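/- Let $A$ be a finite alphabet, $A^+$ the set of nonempty finite words and $A^\infty$ the set of infinite words over $A$. An $\omega$-semigroup $(S_+,S_\infty)$ is a semigroup $S_+$ together with a set $S_\infty$, a mixed product $S_+\times S_\infty\to S_\infty$ and an infinite product mapping sequences in $S_+$ to $S_\infty$, satisfying all forms of associativity; $(A^+,A^\infty)$ with concatenation is one, and morphisms preserve all the products. Two sets $L_0,L_1\subseteq A^\infty$ are FO-separable if there is a sentence $\varphi$ of first-order logic over infinite words, with a predicate for each letter and the order $<$ on positions, such that every word of $L_0$ and no word of $L_1$ satisfies $\varphi$; then $\varphi$ is said to define a separator. **Theorem.** Let $L_0=\alpha^{-1}(F_0)$ and $L_1=\alpha^{-1}(F_1)$ be (regular) languages of infinite words recognized by a morphism $\alpha:(A^+,A^\infty)\to(S_+,S_\infty)$ into a finite $\omega$-semigroup, where $F_0,F_1\subseteq S_\infty$. The input $(\alpha,F_0,F_1)$ is presented by the tables of the product of $S_+$, of the mixed product and of the map $s\mapsto s^\infty=sss\cdots$, by the images $\alpha(a)$ of the letters $a\in A$, and by the characteristic sequences of $F_0$ and $F_1$. 1. It is decidable in exponential time with respect to $|S_+|$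 whether $L_0$ and $L_1$ are FO-separable. More precisely, there are polynomials $p,q$ and one random access machine (unit cost, with addition and subtraction as arithmetic operations, the input standing in its memory) that decides this for all $A$, $\alpha$, $F_0$, $F_1$ in at most $2^{p(|S_+|)}\,q(|A|)$ steps. 2. When $L_0$ and $L_1$ are FO-separable, one can construct an actual separator defined by a sentence of quantifier rank at most $|A|\cdot 2^{|S_+|^2}+1$: there is a computable function that maps each input $(\alpha,F_0,F_1)$ for which $L_0$ and $L_1$ are FO-separable to (a code of) such a sentence. -/

import Mathlib

/-! ## ω-semigroups -/

/-- The product `s i * s (i+1) * ⋯ * s (i+l)` of `l + 1` consecutive entries of a sequence. -/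
def blockProd {S : Type*} [Semigroup S] (s : Stream' S) (i : ℕ) : ℕ → S
  | 0 => s.get i
  | l + 1 => blockProd s i l * s.get (i + l + 1)

/-- The sequence whose `n`-th entry is the product of the block of `s` made of the positions `j`
with `k n ≤ j < k (n + 1)`; it is used only for strictly increasing `k`. -/
def blocks {S : Type*} [Semigroup S] (s : Stream' S) (k : ℕ → ℕ) : Stream' S :=
  fun n => blockProd s (k n) (k (n + 1) - k n - 1)

/-- An ω-semigroup `(S, T)`: a semigroup `S`, a set `T`, a mixed product `S × T → T` (written `•`)
and an infinite product from sequences in `S` to `T`, with all forms of associativity. -/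
class OmegaSemigroup (S T : Type*) [Semigroup S] extends SemigroupAction S T where
  /-- the infinite product -/
  iprod : Stream' S → T
  smul_iprod (s : S) (f : Stream' S) : s • iprod f = iprod (f.cons s)
  iprod_blocks (f : Stream' S) (k : ℕ → ℕ) (h0 : k 0 = 0) (hk : StrictMono k) :
    iprod (blocks f k) = iprod f

/-- Morphisms of ω-semigroups: they preserve the three products. -/
structure OmegaHom (S T S' T' : Type*) [Semigroup S] [Semigroup S'] [OmegaSemigroup S T]
    [OmegaSemigroup S' T'] where
  /-- the component on finite products -/
  fin : S →ₙ* S'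
  /-- the component on infinite products -/
  inf : T → T'
  map_smul (s : S) (t : T) : inf (s • t) = fin s • inf t
  map_iprod (f : Stream' S) : inf (OmegaSemigroup.iprod f) = OmegaSemigroup.iprod (f.map fin)

/-! ## Words: `FreeSemigroup A` is the set of nonempty finite words over `A`, and `Stream' A` is
the set of infinite words. Together they form an ω-semigroup. -/

namespace Word

variable {A : Type*}

/-- The list of letters of a nonempty finite word. -/
def letters (u : FreeSemigroup A) : List A := u.head :: u.tail

theorem letters_mul (u v : FreeSemigroup A) : letters (u * v) = letters u ++ letters v := rfl

theorem letters_pos (u : FreeSemigroup A) : 0 < (letters u).length := Nat.succ_pos _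

theorem lt_length_blockProd (u : Stream' (FreeSemigroup A)) (i n : ℕ) :
    n < (letters (blockProd u i n)).length := by
  induction n with
  | zero => exact letters_pos _
  | succ n ih =>
    have := letters_pos (u.get (i + n + 1))
    rw [blockProd, letters_mul, List.length_append]
    omega

/-- The concatenation of infinitely many nonempty words `u 0, u 1, …`: its `n`-th letter is the
`n`-th letter of the finite word `u 0 ⋯ u n`, which has more than `n` letters. -/
def concat (u : Stream' (FreeSemigroup A)) : Stream' A :=
  fun n => (letters (blockProd u 0 n))[n]'(lt_length_blockProd u 0 n)

theorem getElem?_blockProd (u : Stream' (FreeSemigroup A)) (n d : ℕ) :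
    (letters (blockProd u 0 (n + d)))[n]? = some ((concat u).get n) := by
  induction d with
  | zero => exact List.getElem?_eq_getElem (lt_length_blockProd u 0 n)
  | succ d ih =>
    have := lt_length_blockProd u 0 (n + d)
    rw [← Nat.add_assoc, blockProd, letters_mul, List.getElem?_append_left (by omega), ih]

theorem blockProd_append {S : Type*} [Semigroup S] (s : Stream' S) (i l m : ℕ) :
    blockProd s i (l + 1 + m) = blockProd s i l * blockProd s (i + l + 1) m := by
  induction m with
  | zero => rfl
  | succ m ih =>
    rw [← Nat.add_assoc, blockProd, ih, blockProd, mul_assoc]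
    congr 3
    omega

theorem blockProd_blocks {S : Type*} [Semigroup S] (s : Stream' S) (k : ℕ → ℕ) (h0 : k 0 = 0)
    (hk : StrictMono k) (n : ℕ) :
    blockProd (blocks s k) 0 n = blockProd s 0 (k (n + 1) - 1) := by
  induction n with
  | zero =>
    change blockProd s (k 0) (k (0 + 1) - k 0 - 1) = _
    rw [h0, Nat.sub_zero]
  | succ n ih =>
    have h1 := hk (Nat.lt_add_one n)
    have h2 := hk (Nat.lt_add_one (n + 1))
    rw [blockProd, ih]
    change _ * blockProd s (k (0 + n + 1)) (k (0 + n + 1 + 1) - k (0 + n + 1) - 1) = _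
    rw [Nat.zero_add]
    have e1 : k (n + 1) = 0 + (k (n + 1) - 1) + 1 := by omega
    have e2 : k (n + 1 + 1) - 1 = (k (n + 1) - 1) + 1 + (k (n + 1 + 1) - k (n + 1) - 1) := by omega
    rw [e2, blockProd_append, ← e1]

theorem blockProd_cons {S : Type*} [Semigroup S] (s : Stream' S) (a : S) (n : ℕ) :
    blockProd (s.cons a) 0 (n + 1) = a * blockProd s 0 n := by
  induction n with
  | zero => rfl
  | succ n ih =>
    rw [blockProd, ih, blockProd, mul_assoc]
    congr 2

instance : OmegaSemigroup (FreeSemigroup A) (Stream' A) where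
  smul u w := letters u ++ₛ w
  mul_smul u v w := Stream'.append_append_stream (letters u) (letters v) w
  iprod := concat
  smul_iprod u f := by
    change letters u ++ₛ concat f = concat (f.cons u)
    refine Stream'.ext fun n => Option.some_injective _ ?_
    rw [← getElem?_blockProd (f.cons u) n 1, blockProd_cons, letters_mul]
    rcases Nat.lt_or_ge n (letters u).length with h | h
    · rw [Stream'.get_append_left _ _ _ h, List.getElem?_append_left h, List.getElem?_eq_getElem h]
    · obtain ⟨d, rfl⟩ := Nat.exists_eq_add_of_le h
      rw [Stream'.get_append_right, List.getElem?_append_right h, Nat.add_sub_cancel_left,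
        Nat.add_comm, getElem?_blockProd]
  iprod_blocks f k h0 hk := by
    refine Stream'.ext fun n => Option.some_injective _ ?_
    have h := hk.le_apply (x := n + 1)
    obtain ⟨d, hd⟩ := Nat.exists_eq_add_of_le (show n ≤ k (n + 1) - 1 by omega)
    rw [← getElem?_blockProd (blocks f k) n 0, Nat.add_zero, blockProd_blocks f k h0 hk, hd,
      getElem?_blockProd]

end Word

/-! ## First-order logic over infinite words -/

namespace FOWord

open FirstOrder

/-- The relation symbols: a unary predicate for each letter, and the binary symbol `<`. -/
inductive Rel (A : Type*) : ℕ → Type _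
  | letter (a : A) : Rel A 1
  | lt : Rel A 2

/-- The signature of `FO(<)` on words over `A`. -/
def lang (A : Type*) : Language := ⟨fun _ => Empty, Rel A⟩

variable {A : Type*}

/-- An infinite word as a structure whose domain is its set `ℕ` of positions. -/
@[reducible] def structureOf (w : Stream' A) : (lang A).Structure ℕ where
  funMap f := nomatch f
  RelMap R x := match R, x with
    | .letter a, x => w.get (x 0) = a
    | .lt, x => x 0 < x 1

/-- The infinite word `w` satisfies the sentence `φ`. -/
def Models (w : Stream' A) (φ : (lang A).Sentence) : Prop :=
  letI := structureOf w
  ℕ ⊨ φ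

/-- The quantifier rank (the connectives are `⊥` and `→`, and `∃` is `¬ ∀ ¬`). -/
def qrank : {n : ℕ} → (lang A).BoundedFormula Empty n → ℕ
  | _, .falsum => 0
  | _, .equal _ _ => 0
  | _, .rel _ _ => 0
  | _, .imp φ ψ => max (qrank φ) (qrank ψ)
  | _, .all φ => qrank φ + 1

/-- The set of infinite words defined by a sentence. -/
def langOf (φ : (lang A).Sentence) : Set (Stream' A) := {w | Models w φ}

/-- `K` separates `L₀` from `L₁`. -/
def Separates (K L₀ L₁ : Set (Stream' A)) : Prop := L₀ ⊆ K ∧ L₁ ∩ K = ∅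

/-- `L₀` and `L₁` are separable by a first-order definable language. -/
def Separable (L₀ L₁ : Set (Stream' A)) : Prop :=
  ∃ φ : (lang A).Sentence, Separates (langOf φ) L₀ L₁

/-- The index of a variable (the terms of the signature are variables). -/
def varIndex {n : ℕ} : (lang A).Term (Empty ⊕ Fin n) → ℕ
  | .var (.inr i) => i

/-- The code of an atomic formula. -/
def relCode (c : A → ℕ) {l : ℕ} (R : Rel A l) (x : Fin l → ℕ) : List ℕ :=
  match R, x with
  | .letter a, x => [2, c a, x 0]
  | .lt, x => [3, x 0, x 1]

/-- Formulas written out in Polish notation as lists of numbers, `c` being a numbering of the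
letters; bound variables are numbered from the outside. -/
def code (c : A → ℕ) : {n : ℕ} → (lang A).BoundedFormula Empty n → List ℕ
  | _, .falsum => [0]
  | _, .equal s t => [1, varIndex s, varIndex t]
  | _, .rel R ts => relCode c R fun i => varIndex (ts i)
  | _, .imp φ ψ => 4 :: (code c φ ++ code c ψ)
  | _, .all φ => 5 :: code c φ

end FOWord

/-! ## Random access machines -/

namespace RAM

/-- A state: the values of the program's registers, and an addressable memory. -/
@[ext] structure State where
  /-- the registers -/
  reg : ℕ → ℕ
  /-- the memory -/
  mem : ℕ → ℕ

/-- Write `v` into register `x`. -/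
def State.setReg (s : State) (x v : ℕ) : State := { s with reg := Function.update s.reg x v }

/-- Write `v` into the memory cell with address `a`. -/
def State.setMem (s : State) (a v : ℕ) : State := { s with mem := Function.update s.mem a v }

/-- Structured programs of a random access machine with addition and (truncated) subtraction as
arithmetic operations. There is no multiplication, so that unit-cost time is polynomially related
to the time of Turing machines. -/
inductive Prog
  /-- `reg x := c` -/
  | const (x c : ℕ)
  /-- `reg x := reg y + reg z` -/
  | add (x y z : ℕ)
  /-- `reg x := reg y - reg z` -/
  | sub (x y z : ℕ)
  /-- `reg x := mem (reg y)` -/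
  | load (x y : ℕ)
  /-- `mem (reg x) := reg y` -/
  | store (x y : ℕ)
  /-- `P`, then `Q` -/
  | seq (P Q : Prog)
  /-- if `reg x ≠ 0` then `P` else `Q` -/
  | cond (x : ℕ) (P Q : Prog)
  /-- while `reg x ≠ 0` do `P` -/
  | loop (x : ℕ) (P : Prog)

/-- `Runs P s t s'`: started in state `s`, the program `P` halts in state `s'` after exactly `t`
steps, where every elementary instruction and every test is one step. -/
inductive Runs : Prog → State → ℕ → State → Prop
  | const (x c : ℕ) (s : State) : Runs (.const x c) s 1 (s.setReg x c)
  | add (x y z : ℕ) (s : State) : Runs (.add x y z) s 1 (s.setReg x (s.reg y + s.reg z))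
  | sub (x y z : ℕ) (s : State) : Runs (.sub x y z) s 1 (s.setReg x (s.reg y - s.reg z))
  | load (x y : ℕ) (s : State) : Runs (.load x y) s 1 (s.setReg x (s.mem (s.reg y)))
  | store (x y : ℕ) (s : State) : Runs (.store x y) s 1 (s.setMem (s.reg x) (s.reg y))
  | seq {P Q : Prog} {s s' s'' : State} {t t' : ℕ} :
      Runs P s t s' → Runs Q s' t' s'' → Runs (.seq P Q) s (t + t') s''
  | cond_true {x : ℕ} {P Q : Prog} {s s' : State} {t : ℕ} :
      s.reg x ≠ 0 → Runs P s t s' → Runs (.cond x P Q) s (t + 1) s'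
  | cond_false {x : ℕ} {P Q : Prog} {s s' : State} {t : ℕ} :
      s.reg x = 0 → Runs Q s t s' → Runs (.cond x P Q) s (t + 1) s'
  | loop_false {x : ℕ} {P : Prog} {s : State} : s.reg x = 0 → Runs (.loop x P) s 1 s
  | loop_true {x : ℕ} {P : Prog} {s s' s'' : State} {t t' : ℕ} :
      s.reg x ≠ 0 → Runs P s t s' → Runs (.loop x P) s' t' s'' →
      Runs (.loop x P) s (t + t' + 1) s''

theorem Runs.unique {P : Prog} {s s₁ s₂ : State} {t₁ t₂ : ℕ} (h₁ : Runs P s t₁ s₁)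
    (h₂ : Runs P s t₂ s₂) : t₁ = t₂ ∧ s₁ = s₂ := by
  induction h₁ generalizing t₂ s₂ with
  | const | add | sub | load | store => cases h₂; exact ⟨rfl, rfl⟩
  | seq _ _ ih ih' =>
    cases h₂ with
    | seq a b => obtain ⟨rfl, rfl⟩ := ih a; obtain ⟨rfl, rfl⟩ := ih' b; exact ⟨rfl, rfl⟩
  | cond_true h _ ih =>
    cases h₂ with
    | cond_true _ a => obtain ⟨rfl, rfl⟩ := ih a; exact ⟨rfl, rfl⟩
    | cond_false h' _ => exact absurd h' h
  | cond_false h _ ih =>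
    cases h₂ with
    | cond_true h' _ => exact absurd h h'
    | cond_false _ a => obtain ⟨rfl, rfl⟩ := ih a; exact ⟨rfl, rfl⟩
  | loop_false h =>
    cases h₂ with
    | loop_false => exact ⟨rfl, rfl⟩
    | loop_true h' _ _ => exact absurd h h'
  | loop_true h _ _ ih ih' =>
    cases h₂ with
    | loop_false h' => exact absurd h' h
    | loop_true _ a b => obtain ⟨rfl, rfl⟩ := ih a; obtain ⟨rfl, rfl⟩ := ih' b; exact ⟨rfl, rfl⟩

/-- The initial state on an input list: the list stands in memory from address `0` on, register `0`
holds its length, and everything else is `0`. -/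
def init (l : List ℕ) : State where
  reg x := if x = 0 then l.length else 0
  mem i := l.getD i 0

/-- On input `l`, the program `P` halts within `b` steps, and it accepts (that is, register `0`
is not `0` at the end) if and only if `p` holds. -/
def DecidesWithin (P : Prog) (l : List ℕ) (b : ℕ) (p : Prop) : Prop :=
  ∃ (t : ℕ) (s : State), Runs P (init l) t s ∧ t ≤ b ∧ (s.reg 0 ≠ 0 ↔ p)

end RAM

/-! ## Inputs -/

open Classical in
/-- The list of numbers that presents a morphism `α` from the words over a finite alphabet `A` to a
finite ω-semigroup `(S, T)` and two subsets of `T`, once the elements of `A`, `S` and `T` are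
numbered. It consists of the sizes of `S`, `T`, `A`, the tables of the product, of the mixed product
and of the infinite power `s ↦ s s s ⋯`, the images of the letters, and the characteristic
sequences of the subsets. -/
noncomputable def presentation {A S T : Type*} [Semigroup S] [OmegaSemigroup S T] {n m k : ℕ}
    (eA : A ≃ Fin n) (eS : S ≃ Fin m) (eT : T ≃ Fin k)
    (α : OmegaHom (FreeSemigroup A) (Stream' A) S T) (F₀ F₁ : Set T) : List ℕ :=
  [m, k, n]
  ++ ((List.finRange m).flatMap fun i => (List.finRange m).map fun j =>
      (eS (eS.symm i * eS.symm j) : ℕ))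
  ++ ((List.finRange m).flatMap fun i => (List.finRange k).map fun j =>
      (eT (eS.symm i • eT.symm j) : ℕ))
  ++ ((List.finRange m).map fun i =>
      (eT (OmegaSemigroup.iprod (Stream'.const (eS.symm i))) : ℕ))
  ++ ((List.finRange n).map fun a => (eS (α.fin (FreeSemigroup.of (eA.symm a))) : ℕ))
  ++ ((List.finRange k).map fun j => if eT.symm j ∈ F₀ then 1 else 0)
  ++ ((List.finRange k).map fun j => if eT.symm j ∈ F₁ then 1 else 0)

set_option linter.unusedSectionVars false


/-! The rank-`k` type of a word collects, over all its factorizations `x a y`, the letter `a` with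
the types of rank `k - 1` of `x` and `y`. A sentence of quantifier rank `k` does not distinguish two
words of the same type of rank `k + 2` (`models_iff_of_tp`), and conversely the rank-`k` type of a
word `u v v v ⋯` is defined by a sentence of rank `k` (`holds_hint`). Hence the languages are
separable if and only if, for some `k`, no rank-`k` type meets both. It remains to bound `k` and to
decide the condition.

Both go through the saturation `IsSat`: the least family of subsets of `S` that contains the
singletons of the images of the letters and is closed under products and under `X ↦ X ^ (N + 1) ∪ ⋯
∪ X ^ (2 N)`, where `N = 2 ^ |S|`. At every rank, the elements of a set of the saturation are values
of words of one common type, because a fixed rank does not tell large powers apart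
(`IsSat.exists_words`). Conversely, already at rank `2 * 2 ^ |S| + 1`, the values of all words of
one type lie in one set of the saturation (`exists_isSat_of_tp`).

This converse is the heart of the proof. It is an instance of a statement on finite monoids of
sup-preserving maps (`Arr.exists_dominating`): all words of maps of the same type act below a single
map of the monoid. The words are read as paths between images of maps. Stretches of arrows that can
be undone (tight arrows) lie below one connecting map; the other (loose) arrows, taken in
consecutive pairs, form a path between images of smaller height, whose type costs two ranks.
Induction on the height concludes.

By Ramsey's theorem the value of an infinite word is some `x e e e ⋯`, and two infinite words whose
types of rank `r + 5` agree have such factorizations with the same types of rank `r`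
(`exists_factorizations`). So the languages are separable if and only if no `x e e e ⋯` in `F₀` and
`y f f f ⋯` in `F₁` have `x, y` in one set of the saturation and `e, f` in one set
(`separable_iff`). A separator is the disjunction of the sentences for the types of the words `u v v
v ⋯` with value in `F₀`, where short `u` and `v` suffice (`exists_lasso`). The machine computes the
saturation with sets coded as binary numbers, in time polynomial in `2 * 2 ^ |S| + |A|`. -/

/-! ## Rank types of finite and infinite words -/

/-- The set of possible rank-`k` types of words over `A`. -/
def Ty.{u} (A : Type u) : ℕ → Type u
  | 0 => PUnit.{u + 1}
  | k + 1 => Set (Ty A k × A × Ty A k)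

/-- Finite or infinite words. -/
inductive Wd (A : Type*)
  | fin (l : List A)
  | inf (s : Stream' A)

namespace Wd

variable {A B : Type*}

/-- Prepend a finite word. -/
def app (x : List A) : Wd A → Wd A
  | fin l => fin (x ++ l)
  | inf s => inf (x ++ₛ s)

/-- Prepend a letter. -/
def cons (a : A) (w : Wd A) : Wd A := app [a] w

theorem app_app (x y : List A) (w : Wd A) : app (x ++ y) w = app x (app y w) := by
  cases w <;> simp [app]

@[simp] theorem app_nil (w : Wd A) : app [] w = w := by cases w <;> simp [app]

theorem app_cons (a : A) (x : List A) (w : Wd A) : app (a :: x) w = cons a (app x w) :=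
  app_app [a] x w

@[simp] theorem app_fin (x y : List A) : app x (fin y) = fin (x ++ y) := rfl

@[simp] theorem app_inf (x : List A) (y : Stream' A) : app x (inf y) = inf (x ++ₛ y) := rfl

@[simp] theorem cons_fin (a : A) (y : List A) : cons a (fin y) = fin (a :: y) := rfl

theorem cons_inf (a : A) (y : Stream' A) : cons a (inf y) = inf (y.cons a) := rfl

theorem cons_inj {a b : A} {w w' : Wd A} : cons a w = cons b w' ↔ a = b ∧ w = w' := by
  cases w <;> cases w' <;> simp [cons_fin, cons_inf]
  exact ⟨fun h => ⟨congrArg Stream'.head h, congrArg Stream'.tail h⟩, fun h => by rw [h.1, h.2]⟩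

theorem cons_ne_nil (a : A) (w : Wd A) : cons a w ≠ fin [] := by
  cases w <;> simp [cons_fin, cons_inf]

theorem app_eq_app_cons {u x : List A} {a : A} {v y : Wd A} :
    app u v = app x (cons a y) ↔
      (∃ z, u = x ++ a :: z ∧ y = app z v) ∨ ∃ z, x = u ++ z ∧ v = app z (cons a y) := by
  induction u generalizing x with
  | nil => simp
  | cons b u ih =>
    cases x with
    | nil =>
      simp only [app_cons, app_nil, cons_inj, List.nil_append, List.cons.injEq]
      constructor
      · rintro ⟨rfl, rfl⟩; exact Or.inl ⟨u, ⟨rfl, rfl⟩, rfl⟩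
      · rintro (⟨z, ⟨rfl, rfl⟩, rfl⟩ | ⟨z, h, -⟩)
        · exact ⟨rfl, rfl⟩
        · simp at h
    | cons c x =>
      simp only [app_cons, cons_inj, ih, List.cons_append, List.cons.injEq]
      grind

theorem fin_eq_app_cons {u x : List A} {a : A} {y : Wd A} :
    fin u = app x (cons a y) ↔ ∃ z, u = x ++ a :: z ∧ y = fin z := by
  cases y <;> simp [cons_inf]

theorem inf_eq_app_cons {u : Stream' A} {x : List A} {a : A} {y : Wd A} :
    inf u = app x (cons a y) ↔ ∃ z : Stream' A, u = x ++ₛ z.cons a ∧ y = inf z := by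
  cases y <;> simp [cons_inf]

/-- The rank-`k` type of a word. -/
def tp : (k : ℕ) → Wd A → Ty A k
  | 0, _ => PUnit.unit
  | k + 1, w => ({z | ∃ x a y, w = app x (cons a y) ∧ z = (tp k (fin x), a, tp k y)} : Set _)

/-- One half of the equality of types of rank `k + 1`. -/
def Sub (k : ℕ) (w w' : Wd A) : Prop :=
  ∀ x a y, w = app x (cons a y) →
    ∃ x' y', w' = app x' (cons a y') ∧ tp k (fin x) = tp k (fin x') ∧ tp k y = tp k y'

theorem tp_succ_iff {k : ℕ} {w w' : Wd A} :
    tp (k + 1) w = tp (k + 1) w' ↔ Sub k w w' ∧ Sub k w' w := by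
  constructor
  · intro h
    have key : ∀ w w' : Wd A, tp (k + 1) w = tp (k + 1) w' → Sub k w w' := by
      intro w w' h x a y hw
      have : (tp k (fin x), a, tp k y) ∈
          ({z | ∃ x a y, w' = app x (cons a y) ∧ z = (tp k (fin x), a, tp k y)} : Set _) := by
        have h' : ({z | ∃ x a y, w = app x (cons a y) ∧ z = (tp k (fin x), a, tp k y)} : Set _)
          = {z | ∃ x a y, w' = app x (cons a y) ∧ z = (tp k (fin x), a, tp k y)} := h
        rw [← h']
        exact ⟨x, a, y, hw, rfl⟩
      obtain ⟨x', a', y', hw', he⟩ := this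
      simp only [Prod.mk.injEq] at he
      obtain ⟨h1, rfl, h2⟩ := he
      exact ⟨x', y', hw', h1, h2⟩
    exact ⟨key _ _ h, key _ _ h.symm⟩
  · rintro ⟨h1, h2⟩
    refine Set.ext fun z => ⟨?_, ?_⟩
    · rintro ⟨x, a, y, hw, rfl⟩
      obtain ⟨x', y', hw', e1, e2⟩ := h1 x a y hw
      exact ⟨x', a, y', hw', by rw [e1, e2]⟩
    · rintro ⟨x, a, y, hw, rfl⟩
      obtain ⟨x', y', hw', e1, e2⟩ := h2 x a y hw
      exact ⟨x', a, y', hw', by rw [e1, e2]⟩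

theorem tp_sub {k : ℕ} {w w' : Wd A} (h : tp (k + 1) w = tp (k + 1) w') : Sub k w w' :=
  (tp_succ_iff.1 h).1

theorem tp_of_succ {k : ℕ} {w w' : Wd A} (h : tp (k + 1) w = tp (k + 1) w') :
    tp k w = tp k w' := by
  induction k generalizing w w' with
  | zero => rfl
  | succ k ih =>
    have key : ∀ w w' : Wd A, tp (k + 1 + 1) w = tp (k + 1 + 1) w' → Sub k w w' := by
      intro w w' h x a y hw
      obtain ⟨x', y', hw', e1, e2⟩ := tp_sub h x a y hw
      exact ⟨x', y', hw', ih e1, ih e2⟩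
    exact tp_succ_iff.2 ⟨key _ _ h, key _ _ h.symm⟩

theorem tp_mono {k l : ℕ} (hkl : k ≤ l) {w w' : Wd A} (h : tp l w = tp l w') :
    tp k w = tp k w' := by
  induction l, hkl using Nat.le_induction with
  | base => exact h
  | succ l _ ih => exact ih (tp_of_succ h)

/-- Types are a congruence for concatenation: the chosen letter lies in one of the two factors, and
the other factor is carried along at a lower rank. -/
theorem tp_app {k : ℕ} {u u' : List A} {v v' : Wd A} (hu : tp k (fin u) = tp k (fin u'))
    (hv : tp k v = tp k v') : tp k (app u v) = tp k (app u' v') := by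
  induction k generalizing u u' v v' with
  | zero => rfl
  | succ k ih =>
    have key : ∀ (u u' : List A) (v v' : Wd A), tp (k + 1) (fin u) = tp (k + 1) (fin u') →
        tp (k + 1) v = tp (k + 1) v' → Sub k (app u v) (app u' v') := by
      intro u u' v v' hu hv x a y hw
      rcases app_eq_app_cons.1 hw with ⟨z, rfl, rfl⟩ | ⟨z, rfl, rfl⟩
      · obtain ⟨x', y', hw', e1, e2⟩ := tp_sub hu x a (fin z) rfl
        obtain ⟨z', rfl, rfl⟩ := fin_eq_app_cons.1 hw'
        refine ⟨x', app z' v', ?_, e1, ih e2 (tp_of_succ hv)⟩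
        rw [app_app, app_cons]
      · obtain ⟨x', y', rfl, e1, e2⟩ := tp_sub hv z a y rfl
        refine ⟨u' ++ x', y', (app_app _ _ _).symm, ?_, e2⟩
        exact ih (v := fin z) (v' := fin x') (tp_of_succ hu) e1
    exact tp_succ_iff.2 ⟨key _ _ _ _ hu hv, key _ _ _ _ hu.symm hv.symm⟩

theorem tp_append {k : ℕ} {u u' v v' : List A} (hu : tp k (fin u) = tp k (fin u'))
    (hv : tp k (fin v) = tp k (fin v')) : tp k (fin (u ++ v)) = tp k (fin (u' ++ v')) :=
  tp_app (v := fin v) (v' := fin v') hu hv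

theorem eq_nil_of_tp {k : ℕ} {w : Wd A} (h : tp (k + 1) w = tp (k + 1) (fin [])) :
    w = fin [] := by
  by_contra hw
  have : ∃ a y, w = app [] (cons a y) := by
    rcases w with (_ | ⟨a, l⟩) | s
    · exact absurd rfl hw
    · exact ⟨a, fin l, rfl⟩
    · exact ⟨s.head, inf s.tail, by rw [app_nil, cons_inf]; exact congrArg inf (Stream'.eta s).symm⟩
  obtain ⟨a, y, hy⟩ := this
  obtain ⟨x', y', h', -⟩ := tp_sub h _ _ _ hy
  rw [fin_eq_app_cons] at h'
  obtain ⟨z, hz, -⟩ := h'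
  simp at hz

/-- The first letter is determined by the type. -/
theorem tp_cons {k : ℕ} {a : A} {y w : Wd A} (h : tp (k + 2) (cons a y) = tp (k + 2) w) :
    ∃ y', w = cons a y' ∧ tp (k + 1) y = tp (k + 1) y' := by
  obtain ⟨x', y', rfl, e1, e2⟩ := tp_sub h [] a y (app_nil _).symm
  have := eq_nil_of_tp e1.symm
  obtain rfl : x' = [] := by simpa using this
  exact ⟨y', app_nil _, e2⟩

/-- The last letter is determined by the type. -/
theorem tp_concat {k : ℕ} {a : A} {x w : List A}
    (h : tp (k + 2) (fin (x ++ [a])) = tp (k + 2) (fin w)) :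
    ∃ x', w = x' ++ [a] ∧ tp (k + 1) (fin x) = tp (k + 1) (fin x') := by
  obtain ⟨x', y', hw, e1, e2⟩ := tp_sub h x a (fin []) rfl
  obtain rfl := eq_nil_of_tp e2.symm
  exact ⟨x', by simpa using hw, e1⟩

/-- A factorization of a word can be copied to a word of the same type. -/
theorem tp_cut {k : ℕ} {x : List A} {y w : Wd A} (hy : y ≠ fin [])
    (h : tp (k + 1) (app x y) = tp (k + 1) w) :
    ∃ x' y', w = app x' y' ∧ tp k (fin x) = tp k (fin x') ∧ tp k y = tp k y' := by
  have : ∃ a z, y = cons a z := by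
    rcases y with (_ | ⟨a, l⟩) | s
    · exact absurd rfl hy
    · exact ⟨a, fin l, rfl⟩
    · exact ⟨s.head, inf s.tail, by rw [cons_inf]; exact congrArg inf (Stream'.eta s).symm⟩
  obtain ⟨a, z, rfl⟩ := this
  obtain ⟨x', y', rfl, e1, e2⟩ := tp_sub h x a z rfl
  exact ⟨x', cons a y', rfl, e1, tp_app (u := [a]) (u' := [a]) rfl e2⟩

/-- Deleting letters costs no rank, because a factorization of the filtered word at `a` lifts to a
factorization of the original word at `a`. -/
theorem tp_filter (p : A → Bool) {k : ℕ} {u v : List A} (h : tp k (fin u) = tp k (fin v)) :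
    tp k (fin (u.filter p)) = tp k (fin (v.filter p)) := by
  induction k generalizing u v with
  | zero => rfl
  | succ k ih =>
    have key : ∀ u v : List A, tp (k + 1) (fin u) = tp (k + 1) (fin v) →
        Sub k (fin (u.filter p)) (fin (v.filter p)) := by
      intro u v h x a y hw
      obtain ⟨z, hz, rfl⟩ := fin_eq_app_cons.1 hw
      obtain ⟨l₁, l₂, rfl, rfl, h₂⟩ := List.filter_eq_append_iff.1 hz
      obtain ⟨l₃, l₄, rfl, h₃, hpa, rfl⟩ := List.filter_eq_cons_iff.1 h₂
      obtain ⟨x', y', hv, e1, e2⟩ := tp_sub h (l₁ ++ l₃) a (fin l₄) (by simp)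
      obtain ⟨z', rfl, rfl⟩ := fin_eq_app_cons.1 hv
      refine ⟨x'.filter p, fin (z'.filter p), ?_, ?_, ih e2⟩
      · simp [hpa]
      · rw [← ih e1, List.filter_append, List.filter_eq_nil_iff.2 h₃, List.append_nil]
    exact tp_succ_iff.2 ⟨key _ _ h, key _ _ h.symm⟩

/-- The images of the pairs of consecutive letters. -/
def pairs (δ : A → A → B) : List A → List B
  | a :: b :: l => δ a b :: pairs δ (b :: l)
  | _ => []

theorem pairs_append (δ : A → A → B) (x : List A) (b : A) (y : List A) :
    pairs δ (x ++ b :: y) = pairs δ (x ++ [b]) ++ pairs δ (b :: y) := by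
  induction x with
  | nil => simp [pairs]
  | cons a x ih =>
    cases x with
    | nil => simp [pairs]
    | cons c x => simpa [pairs] using ih

theorem pairs_eq_append_cons {δ : A → A → B} {N : List A} {x : List B} {c : B} {y : List B}
    (h : pairs δ N = x ++ c :: y) :
    ∃ u a b v, N = u ++ a :: b :: v ∧ pairs δ (u ++ [a]) = x ∧ c = δ a b ∧
      pairs δ (b :: v) = y := by
  induction x generalizing N with
  | nil =>
    match N, h with
    | a :: b :: l, h =>
      simp only [pairs, List.nil_append, List.cons.injEq] at h
      exact ⟨[], a, b, l, rfl, rfl, h.1.symm, h.2⟩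
  | cons d x ih =>
    match N, h with
    | a :: b :: l, h =>
      simp only [pairs, List.cons_append, List.cons.injEq] at h
      obtain ⟨u, a', b', v, hN, h1, h2, h3⟩ := ih h.2
      refine ⟨a :: u, a', b', v, by rw [hN]; rfl, ?_, h2, h3⟩
      cases u with
      | nil => simp_all [pairs]
      | cons e u =>
        simp only [List.cons_append, List.cons.injEq] at hN
        obtain ⟨rfl, hN⟩ := hN
        simp only [List.cons_append, pairs]
        rw [← h1, h.1]; rfl

/-- A letter of the word of pairs is a chosen letter `a` together with the first letter of the
suffix behind it. `tp_cons` reads that letter off a suffix type of rank at least `2`, hence the loss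
of two ranks. -/
theorem tp_pairs (δ : A → A → B) {k : ℕ} {u v : List A}
    (h : tp (k + 2) (fin u) = tp (k + 2) (fin v)) :
    tp k (fin (pairs δ u)) = tp k (fin (pairs δ v)) := by
  induction k generalizing u v with
  | zero => rfl
  | succ k ih =>
    have key : ∀ u v : List A, tp (k + 1 + 2) (fin u) = tp (k + 1 + 2) (fin v) →
        Sub k (fin (pairs δ u)) (fin (pairs δ v)) := by
      intro u v h x c y hw
      obtain ⟨z, hz, rfl⟩ := fin_eq_app_cons.1 hw
      obtain ⟨l, a, b, r, rfl, rfl, rfl, rfl⟩ := pairs_eq_append_cons hz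
      obtain ⟨l', y', hv, e1, e2⟩ := tp_sub h l a (fin (b :: r)) rfl
      obtain ⟨z', rfl, rfl⟩ := fin_eq_app_cons.1 hv
      obtain ⟨y'', hy'', -⟩ := tp_cons (a := b) (y := fin r) e2
      rw [← app_nil (cons b y'')] at hy''
      obtain ⟨r', hr', -⟩ := fin_eq_app_cons.1 hy''
      rw [List.nil_append] at hr'
      subst hr'
      refine ⟨pairs δ (l' ++ [a]), fin (pairs δ (b :: r')), ?_, ih (tp_append e1 rfl), ih e2⟩
      rw [pairs_append]
      rfl
    exact tp_succ_iff.2 ⟨key _ _ h, key _ _ h.symm⟩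

/-! ### Powers and infinite products -/

/-- Factors of equal type act like the points of an unlabelled finite order, and rank `k` counts
these only up to `2 ^ k - 1`. -/
theorem tp_flatten {k : ℕ} {L L' : List (List A)} {v : List A}
    (hL : ∀ u ∈ L, tp k (fin u) = tp k (fin v)) (hL' : ∀ u ∈ L', tp k (fin u) = tp k (fin v))
    (h : L.length = L'.length ∨ 2 ^ k ≤ L.length + 1 ∧ 2 ^ k ≤ L'.length + 1) :
    tp k (fin L.flatten) = tp k (fin L'.flatten) := by
  induction k generalizing L L' v with
  | zero => rfl
  | succ k ih =>
    have key : ∀ L L' : List (List A), (∀ u ∈ L, tp (k + 1) (fin u) = tp (k + 1) (fin v)) →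
        (∀ u ∈ L', tp (k + 1) (fin u) = tp (k + 1) (fin v)) →
        (L.length = L'.length ∨ 2 ^ (k + 1) ≤ L.length + 1 ∧ 2 ^ (k + 1) ≤ L'.length + 1) →
        Sub k (fin L.flatten) (fin L'.flatten) := by
      intro L L' hL hL' h x a y hw
      obtain ⟨z, hz, rfl⟩ := fin_eq_app_cons.1 hw
      obtain ⟨M₁, b, x₀, z₀, M₂, rfl, rfl, rfl, rfl⟩ :
          ∃ (M₁ : List (List A)) (b : List A) (x₀ z₀ : List A) (M₂ : List (List A)),
            L = M₁ ++ b :: M₂ ∧ b = x₀ ++ a :: z₀ ∧ x = M₁.flatten ++ x₀ ∧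
            z = z₀ ++ M₂.flatten := by
        clear hL h hw
        induction L generalizing x with
        | nil => simp at hz
        | cons b L ihL =>
          have hz' : app b (fin L.flatten) = app x (Wd.cons a (fin z)) := by simpa using hz
          rcases app_eq_app_cons.1 hz' with ⟨t, rfl, ht⟩ | ⟨t, rfl, ht⟩
          · exact ⟨[], _, x, t, L, rfl, rfl, rfl, by simpa using ht⟩
          · obtain ⟨M₁, b', x₀, z₀, M₂, rfl, rfl, rfl, rfl⟩ := ihL t (by simpa using ht)
            exact ⟨b :: M₁, _, x₀, z₀, M₂, rfl, rfl, by simp, rfl⟩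
      -- The factor of `L'` that answers: the same index if the lengths agree or the left side is
      -- short, the same distance from the end if the right side is short, and otherwise `2 ^ k -
      -- 1`, which leaves enough factors on both sides.
      obtain ⟨i, hi, hi1, hi2⟩ : ∃ i < L'.length,
          (M₁.length = i ∨ 2 ^ k ≤ M₁.length + 1 ∧ 2 ^ k ≤ i + 1) ∧
          (M₂.length = L'.length - (i + 1) ∨
            2 ^ k ≤ M₂.length + 1 ∧ 2 ^ k ≤ L'.length - (i + 1) + 1) := by
        simp only [List.length_append, List.length_cons, pow_succ] at h
        have : 0 < 2 ^ k := by positivity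
        rcases h with h | h
        · exact ⟨M₁.length, by omega, by omega, by omega⟩
        · by_cases h1 : M₁.length + 1 < 2 ^ k
          · exact ⟨M₁.length, by omega, by omega, by omega⟩
          · by_cases h2 : M₂.length + 1 < 2 ^ k
            · exact ⟨L'.length - (M₂.length + 1), by omega, by omega, by omega⟩
            · exact ⟨2 ^ k - 1, by omega, by omega, by omega⟩
      have e : L' = L'.take i ++ L'[i] :: L'.drop (i + 1) := by simp
      have hb := (hL (x₀ ++ a :: z₀) (by simp)).trans (hL' L'[i] (by simp)).symm
      obtain ⟨x', y', hb', e1, e2⟩ := tp_sub hb x₀ a (fin z₀) rfl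
      obtain ⟨z', hb'', rfl⟩ := fin_eq_app_cons.1 hb'
      refine ⟨(L'.take i).flatten ++ x', fin (z' ++ (L'.drop (i + 1)).flatten), ?_, ?_, ?_⟩
      · conv_lhs => rw [e, hb'']
        simp
      · refine tp_append (ih (v := v) ?_ ?_ ?_) e1
        · exact fun u hu => tp_of_succ (hL u (by simp [hu]))
        · exact fun u hu => tp_of_succ (hL' u (List.mem_of_mem_take hu))
        · rw [List.length_take, min_eq_left hi.le]; exact hi1
      · refine tp_append e2 (ih (v := v) ?_ ?_ ?_)
        · exact fun u hu => tp_of_succ (hL u (by simp [hu]))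
        · exact fun u hu => tp_of_succ (hL' u (List.mem_of_mem_drop hu))
        · rw [List.length_drop]; exact hi2
    exact tp_succ_iff.2 ⟨key _ _ hL hL' h, key _ _ hL' hL (h.elim (Or.inl ·.symm) (Or.inr ·.symm))⟩

open Word

theorem concat_cons (f : Stream' (FreeSemigroup A)) :
    concat f = letters f.head ++ₛ concat f.tail := by
  have := OmegaSemigroup.smul_iprod (T := Stream' A) f.head f.tail
  rw [show Stream'.cons f.head f.tail = f from Stream'.eta f] at this
  exact this.symm

theorem concat_split {f : Stream' (FreeSemigroup A)} {x : List A} {a : A} {y : Wd A}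
    (h : inf (concat f) = app x (cons a y)) :
    ∃ b x' z, letters (f.get b) = x' ++ a :: z ∧
      x = ((f.take b).map letters).flatten ++ x' ∧ y = app z (inf (concat (f.drop (b + 1)))) := by
  induction hn : x.length using Nat.strong_induction_on generalizing f x with
  | _ n ih =>
    rw [concat_cons, ← app_inf, app_eq_app_cons] at h
    rcases h with ⟨z, hz, rfl⟩ | ⟨z, rfl, hz⟩
    · exact ⟨0, x, z, hz, by simp, rfl⟩
    · have hp := letters_pos f.head
      have hlt : z.length < n := by
        rw [List.length_append] at hn
        omega
      obtain ⟨b, x', z', h1, rfl, rfl⟩ := ih z.length hlt hz rfl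
      exact ⟨b + 1, x', z', h1, by rw [Stream'.take_succ]; simp, rfl⟩

/-- Only finitely many factors precede the chosen letter; they are handled by `tp_append`, and the
remaining infinite product by induction on the rank. -/
theorem tp_iconcat {k : ℕ} {f f' : Stream' (FreeSemigroup A)}
    (h : ∀ i, tp k (fin (letters (f.get i))) = tp k (fin (letters (f'.get i)))) :
    tp k (inf (concat f)) = tp k (inf (concat f')) := by
  induction k generalizing f f' with
  | zero => rfl
  | succ k ih =>
    have key : ∀ f f' : Stream' (FreeSemigroup A),
        (∀ i, tp (k + 1) (fin (letters (f.get i))) = tp (k + 1) (fin (letters (f'.get i)))) →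
        Sub k (inf (concat f)) (inf (concat f')) := by
      intro f f' h x a y hw
      obtain ⟨b, x', z, h1, rfl, rfl⟩ := concat_split hw
      have hb := h b
      rw [h1] at hb
      obtain ⟨x'', y'', h2, e1, e2⟩ := tp_sub hb x' a (fin z) rfl
      obtain ⟨z', h2', rfl⟩ := fin_eq_app_cons.1 h2
      have hcat : ∀ (n : ℕ) (f : Stream' (FreeSemigroup A)), concat f =
          ((f.take n).map letters).flatten ++ₛ concat (f.drop n) := by
        intro n
        induction n with
        | zero => intro f; rfl
        | succ n ihn =>
          intro f
          rw [concat_cons, ihn f.tail, Stream'.take_succ, List.map_cons, List.flatten_cons,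
            Stream'.append_append_stream]
          rfl
      refine ⟨((f'.take b).map letters).flatten ++ x'',
        app z' (inf (concat (f'.drop (b + 1)))), ?_, tp_append ?_ e1, tp_app e2 (ih ?_)⟩
      · rw [hcat (b + 1) f', Stream'.take_succ', List.map_append, List.flatten_append]
        simp [h2', Stream'.append_append_stream, cons_inf, Stream'.cons_append_stream]
      · clear hcat hw h1 hb h2 h2'
        induction b generalizing f f' with
        | zero => rfl
        | succ b ihb =>
          simp only [Stream'.take_succ, List.map_cons, List.flatten_cons]
          exact tp_append (tp_of_succ (h 0)) (ihb f.tail f'.tail fun i => h (i + 1))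
      · exact fun i => tp_of_succ (h _)
    exact tp_succ_iff.2 ⟨key _ _ h, key _ _ fun i => (h i).symm⟩

end Wd


/-! ## Covering runs of words of the same type -/

namespace Wd

variable {A B : Type*}

/-- Apply a map to every letter. -/
def map (g : A → B) : Wd A → Wd B
  | fin l => fin (l.map g)
  | inf s => inf (s.map g)

theorem map_app (g : A → B) (x : List A) (w : Wd A) : map g (app x w) = app (x.map g) (map g w) := by
  cases w
  · simp [map]
  · simp [map, Stream'.map_append_stream]

theorem map_cons (g : A → B) (a : A) (w : Wd A) : map g (cons a w) = cons (g a) (map g w) :=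
  map_app g [a] w

theorem map_eq_app_cons {g : A → B} {w : Wd A} {x : List B} {c : B} {y : Wd B}
    (h : map g w = app x (cons c y)) :
    ∃ l a r, w = app l (cons a r) ∧ l.map g = x ∧ g a = c ∧ map g r = y := by
  induction x generalizing w with
  | nil =>
    rw [app_nil] at h
    rcases w with (_ | ⟨a, l⟩) | s
    · exact absurd h.symm (cons_ne_nil _ _)
    · have h' : cons (g a) (map g (fin l)) = cons c y := h
      rw [cons_inj] at h'
      exact ⟨[], a, fin l, rfl, rfl, h'.1, h'.2⟩
    · have e : inf s = cons s.head (inf s.tail) := by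
        rw [cons_inf]; exact congrArg inf (Stream'.eta s).symm
      rw [e, map_cons, cons_inj] at h
      exact ⟨[], s.head, inf s.tail, by rw [app_nil, e], rfl, h.1, h.2⟩
  | cons b x ih =>
    rw [app_cons] at h
    rcases w with (_ | ⟨a, l⟩) | s
    · exact absurd h.symm (cons_ne_nil _ _)
    · have h' : cons (g a) (map g (fin l)) = cons b (app x (cons c y)) := h
      rw [cons_inj] at h'
      obtain ⟨l', a', r, h1, h2, h3, h4⟩ := ih h'.2
      refine ⟨a :: l', a', r, ?_, by rw [List.map_cons, h2, h'.1], h3, h4⟩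
      rw [app_cons, ← h1, cons_fin]
    · have e : inf s = cons s.head (inf s.tail) := by
        rw [cons_inf]; exact congrArg inf (Stream'.eta s).symm
      rw [e, map_cons, cons_inj] at h
      obtain ⟨l', a', r, h1, h2, h3, h4⟩ := ih h.2
      refine ⟨s.head :: l', a', r, ?_, by rw [List.map_cons, h2, h.1], h3, h4⟩
      rw [app_cons, ← h1, e]

theorem tp_map (g : A → B) {k : ℕ} {u v : Wd A} (h : tp k u = tp k v) :
    tp k (map g u) = tp k (map g v) := by
  induction k generalizing u v with
  | zero => rfl
  | succ k ih =>
    have key : ∀ u v : Wd A, tp (k + 1) u = tp (k + 1) v → Sub k (map g u) (map g v) := by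
      intro u v h x c y hw
      obtain ⟨l, a, r, rfl, rfl, rfl, rfl⟩ := map_eq_app_cons hw
      obtain ⟨x', y', rfl, e1, e2⟩ := tp_sub h l a r rfl
      exact ⟨x'.map g, map g y', by rw [map_app, map_cons], ih e1, ih e2⟩
    exact tp_succ_iff.2 ⟨key _ _ h, key _ _ h.symm⟩

end Wd

/-! ### Finite monoids of sup-preserving maps and their images -/

namespace Cover

variable {Q : Type*} [SemilatticeSup Q]

/-- A monoid of sup-preserving maps in which the powers of every map that permutes a sup-closed
set are dominated by a single map. -/
structure IsCover (F : Set (Q → Q)) : Prop where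
  id_mem : id ∈ F
  comp_mem {f g : Q → Q} : f ∈ F → g ∈ F → f ∘ g ∈ F
  map_sup {f : Q → Q} : f ∈ F → ∀ x y, f (x ⊔ y) = f x ⊔ f y
  absorb {h : Q → Q} : h ∈ F → ∃ u ∈ F, ∀ X : Set Q, SupClosed X → h '' X = X →
    ∀ x ∈ X, u x ∈ X ∧ x ≤ u x ∧ h x ≤ u x

/-- The images of the maps. -/
def Obj (F : Set (Q → Q)) : Set (Set Q) := Set.range '' F

/-- The preorder on images. -/
def Ge (F : Set (Q → Q)) (X Y : Set Q) : Prop := ∃ f ∈ F, Y ⊆ f '' X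

/-- The two sets are mapped onto each other. -/
def Sim (F : Set (Q → Q)) (X Y : Set Q) : Prop := (∃ f ∈ F, f '' X = Y) ∧ ∃ g ∈ F, g '' Y = X

/-- The number of images strictly below a set. -/
noncomputable def height (F : Set (Q → Q)) (X : Set Q) : ℕ :=
  {Z ∈ Obj F | Ge F X Z ∧ ¬ Ge F Z X}.ncard

variable {F : Set (Q → Q)}

theorem IsCover.mono (hF : IsCover F) {f : Q → Q} (hf : f ∈ F) : Monotone f := fun x y hxy => by
  have := hF.map_sup hf x y
  rw [sup_eq_right.2 hxy] at this
  rw [this]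
  exact le_sup_left

theorem IsCover.supClosed (hF : IsCover F) {X : Set Q} (hX : X ∈ Obj F) : SupClosed X := by
  obtain ⟨f, hf, rfl⟩ := hX
  rintro _ ⟨x, rfl⟩ _ ⟨y, rfl⟩
  exact ⟨x ⊔ y, hF.map_sup hf x y⟩

theorem IsCover.image_mem (hF : IsCover F) {X : Set Q} (hX : X ∈ Obj F) {f : Q → Q}
    (hf : f ∈ F) : f '' X ∈ Obj F := by
  obtain ⟨g, hg, rfl⟩ := hX
  exact ⟨f ∘ g, hF.comp_mem hf hg, Set.range_comp f g⟩

theorem IsCover.ge_trans (hF : IsCover F) {X Y Z : Set Q} (h : Ge F X Y) (h' : Ge F Y Z) :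
    Ge F X Z := by
  obtain ⟨f, hf, h⟩ := h
  obtain ⟨g, hg, h'⟩ := h'
  refine ⟨g ∘ f, hF.comp_mem hg hf, h'.trans ?_⟩
  rw [Set.image_comp]
  exact Set.image_mono h

theorem IsCover.sim_refl (hF : IsCover F) (X : Set Q) : Sim F X X :=
  ⟨⟨id, hF.id_mem, Set.image_id X⟩, ⟨id, hF.id_mem, Set.image_id X⟩⟩

theorem IsCover.sim_trans (hF : IsCover F) {X Y Z : Set Q} (h : Sim F X Y) (h' : Sim F Y Z) :
    Sim F X Z := by
  obtain ⟨⟨f, hf, rfl⟩, ⟨g, hg, h2⟩⟩ := h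
  obtain ⟨⟨f', hf', rfl⟩, ⟨g', hg', h2'⟩⟩ := h'
  exact ⟨⟨f' ∘ f, hF.comp_mem hf' hf, Set.image_comp _ _ _⟩,
    ⟨g ∘ g', hF.comp_mem hg hg', by rw [Set.image_comp, h2', h2]⟩⟩

variable [Finite Q]

theorem IsCover.height_lt (hF : IsCover F) {X Y : Set Q} (hY : Y ∈ Obj F) (h : Ge F X Y)
    (h' : ¬ Ge F Y X) : height F Y < height F X := by
  refine Set.ncard_lt_ncard ⟨fun Z hZ => ⟨hZ.1, hF.ge_trans h hZ.2.1, fun h2 =>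
    hZ.2.2 (hF.ge_trans h2 h)⟩, fun hs => ?_⟩ (Set.toFinite _)
  exact (hs (show Y ∈ _ from ⟨hY, h, h'⟩)).2.2 (hs (show Y ∈ _ from ⟨hY, h, h'⟩)).2.1

theorem height_lt_ncard {X : Set Q} (hX : X ∈ Obj F) : height F X < (Obj F).ncard := by
  refine Set.ncard_lt_ncard ⟨fun Z hZ => hZ.1, fun hs => ?_⟩ (Set.toFinite _)
  exact (hs hX).2.2 (hs hX).2.1

/-- A map between images that is not onto or has no way back leads to a lower image. -/
theorem IsCover.height_image_lt (hF : IsCover F) {X Y : Set Q} (hX : X ∈ Obj F) {f : Q → Q}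
    (hf : f ∈ F) (hXY : f '' X ⊆ Y) (h : ¬ (Sim F X Y ∧ f '' X = Y)) {d : ℕ}
    (h1 : height F X < d + 1) (h2 : height F Y < d + 1) : height F (f '' X) < d := by
  have hZ := hF.image_mem hX hf
  have g1 : Ge F X (f '' X) := ⟨f, hf, subset_rfl⟩
  have g2 : Ge F Y (f '' X) := ⟨id, hF.id_mem, by rwa [Set.image_id]⟩
  by_cases k1 : Ge F (f '' X) X
  · by_cases k2 : Ge F (f '' X) Y
    · refine absurd ?_ h
      obtain ⟨g, hg, k1⟩ := k1
      obtain ⟨g', hg', k2⟩ := k2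
      have e : f '' X = Y := Set.eq_of_subset_of_ncard_le hXY
        ((Set.ncard_le_ncard k2).trans (Set.ncard_image_le (Set.toFinite _))) (Set.toFinite _)
      refine ⟨⟨⟨f, hf, e⟩, ⟨g, hg, ?_⟩⟩, e⟩
      rw [e] at k1
      refine (Set.eq_of_subset_of_ncard_le k1 ?_ (Set.toFinite _)).symm
      rw [← e]
      exact (Set.ncard_image_le (Set.toFinite _)).trans (Set.ncard_image_le (Set.toFinite _))
    · have := hF.height_lt hZ g2 k2
      omega
  · have := hF.height_lt hZ g1 k1
    omega

/-- Only finitely many maps permute `X`. The maps that `absorb` gives for them are monotone,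
preserve `X` and increase its points, so their composite dominates each of them. -/
theorem IsCover.exists_dominating (hF : IsCover F) {X : Set Q} (hX : SupClosed X) :
    ∃ V ∈ F, (∀ x ∈ X, V x ∈ X ∧ x ≤ V x) ∧ ∀ h ∈ F, h '' X = X → ∀ x ∈ X, h x ≤ V x := by
  have key : ∀ H : Set (Q → Q), H.Finite → (∀ h ∈ H, h ∈ F ∧ h '' X = X) →
      ∃ V ∈ F, (∀ x ∈ X, V x ∈ X ∧ x ≤ V x) ∧ ∀ h ∈ H, ∀ x ∈ X, h x ≤ V x := by
    intro H hH
    induction H, hH using Set.Finite.induction_on with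
    | empty => exact fun _ => ⟨id, hF.id_mem, fun x hx => ⟨hx, le_rfl⟩, by simp⟩
    | insert _ _ ih =>
      rename_i h H _ _
      intro hH
      obtain ⟨V, hV, h1, h2⟩ := ih fun h' hh' => hH h' (Or.inr hh')
      obtain ⟨hh, hhX⟩ := hH h (Or.inl rfl)
      obtain ⟨u, hu, hu'⟩ := hF.absorb hh
      refine ⟨V ∘ u, hF.comp_mem hV hu, fun x hx => ?_, ?_⟩
      · obtain ⟨a, b, -⟩ := hu' X hX hhX x hx
        exact ⟨(h1 _ a).1, b.trans (h1 _ a).2⟩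
      · rintro h' (rfl | hh') x hx
        · obtain ⟨a, b, c⟩ := hu' X hX hhX x hx
          exact c.trans (h1 _ a).2
        · exact (h2 h' hh' x hx).trans (hF.mono hV (hu' X hX hhX x hx).2.1)
  obtain ⟨V, hV, h1, h2⟩ := key {h | h ∈ F ∧ h '' X = X} (Set.toFinite _) fun h hh => hh
  exact ⟨V, hV, h1, fun h hh hX => h2 h ⟨hh, hX⟩⟩

theorem exists_iterate_eq {X : Set Q} {s : Q → Q} (hs : s '' X = X) :
    ∃ n, ∀ x ∈ X, s^[n + 1] x = x := by
  have hm : Set.MapsTo s X X := fun x hx => hs ▸ Set.mem_image_of_mem s hx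
  have hsurj : Function.Surjective (hm.restrict s X X) := by
    rintro ⟨y, hy⟩
    obtain ⟨x, hx, rfl⟩ := hs.symm ▸ hy
    exact ⟨⟨x, hx⟩, rfl⟩
  have hbij := Finite.surjective_iff_bijective.1 hsurj
  obtain ⟨n, hn, h1⟩ := (isOfFinOrder_of_finite (Equiv.ofBijective _ hbij)).exists_pow_eq_one
  refine ⟨n - 1, fun x hx => ?_⟩
  rw [Nat.sub_add_cancel hn]
  have h2 : ∀ m : ℕ, (((Equiv.ofBijective _ hbij) ^ m) ⟨x, hx⟩ : Q) = s^[m] x := by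
    intro m
    induction m with
    | zero => rfl
    | succ m ih => rw [pow_succ', Equiv.Perm.mul_apply, Function.iterate_succ_apply', ← ih]; rfl
  rw [← h2, h1]
  rfl

theorem IsCover.iterate_mem (hF : IsCover F) {f : Q → Q} (hf : f ∈ F) (n : ℕ) : f^[n] ∈ F := by
  induction n with
  | zero => exact hF.id_mem
  | succ n ih => exact hF.comp_mem ih hf

/-- Fix `f` from `X` onto `Y`; a power of the round trip `g ∘ f`, composed with `g`, gives a map `r`
in `F` that inverts `f`. Every `h` from `X` onto `Y` is `f ∘ (r ∘ h)` on `X`, and `r ∘ h` permutes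
`X`, so it lies below the single map `V`. Hence `f ∘ V` dominates every `h`. -/
theorem IsCover.exists_connector (hF : IsCover F) {X Y : Set Q} (hX : SupClosed X)
    (h : Sim F X Y) : ∃ c ∈ F, Set.MapsTo c X Y ∧
      ∀ h ∈ F, h '' X = Y → ∀ x ∈ X, h x ≤ c x := by
  obtain ⟨⟨f, hf, rfl⟩, ⟨g, hg, h2⟩⟩ := h
  obtain ⟨V, hV, h1, hd⟩ := hF.exists_dominating hX
  obtain ⟨n, hn⟩ := exists_iterate_eq (s := g ∘ f) (X := X) (by rw [Set.image_comp, h2])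
  have hr : (g ∘ f)^[n] ∘ g ∈ F := hF.comp_mem (hF.iterate_mem (hF.comp_mem hg hf) n) hg
  refine ⟨f ∘ V, hF.comp_mem hf hV, fun x hx => ⟨V x, (h1 x hx).1, rfl⟩, fun h hh he x hx => ?_⟩
  have hrf : ∀ x ∈ X, (g ∘ f)^[n] (g (f x)) = x := fun x hx => hn x hx
  have key : h x = f ((g ∘ f)^[n] (g (h x))) := by
    obtain ⟨x', hx', e⟩ : h x ∈ f '' X := he ▸ Set.mem_image_of_mem h hx
    rw [← e, hrf x' hx']
  rw [key]
  refine hF.mono hf (hd (((g ∘ f)^[n] ∘ g) ∘ h) (hF.comp_mem hr hh) ?_ x hx)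
  rw [Set.image_comp, he]
  ext z
  constructor
  · rintro ⟨_, ⟨x, hx, rfl⟩, rfl⟩
    simpa [hrf x hx] using hx
  · exact fun hz => ⟨f z, ⟨z, hz, rfl⟩, hrf z hz⟩

/-! ### Typed words -/

/-- A map with a source and a target. -/
structure Arr (Q : Type*) where
  /-- the source -/
  src : Set Q
  /-- the map -/
  f : Q → Q
  /-- the target -/
  tgt : Set Q

namespace Arr

/-- The composite of a word of maps. -/
def run (w : List (Arr Q)) (x : Q) : Q := w.foldl (fun x n => n.f x) x

/-- The word is a path between two sets. -/
def Path : Set Q → List (Arr Q) → Set Q → Prop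
  | X, [], Y => X = Y
  | X, n :: w, Y => n.src = X ∧ Path n.tgt w Y

theorem path_append {X Z : Set Q} {u v : List (Arr Q)} :
    Path X (u ++ v) Z ↔ ∃ Y, Path X u Y ∧ Path Y v Z := by
  induction u generalizing X with
  | nil => simp [Path]
  | cons n u ih => simp only [List.cons_append, Path, ih]; grind

/-- The arrow is made of the given maps and images, of bounded height. -/
structure Good (F : Set (Q → Q)) (d : ℕ) (n : Arr Q) : Prop where
  src_mem : n.src ∈ Obj F
  tgt_mem : n.tgt ∈ Obj F
  f_mem : n.f ∈ F
  image_sub : n.f '' n.src ⊆ n.tgt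
  src_lt : height F n.src < d
  tgt_lt : height F n.tgt < d

/-- The arrow is onto, and there is a way back. -/
def Tight (F : Set (Q → Q)) (n : Arr Q) : Prop := Sim F n.src n.tgt ∧ n.f '' n.src = n.tgt

open Classical in
/-- A map that dominates all maps from `X` onto `Y`. -/
noncomputable def conn (F : Set (Q → Q)) (X Y : Set Q) : Q → Q :=
  if h : ∃ c ∈ F, Set.MapsTo c X Y ∧ ∀ h ∈ F, h '' X = Y → ∀ x ∈ X, h x ≤ c x then h.choose else id

theorem conn_spec (hF : IsCover F) {X Y : Set Q} (hX : X ∈ Obj F) (h : Sim F X Y) :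
    conn F X Y ∈ F ∧ Set.MapsTo (conn F X Y) X Y ∧
      ∀ h ∈ F, h '' X = Y → ∀ x ∈ X, h x ≤ conn F X Y x := by
  have := hF.exists_connector (hF.supClosed hX) h
  rw [conn, dif_pos this]
  exact this.choose_spec

/-- The arrow between the images of two arrows that are joined by tight arrows. -/
noncomputable def link (F : Set (Q → Q)) (n n' : Arr Q) : Arr Q :=
  ⟨n.f '' n.src, n'.f ∘ conn F n.tgt n'.src, n'.f '' n'.src⟩

theorem run_append (u v : List (Arr Q)) (x : Q) : run (u ++ v) x = run v (run u x) :=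
  List.foldl_append

theorem run_mono (hF : IsCover F) {w : List (Arr Q)} (hw : ∀ n ∈ w, n.f ∈ F) :
    Monotone (run w) := by
  induction w with
  | nil => exact monotone_id
  | cons n w ih =>
    exact fun x y hxy => ih (fun n hn => hw n (by simp [hn])) (hF.mono (hw n (by simp)) hxy)

theorem run_tight (hF : IsCover F) {X Y : Set Q} {w : List (Arr Q)}
    (hw : ∀ n ∈ w, n.f ∈ F ∧ Tight F n) (hp : Path X w Y) :
    run w ∈ F ∧ run w '' X = Y ∧ Sim F X Y := by
  induction w generalizing X with
  | nil =>
    obtain rfl : X = Y := hp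
    exact ⟨hF.id_mem, Set.image_id X, hF.sim_refl X⟩
  | cons n w ih =>
    obtain ⟨rfl, hp⟩ := hp
    obtain ⟨h1, h2, h3⟩ := ih (fun n hn => hw n (by simp [hn])) hp
    obtain ⟨hn, hs, hi⟩ := hw n (by simp)
    have e : run (n :: w) = run w ∘ n.f := rfl
    exact ⟨e ▸ hF.comp_mem h1 hn, by rw [e, Set.image_comp, hi, h2], hF.sim_trans hs h3⟩

open Classical in
/-- The arrows of a word that are not tight. -/
noncomputable def loose (F : Set (Q → Q)) (w : List (Arr Q)) : List (Arr Q) :=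
  w.filter fun n => ¬ Tight F n

/-- Each tight stretch between consecutive loose arrows lies below a `conn`. Replacing all of them
turns the path behind the loose arrow `n` into a path of links, followed by the `conn` for the
stretch behind the last loose arrow `m`. Links start and end at images of loose arrows, which are
lower by `height_image_lt`. -/
theorem run_le_link (hF : IsCover F) {d : ℕ} {Y : Set Q} {N w : List (Arr Q)} {n : Arr Q}
    (hN : loose F w = N) (hn : Good F (d + 1) n) (hw : ∀ n ∈ w, Good F (d + 1) n)
    (hnt : ¬ Tight F n) (hp : Path n.tgt w Y) {M : List (Arr Q)} {m : Arr Q}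
    (hM : n :: N = M ++ [m]) :
    (∀ l ∈ Wd.pairs (link F) (n :: N), Good F d l) ∧
    Path (n.f '' n.src) (Wd.pairs (link F) (n :: N)) (m.f '' m.src) ∧ Good F (d + 1) m ∧
    Sim F m.tgt Y ∧
    ∀ y ∈ n.f '' n.src, run w y ≤ conn F m.tgt Y (run (Wd.pairs (link F) (n :: N)) y) := by
  classical
  induction N generalizing n w M with
  | nil =>
    obtain ⟨rfl, rfl⟩ : M = [] ∧ n = m := by
      cases M with
      | nil => simpa using hM
      | cons a M => simp at hM
    have ht : ∀ l ∈ w, l.f ∈ F ∧ Tight F l := fun l hl => ⟨(hw l hl).f_mem, by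
      have := List.filter_eq_nil_iff.1 hN l hl
      simpa using this⟩
    obtain ⟨h1, h2, h3⟩ := run_tight hF ht hp
    refine ⟨by simp [Wd.pairs], rfl, hn, h3, fun y hy => ?_⟩
    exact (conn_spec hF hn.tgt_mem h3).2.2 _ h1 h2 y (hn.image_sub hy)
  | cons n' N ih =>
    obtain ⟨s, w', rfl, hs, hn'⟩ := List.filter_eq_cons_iff.1 hN
    obtain ⟨hn't, hN'⟩ := hn'
    obtain ⟨Z, hp1, rfl, hp2⟩ := path_append.1 hp
    have hn'g := hw n' (by simp)
    have hM' : ∃ M', n' :: N = M' ++ [m] := by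
      cases M with
      | nil => simp at hM
      | cons a M => exact ⟨M, (List.cons.inj hM).2⟩
    obtain ⟨M', hM'⟩ := hM'
    have hn't' : ¬ Tight F n' := by simpa using hn't
    obtain ⟨i1, i2, i3, i4, i5⟩ := ih (w := w') (M := M') hN' hn'g
      (fun l hl => hw l (by simp [hl])) hn't' hp2 hM'
    have ht : ∀ l ∈ s, l.f ∈ F ∧ Tight F l := fun l hl => ⟨(hw l (by simp [hl])).f_mem, by
      have := hs l hl
      simpa using this⟩
    obtain ⟨h1, h2, h3⟩ := run_tight hF ht hp1
    obtain ⟨c1, c2, c3⟩ := conn_spec hF hn.tgt_mem h3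
    refine ⟨?_, ⟨rfl, i2⟩, i3, i4, fun y hy => ?_⟩
    · intro l hl
      rcases List.mem_cons.1 hl with rfl | hl
      · refine ⟨hF.image_mem hn.src_mem hn.f_mem, hF.image_mem hn'g.src_mem hn'g.f_mem,
          (hF.comp_mem hn'g.f_mem c1 : n'.f ∘ conn F n.tgt n'.src ∈ F), ?_,
          hF.height_image_lt hn.src_mem hn.f_mem hn.image_sub hnt hn.src_lt hn.tgt_lt,
          hF.height_image_lt hn'g.src_mem hn'g.f_mem hn'g.image_sub hn't' hn'g.src_lt hn'g.tgt_lt⟩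
        rintro _ ⟨y, hy, rfl⟩
        exact ⟨_, c2 (hn.image_sub hy), rfl⟩
      · exact i1 l hl
    · have e : run (s ++ n' :: w') y = run w' (n'.f (run s y)) := by rw [run_append]; rfl
      rw [e]
      have hy' := hn.image_sub hy
      refine (run_mono hF (fun l hl => (hw l (by simp [hl])).f_mem)
        (hF.mono hn'g.f_mem (c3 _ h1 h2 y hy'))).trans ?_
      exact i5 _ ⟨_, c2 hy', rfl⟩

/-- All paths of the same type are dominated by a single map. -/
theorem exists_dominating (hF : IsCover F) (d : ℕ) (τ : Ty (Arr Q) (2 * d)) {X : Set Q}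
    (hX : X ∈ Obj F) (Y : Set Q) :
    ∃ ψ ∈ F, ∀ w : List (Arr Q), Wd.tp (2 * d) (.fin w) = τ → (∀ n ∈ w, Good F d n) →
      Path X w Y → ∀ x ∈ X, ψ x ∈ Y ∧ run w x ≤ ψ x := by
  classical
  -- Induction on the bound on the heights. Passing to the loose arrows is free (`tp_filter`) and
  -- passing to the links costs two ranks (`tp_pairs`), hence the rank `2 * d`.
  induction d generalizing X Y with
  | zero =>
    refine ⟨id, hF.id_mem, fun w _ hw hp x hx => ?_⟩
    cases w with
    | nil => exact ⟨hp ▸ hx, le_rfl⟩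
    | cons n w => exact absurd (hw n (by simp)).src_lt (by simp)
  | succ d ih =>
    by_cases hex : ∃ w : List (Arr Q), Wd.tp (2 * (d + 1)) (.fin w) = τ ∧
      (∀ n ∈ w, Good F (d + 1) n) ∧ Path X w Y
    swap
    · exact ⟨id, hF.id_mem, fun w h1 h2 h3 => absurd ⟨w, h1, h2, h3⟩ hex⟩
    obtain ⟨w₀, rfl, hw₀, hp₀⟩ := hex
    -- If `w₀` has no loose arrow, then no word of its type has one, and every such path is
    -- dominated by `conn F X Y`.
    rcases hN₀ : loose F w₀ with _ | ⟨n, N₀⟩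
    · have key : ∀ w : List (Arr Q), Wd.tp (2 * (d + 1)) (.fin w) = Wd.tp (2 * (d + 1)) (.fin w₀) →
          (∀ n ∈ w, Good F (d + 1) n) → Path X w Y → run w ∈ F ∧ run w '' X = Y ∧ Sim F X Y := by
        intro w h1 h2 h3
        have h4 := Wd.tp_filter (fun n => ¬ Tight F n) h1
        change _ = Wd.tp _ (.fin (loose F w₀)) at h4
        rw [hN₀] at h4
        have h5 := Wd.eq_nil_of_tp (k := 2 * d + 1) h4
        simp only [Wd.fin.injEq] at h5
        refine run_tight hF (fun l hl => ⟨(h2 l hl).f_mem, ?_⟩) h3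
        have := List.filter_eq_nil_iff.1 h5 l hl
        simpa using this
      obtain ⟨-, -, hs⟩ := key w₀ rfl hw₀ hp₀
      obtain ⟨c1, c2, c3⟩ := conn_spec hF hX hs
      refine ⟨_, c1, fun w h1 h2 h3 x hx => ⟨c2 hx, ?_⟩⟩
      obtain ⟨k1, k2, -⟩ := key w h1 h2 h3
      exact c3 _ k1 k2 x hx
    · obtain ⟨M₀, m, hM₀⟩ : ∃ M m, n :: N₀ = M ++ [m] :=
        ⟨_, _, (List.dropLast_append_getLast (List.cons_ne_nil n N₀)).symm⟩
      -- The type determines the first loose arrow `n` and the last one `m`. So the paths of links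
      -- of all words of this type have the same source, target and type, and the induction
      -- hypothesis gives one map for all of them.
      have key : ∀ w : List (Arr Q), Wd.tp (2 * (d + 1)) (.fin w) = Wd.tp (2 * (d + 1)) (.fin w₀) →
          (∀ n ∈ w, Good F (d + 1) n) → Path X w Y → ∃ s w' N M, w = s ++ n :: w' ∧
          n :: N = M ++ [m] ∧ loose F w' = N ∧ Sim F X n.src ∧ run s ∈ F ∧ run s '' X = n.src ∧
          Path n.tgt w' Y ∧ ¬ Tight F n ∧ Wd.tp (2 * d) (.fin (Wd.pairs (link F) (n :: N))) =
            Wd.tp (2 * d) (.fin (Wd.pairs (link F) (n :: N₀))) := by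
        intro w h1 h2 h3
        have h4 := Wd.tp_filter (fun n => ¬ Tight F n) h1
        change Wd.tp (2 * d + 2) (.fin (loose F w)) = Wd.tp (2 * d + 2) (.fin (loose F w₀)) at h4
        rw [hN₀] at h4
        obtain ⟨y', hy', -⟩ := Wd.tp_cons (a := n) (y := .fin N₀) h4.symm
        obtain ⟨N, hN, -⟩ := Wd.fin_eq_app_cons.1 (hy'.trans (Wd.app_nil _).symm)
        rw [List.nil_append] at hN
        rw [hM₀] at h4
        obtain ⟨M, hM, -⟩ := Wd.tp_concat h4.symm
        rw [← hM₀] at h4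
        rw [hN] at hM h4
        obtain ⟨s, w', rfl, hs, hnt, hN'⟩ := List.filter_eq_cons_iff.1 hN
        obtain ⟨Z, hp1, rfl, hp2⟩ := path_append.1 h3
        obtain ⟨k1, k2, k3⟩ := run_tight hF (w := s) (fun l hl => ⟨(h2 l (by simp [hl])).f_mem, by
          have := hs l hl
          simpa using this⟩) hp1
        exact ⟨s, w', N, M, rfl, hM, hN', k3, k1, k2, hp2, by simpa using hnt, Wd.tp_pairs _ h4⟩
      obtain ⟨s₀, w₀', N, M, rfl, hM, hN, hs, -, -, hp', hnt, -⟩ := key w₀ rfl hw₀ hp₀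
      have hn := hw₀ n (by simp)
      obtain ⟨-, -, hm, hm', -⟩ := run_le_link hF hN hn (fun l hl => hw₀ l (by simp [hl])) hnt hp' hM
      obtain ⟨ψ, hψ, hψ'⟩ := ih (Wd.tp (2 * d) (.fin (Wd.pairs (link F) (n :: N₀))))
        (hF.image_mem hn.src_mem hn.f_mem) (m.f '' m.src)
      obtain ⟨c1, c2, c3⟩ := conn_spec hF hX hs
      obtain ⟨e1, e2, e3⟩ := conn_spec hF hm.tgt_mem hm'
      refine ⟨conn F m.tgt Y ∘ ψ ∘ n.f ∘ conn F X n.src, hF.comp_mem e1 (hF.comp_mem hψ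
        (hF.comp_mem hn.f_mem c1)), fun w h1 h2 h3 x hx => ?_⟩
      obtain ⟨s, w', N, M, rfl, hM, hN, hs, k1, k2, hp', -, htp⟩ := key w h1 h2 h3
      obtain ⟨i1, i2, -, -, i5⟩ := run_le_link hF hN hn (fun l hl => h2 l (by simp [hl])) hnt hp' hM
      have hy : n.f (conn F X n.src x) ∈ n.f '' n.src := ⟨_, c2 hx, rfl⟩
      obtain ⟨j1, j2⟩ := hψ' _ htp i1 i2 _ hy
      refine ⟨e2 (hm.image_sub j1), ?_⟩
      have e : run (s ++ n :: w') x = run w' (n.f (run s x)) := by rw [run_append]; rfl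
      rw [e]
      refine (run_mono hF (fun l hl => (h2 l (by simp [hl])).f_mem)
        (hF.mono hn.f_mem (c3 _ k1 k2 x hx))).trans ((i5 _ hy).trans ?_)
      exact hF.mono e1 j2

end Arr

/-- All words of the same type act below a single map. -/
theorem IsCover.exists_foldl_le (hF : IsCover F) {L : Type*} (φ : L → Q → Q) (hφ : ∀ a, φ a ∈ F)
    (w₀ : List L) : ∃ ψ ∈ F, ∀ w : List L,
      Wd.tp (2 * (Obj F).ncard) (.fin w) = Wd.tp (2 * (Obj F).ncard) (.fin w₀) →
      ∀ x, w.foldl (fun x a => φ a x) x ≤ ψ x := by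
  have hu : Set.univ ∈ Obj F := ⟨id, hF.id_mem, Set.range_id⟩
  -- A word of maps is regarded as a path from `Set.univ` to itself.
  let g : L → Arr Q := fun a => ⟨Set.univ, φ a, Set.univ⟩
  obtain ⟨ψ, hψ, h⟩ := Arr.exists_dominating hF _
    (Wd.tp (2 * (Obj F).ncard) (.fin (w₀.map g))) hu Set.univ
  refine ⟨ψ, hψ, fun w hw x => ?_⟩
  have := (h (w.map g) (Wd.tp_map g hw) ?_ ?_ x trivial).2
  · rwa [Arr.run, List.foldl_map] at this
  · intro n hn
    obtain ⟨a, -, rfl⟩ := List.mem_map.1 hn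
    exact ⟨hu, hu, hφ a, Set.subset_univ _, height_lt_ncard hu, height_lt_ncard hu⟩
  · clear hw h
    induction w with
    | nil => rfl
    | cons a w ih => exact ⟨rfl, ih⟩

end Cover


/-! ## The saturation of the images of the letters -/

namespace Sat

open scoped Pointwise
open Word

section Powers

variable {S : Type*} [Semigroup S]

/-- `ppow X n` is the power `X ^ (n + 1)`. -/
def ppow (X : Set S) : ℕ → Set S
  | 0 => X
  | n + 1 => ppow X n * X

/-- The union of the powers with exponents in `(N, 2N]`. -/
def upow (N : ℕ) (X : Set S) : Set S := {s | ∃ i < N, s ∈ ppow X (N + i)}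

theorem mul_ppow (X Y : Set S) (n : ℕ) : Y * ppow X n = (fun Z => Z * X)^[n + 1] Y := by
  induction n with
  | zero => rfl
  | succ n ih => rw [ppow, ← mul_assoc, ih, Function.iterate_succ_apply' _ (n + 1)]

theorem mul_upow (N : ℕ) (X Y : Set S) : Y * upow N X = ⋃ i < N, Y * ppow X (N + i) := by
  ext s
  simp only [upow, Set.mem_mul, Set.mem_ofPred_eq, Set.mem_iUnion]
  grind

theorem exists_ppow_eq [Finite S] (X : Set S) :
    ∃ i j, i < j ∧ j ≤ 2 ^ Nat.card S ∧ ppow X i = ppow X j := by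
  have hfin : Fintype S := Fintype.ofFinite S
  have h : ¬ Function.Injective fun i : Fin (2 ^ Nat.card S + 1) => ppow X i := by
    intro h
    have := Nat.card_le_card_of_injective _ h
    simp at this
  rw [Function.Injective] at h
  push Not at h
  obtain ⟨a, b, hab, hne⟩ := h
  rcases lt_or_gt_of_ne hne with h | h
  · exact ⟨a, b, h, by omega, hab⟩
  · exact ⟨b, a, h, by omega, hab.symm⟩

theorem ppow_eq_add {X : Set S} {i j : ℕ} (h : ppow X i = ppow X j) (c : ℕ) :
    ppow X (i + c) = ppow X (j + c) := by
  induction c with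
  | zero => exact h
  | succ c ih => rw [← add_assoc, ← add_assoc, ppow, ppow, ih]

theorem ppow_periodic {X : Set S} {i p n : ℕ} (h : ppow X i = ppow X (i + p)) (hn : i ≤ n)
    (q : ℕ) : ppow X n = ppow X (n + p * q) := by
  induction q with
  | zero => rfl
  | succ q ih =>
    have h2 := ppow_eq_add h (n + p * q - i)
    rw [ih, mul_add, mul_one]
    convert h2 using 2 <;> omega

end Powers

variable {A S : Type*} [Semigroup S]

/-- The saturation of the images of the letters under products and unions of large powers. -/
inductive IsSat (g : A → S) : Set S → Prop
  | letter (a : A) : IsSat g {g a}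
  | mul {X Y : Set S} : IsSat g X → IsSat g Y → IsSat g (X * Y)
  | pow {X : Set S} : IsSat g X → IsSat g (upow (2 ^ Nat.card S) X)

theorem ppow_nonempty {X : Set S} (h : X.Nonempty) (n : ℕ) : (ppow X n).Nonempty := by
  induction n with
  | zero => exact h
  | succ n ih => exact ih.mul h

theorem IsSat.nonempty {g : A → S} {X : Set S} (h : IsSat g X) : X.Nonempty := by
  induction h with
  | letter a => exact ⟨_, rfl⟩
  | mul _ _ h1 h2 => exact h1.mul h2
  | pow _ h =>
    obtain ⟨s, hs⟩ := ppow_nonempty h (2 ^ Nat.card S + 0)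
    exact ⟨s, 0, by positivity, hs⟩

/-- The maps given by right multiplication with the sets of the saturation. -/
def maps (g : A → S) : Set (Set S → Set S) := insert id ((fun T X => X * T) '' {T | IsSat g T})

/-- For `absorb` the dominating map is right multiplication with `upow N T`. If multiplication with
`T` permutes `𝒳`, it acts there with a period `p ≤ N`. Among the `N` consecutive exponents of `upow
N T` one is `0` and one is `1` modulo `p`, and these contribute `X` and `X * T`. The union stays in
`𝒳` because `𝒳` is closed under suprema. -/
theorem maps_isCover [Finite S] (g : A → S) : Cover.IsCover (maps g) where
  id_mem := Or.inl rfl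
  comp_mem := by
    rintro _ _ (rfl | ⟨T, hT, rfl⟩) (rfl | ⟨T', hT', rfl⟩)
    · exact Or.inl rfl
    · exact Or.inr ⟨T', hT', rfl⟩
    · exact Or.inr ⟨T, hT, rfl⟩
    · exact Or.inr ⟨T' * T, hT'.mul hT, funext fun X => (mul_assoc _ _ _).symm⟩
  map_sup := by
    rintro _ (rfl | ⟨T, hT, rfl⟩) X Y
    · rfl
    · exact Set.union_mul
  absorb := by
    rintro _ (rfl | ⟨T, hT, rfl⟩)
    · exact ⟨id, Or.inl rfl, fun _ _ _ x hx => ⟨hx, le_rfl, le_rfl⟩⟩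
    · refine ⟨_, Or.inr ⟨_, hT.pow, rfl⟩, fun 𝒳 h𝒳 him X hX => ?_⟩
      set N := 2 ^ Nat.card S with hN
      have hpos : 0 < N := by positivity
      have hit : ∀ n, (fun Z => Z * T)^[n] '' 𝒳 = 𝒳 := by
        intro n
        induction n with
        | zero => exact Set.image_id _
        | succ n ih => rw [Function.iterate_succ, Set.image_comp, him, ih]
      have hmem : ∀ n, (fun Z => Z * T)^[n] X ∈ 𝒳 := fun n => hit n ▸ Set.mem_image_of_mem _ hX
      obtain ⟨i, j, hij, hj, he⟩ := exists_ppow_eq T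
      have hper : ∀ Y ∈ 𝒳, (fun Z => Z * T)^[j - i] Y = Y := by
        intro Y hY
        obtain ⟨Z, hZ, rfl⟩ := (hit (i + 1)).symm ▸ hY
        rw [← Function.iterate_add_apply, show j - i + (i + 1) = j + 1 by omega, ← mul_ppow,
          ← mul_ppow, he]
      have hper' : ∀ q, ∀ Y ∈ 𝒳, (fun Z => Z * T)^[(j - i) * q] Y = Y := by
        intro q Y hY
        induction q with
        | zero => rfl
        | succ q ih => rw [mul_add, mul_one, Function.iterate_add_apply, hper Y hY, ih]
      -- The exponent used is the least number above `N` that is congruent to `r` modulo the period;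
      -- the `+ 1` is there because `ppow T n` has exponent `n + 1`.
      have hres : ∀ r, ∃ c < N, ∃ q, N + c + 1 = (j - i) * q + r % (j - i) := by
        intro r
        set p := j - i with hp
        have hp0 : 0 < p := by omega
        have hpN : p ≤ N := by omega
        have h1 := Nat.mod_add_div (N - r % p + p) p
        have h2 := Nat.mod_lt (N - r % p + p) hp0
        have h3 := Nat.mod_lt r hp0
        refine ⟨p * ((N - r % p + p) / p) + r % p - N - 1, ?_, (N - r % p + p) / p, ?_⟩ <;> omega
      dsimp only
      rw [mul_upow]
      have hsub : ∀ c < N, (fun Z => Z * T)^[N + c + 1] X ⊆ ⋃ i < N, X * ppow T (N + i) := by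
        intro c hc
        rw [← mul_ppow]
        exact Set.subset_biUnion_of_mem (u := fun i => X * ppow T (N + i)) hc
      refine ⟨?_, ?_, ?_⟩
      · have := h𝒳.finsetSup'_mem (t := Finset.range N)
          (Finset.nonempty_range_iff.2 hpos.ne')
          (f := fun i => X * ppow T (N + i)) (fun i _ => by rw [mul_ppow]; exact hmem _)
        convert this using 1
        rw [Finset.sup'_eq_sup, Finset.sup_set_eq_biUnion]
        simp
      · obtain ⟨c, hc, q, hq⟩ := hres 0
        have := hsub c hc
        rw [hq, Nat.zero_mod, add_zero, hper' q X hX] at this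
        exact this
      · obtain ⟨c, hc, q, hq⟩ := hres 1
        have := hsub c hc
        rw [hq, Function.iterate_add_apply, hper' q _ (hmem _)] at this
        -- For period `1` the residue of `1` is `0`, and then `T` fixes `X`.
        rcases Nat.lt_or_ge 1 (j - i) with h1 | h1
        · rw [Nat.mod_eq_of_lt h1] at this
          exact this
        · have e : j - i = 1 := by omega
          have h2 : X * T = X := by simpa [e] using hper X hX
          rw [h2]
          rw [e] at this
          exact this

/-- The empty set is not in the saturation, which leaves room for the identity among the `2 ^ |S|`
maps. -/
theorem ncard_obj_le [Finite S] (g : A → S) : (Cover.Obj (maps g)).ncard ≤ 2 ^ Nat.card S := by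
  have hfin : Fintype S := Fintype.ofFinite S
  have h1 : {T | IsSat g T}.ncard < Nat.card (Set S) := by
    rw [← Set.ncard_univ]
    refine Set.ncard_lt_ncard (Set.ssubset_univ_iff.2 fun h => ?_) (Set.toFinite _)
    have : IsSat g ∅ := by
      have := Set.mem_univ (∅ : Set S)
      rwa [← h] at this
    exact Set.not_nonempty_empty this.nonempty
  have h2 : Nat.card (Set S) = 2 ^ Nat.card S := by simp
  calc (Cover.Obj (maps g)).ncard ≤ (maps g).ncard := Set.ncard_image_le (Set.toFinite _)
    _ ≤ ((fun (T X : Set S) => X * T) '' {T | IsSat g T}).ncard + 1 := Set.ncard_insert_le _ _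
    _ ≤ {T | IsSat g T}.ncard + 1 := by gcongr; exact Set.ncard_image_le (Set.toFinite _)
    _ ≤ 2 ^ Nat.card S := by omega

/-- The image of a letter. -/
def img (φ : FreeSemigroup A →ₙ* S) (a : A) : S := φ (FreeSemigroup.of a)

theorem foldl_img (φ : FreeSemigroup A →ₙ* S) (u : FreeSemigroup A) :
    u.tail.foldl (fun s b => s * img φ b) (img φ u.head) = φ u := by
  obtain ⟨a, l⟩ := u
  change l.foldl (fun s b => s * img φ b) (img φ a) = _
  induction l using List.reverseRecOn with
  | nil => rfl
  | append_singleton l b ih =>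
    rw [List.foldl_append, ih]
    exact (map_mul φ ⟨a, l⟩ (FreeSemigroup.of b)).symm

/-- The rank at which the values of words are controlled by the saturation. -/
noncomputable def rank (S : Type*) : ℕ := 2 * 2 ^ Nat.card S + 1

/-- Since `S` need not have a neutral element, the action starts at the image of the first letter.
The type determines this letter, and the `+ 1` in `rank` pays for splitting it off;
`exists_foldl_le` then bounds the rest of the word. -/
theorem exists_isSat_of_tp [Finite S] (φ : FreeSemigroup A →ₙ* S) (u₀ : FreeSemigroup A) :
    ∃ T, IsSat (img φ) T ∧ ∀ u, Wd.tp (rank S) (.fin (letters u)) =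
      Wd.tp (rank S) (.fin (letters u₀)) → φ u ∈ T := by
  obtain ⟨a, r₀⟩ := u₀
  obtain ⟨ψ, hψ, h⟩ := (maps_isCover (img φ)).exists_foldl_le (fun b X => X * {img φ b})
    (fun b => Or.inr ⟨_, .letter b, rfl⟩) r₀
  refine ⟨ψ {img φ a}, ?_, fun u hu => ?_⟩
  · rcases hψ with rfl | ⟨T, hT, rfl⟩
    · exact .letter a
    · exact (IsSat.letter a).mul hT
  · obtain ⟨k, hk⟩ : ∃ k, rank S = k + 2 := by
      have : 0 < 2 ^ Nat.card S := by positivity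
      exact ⟨rank S - 2, by rw [rank]; omega⟩
    have hk' : k + 1 = 2 * 2 ^ Nat.card S := by rw [rank] at hk; omega
    rw [hk] at hu
    obtain ⟨y, hy, htp⟩ := Wd.tp_cons (a := a) (y := .fin r₀) hu.symm
    obtain ⟨r, hr, rfl⟩ := Wd.fin_eq_app_cons.1 (hy.trans (Wd.app_nil _).symm)
    obtain ⟨b, r'⟩ := u
    obtain ⟨rfl, rfl⟩ : b = a ∧ r' = r := List.cons.inj hr
    have h1 := h r' (Wd.tp_mono (by rw [hk']; gcongr; exact ncard_obj_le _) htp.symm) {img φ b}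
    have h2 : ∀ s : S, ∀ l : List A, l.foldl (fun X b => X * {img φ b}) ({s} : Set S) =
        {l.foldl (fun s b => s * img φ b) s} := by
      intro s l
      induction l generalizing s with
      | nil => rfl
      | cons c l ih => simp only [List.foldl_cons, Set.singleton_mul_singleton]; exact ih _
    rw [h2] at h1
    have h3 := foldl_img φ ⟨b, r'⟩
    dsimp only at h3
    rw [h3] at h1
    exact h1 rfl

/-! ### Sets of the saturation consist of values of words of the same type -/

/-- Products follow from the congruence `tp_append`. For the union of powers, periodicity makes all
exponents large without changing the sets, and then `tp_flatten` identifies the types. -/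
theorem IsSat.exists_words [Finite S] (φ : FreeSemigroup A →ₙ* S) {T : Set S}
    (hT : IsSat (img φ) T) (k : ℕ) :
    ∃ τ, ∀ t ∈ T, ∃ u, φ u = t ∧ Wd.tp k (.fin (letters u)) = τ := by
  induction hT with
  | letter a => exact ⟨_, fun t ht => ⟨_, (Set.mem_singleton_iff.1 ht).symm, rfl⟩⟩
  | mul hX hY ih ih' =>
    obtain ⟨σ, hσ⟩ := ih
    obtain ⟨τ, hτ⟩ := ih'
    obtain ⟨u₀, -, h1⟩ := hσ _ hX.nonempty.some_mem
    obtain ⟨v₀, -, h2⟩ := hτ _ hY.nonempty.some_mem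
    refine ⟨Wd.tp k (.fin (letters (u₀ * v₀))), ?_⟩
    rintro _ ⟨s, hs, t, ht, rfl⟩
    obtain ⟨u, rfl, hu⟩ := hσ s hs
    obtain ⟨v, rfl, hv⟩ := hτ t ht
    refine ⟨u * v, map_mul φ u v, ?_⟩
    rw [letters_mul, letters_mul]
    exact Wd.tp_append (hu.trans h1.symm) (hv.trans h2.symm)
  | pow hX ih =>
    rename_i X
    obtain ⟨τ, hτ⟩ := ih
    obtain ⟨v, -, hv⟩ := hτ _ hX.nonempty.some_mem
    have key : ∀ n, ∀ s ∈ ppow X n, ∃ u L, φ u = s ∧ letters u = List.flatten L ∧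
        L.length = n + 1 ∧ ∀ w ∈ L, Wd.tp k (.fin w) = τ := by
      intro n
      induction n with
      | zero =>
        intro s hs
        obtain ⟨u, rfl, hu⟩ := hτ s hs
        exact ⟨u, [letters u], rfl, by simp, rfl, by simpa using hu⟩
      | succ n ihn =>
        rintro _ ⟨s, hs, t, ht, rfl⟩
        obtain ⟨u, L, rfl, h1, h2, h3⟩ := ihn s hs
        obtain ⟨w, rfl, hw⟩ := hτ t ht
        refine ⟨u * w, L ++ [letters w], map_mul φ u w, ?_, by simp [h2], ?_⟩
        · rw [letters_mul, h1]; simp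
        · simp only [List.mem_append, List.mem_singleton]
          rintro x (hx | rfl)
          · exact h3 x hx
          · exact hw
    refine ⟨Wd.tp k (.fin (List.replicate (2 ^ k) (letters v)).flatten), ?_⟩
    rintro s ⟨i, hi, hs⟩
    obtain ⟨a, b, hab, hb, he⟩ := exists_ppow_eq X
    -- Exponents above `N` lie in the periodic range of the powers of `X`, so `2 ^ k` periods may be
    -- added.
    rw [ppow_periodic (i := a) (p := b - a) (by rw [he]; congr 1; omega) (by omega) (2 ^ k)] at hs
    obtain ⟨u, L, rfl, h1, h2, h3⟩ := key _ s hs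
    refine ⟨u, rfl, ?_⟩
    rw [h1]
    refine Wd.tp_flatten (v := letters v) (fun w hw => (h3 w hw).trans hv.symm) ?_ (Or.inr ?_)
    · intro w hw
      rw [List.eq_of_mem_replicate hw]
    · have : 2 ^ k ≤ (b - a) * 2 ^ k := Nat.le_mul_of_pos_left _ (by omega)
      rw [h2, List.length_replicate]
      omega

variable {T : Type*} [OmegaSemigroup S T]

/-- Two values of infinite words that the saturation does not tell apart. -/
def Close (g : A → S) (p q : T) : Prop :=
  ∃ X E : Set S, IsSat g X ∧ IsSat g E ∧ ∃ x ∈ X, ∃ y ∈ X, ∃ e ∈ E, ∃ f ∈ E,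
    p = x • (OmegaSemigroup.iprod (Stream'.const e) : T) ∧
    q = y • (OmegaSemigroup.iprod (Stream'.const f) : T)

theorem Close.exists_words [Finite S] {α : OmegaHom (FreeSemigroup A) (Stream' A) S T} {p q : T}
    (h : Close (img α.fin) p q) (k : ℕ) :
    ∃ w w' : Stream' A, α.inf w = p ∧ α.inf w' = q ∧ Wd.tp k (.inf w) = Wd.tp k (.inf w') := by
  obtain ⟨X, E, hX, hE, x, hx, y, hy, e, he, f, hf, rfl, rfl⟩ := h
  obtain ⟨σ, hσ⟩ := hX.exists_words α.fin k
  obtain ⟨τ, hτ⟩ := hE.exists_words α.fin k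
  obtain ⟨u, rfl, hu⟩ := hσ x hx
  obtain ⟨u', rfl, hu'⟩ := hσ y hy
  obtain ⟨v, rfl, hv⟩ := hτ e he
  obtain ⟨v', rfl, hv'⟩ := hτ f hf
  refine ⟨u • OmegaSemigroup.iprod (Stream'.const v), u' • OmegaSemigroup.iprod (Stream'.const v'),
    ?_, ?_, ?_⟩
  · rw [α.map_smul, α.map_iprod, Stream'.map_const]
  · rw [α.map_smul, α.map_iprod, Stream'.map_const]
  · exact Wd.tp_app (hu.trans hu'.symm)
      (Wd.tp_iconcat (f := Stream'.const v) (f' := Stream'.const v') fun i => hv.trans hv'.symm)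

end Sat


/-! ## Infinite words of the same type -/

instance Ty.finite {A : Type*} [Finite A] (k : ℕ) : Finite (Ty A k) := by
  induction k with
  | zero => exact inferInstanceAs (Finite PUnit)
  | succ k ih => exact inferInstanceAs (Finite (Set (Ty A k × A × Ty A k)))

/-- Ramsey's theorem for pairs. -/
theorem exists_strictMono_homogeneous {C : Type*} [Finite C] (c : ℕ → ℕ → C) :
    ∃ (k : ℕ → ℕ) (γ : C), StrictMono k ∧ ∀ i j, i < j → c (k i) (k j) = γ := by
  -- A nonprincipal ultrafilter selects the colour `γ i` that `c i` takes almost everywhere, and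
  -- then the colour `δ` that `γ` takes almost everywhere. Finitely many such conditions can be met
  -- at once, so the sequence can be chosen greedily.
  have h1 : ∀ i, ∃ γ, ∀ᶠ j in (Filter.hyperfilter ℕ : Filter ℕ), c i j = γ := by
    intro i
    obtain ⟨γ, h⟩ := Ultrafilter.eq_pure_of_finite ((Filter.hyperfilter ℕ).map (c i))
    refine ⟨γ, ?_⟩
    have : ({γ} : Set C) ∈ (Filter.hyperfilter ℕ).map (c i) := by rw [h]; exact rfl
    exact this
  choose γ hγ using h1
  obtain ⟨δ, hδ⟩ := Ultrafilter.eq_pure_of_finite ((Filter.hyperfilter ℕ).map γ)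
  have h2 : ∀ᶠ i in (Filter.hyperfilter ℕ : Filter ℕ), γ i = δ := by
    have : ({δ} : Set C) ∈ (Filter.hyperfilter ℕ).map γ := by rw [hδ]; exact rfl
    exact this
  obtain ⟨k, -, hk⟩ := exists_seq_of_forall_finset_exists (fun i => γ i = δ)
    (fun i j => i < j ∧ c i j = δ) fun s hs => by
      have h3 : ∀ᶠ j in (Filter.hyperfilter ℕ : Filter ℕ), ∀ i ∈ s, i < j ∧ c i j = δ := by
        rw [Filter.eventually_all_finset]
        intro i hi
        have h4 : ∀ᶠ j in (Filter.hyperfilter ℕ : Filter ℕ), i < j :=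
          Nat.hyperfilter_le_atTop (Filter.eventually_gt_atTop i)
        filter_upwards [h4, hγ i] with j h5 h6
        exact ⟨h5, h6.trans (hs i hi)⟩
      exact (h2.and h3).exists
  exact ⟨k, δ, fun i j hij => (hk i j hij).1, fun i j hij => (hk i j hij).2⟩

/-! ### Factors of infinite words -/

namespace Word

variable {A : Type*}

/-- The factor of an infinite word between two positions. -/
def seg (w : Stream' A) (i j : ℕ) : List A := (w.drop i).take (j - i)

theorem length_seg (w : Stream' A) (i j : ℕ) : (seg w i j).length = j - i :=
  Stream'.length_take _ _

theorem seg_append (w : Stream' A) {i j l : ℕ} (hij : i ≤ j) (hjl : j ≤ l) :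
    seg w i j ++ seg w j l = seg w i l := by
  obtain ⟨a, rfl⟩ := Nat.exists_eq_add_of_le hij
  obtain ⟨b, rfl⟩ := Nat.exists_eq_add_of_le hjl
  have e : i + a + b - i = a + b := by omega
  simp only [seg, Nat.add_sub_cancel_left, e]
  rw [Stream'.take_add, Stream'.drop_drop]

theorem seg_append_drop (w : Stream' A) {i j : ℕ} (hij : i ≤ j) :
    seg w i j ++ₛ w.drop j = w.drop i := by
  obtain ⟨a, rfl⟩ := Nat.exists_eq_add_of_le hij
  rw [seg, Nat.add_sub_cancel_left, ← Stream'.drop_drop]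
  exact Stream'.append_take_drop _ _

theorem eq_take_of_append {x : List A} {y w : Stream' A} (h : w = x ++ₛ y) :
    x = w.take x.length ∧ y = w.drop x.length := by
  subst h
  refine ⟨?_, (Stream'.drop_append_stream _ _).symm⟩
  have h := Stream'.append_take 0 x y
  simpa using h

/-- The factor of an infinite word as a nonempty word. -/
def blk (w : Stream' A) (i j : ℕ) : FreeSemigroup A := ⟨w.get i, seg w (i + 1) j⟩

theorem letters_blk (w : Stream' A) {i j : ℕ} (h : i < j) : letters (blk w i j) = seg w i j := by
  rw [← seg_append w (Nat.le_succ i) h]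
  have : seg w i i.succ = [w.get i] := by simp [seg, Stream'.take_succ]
  rw [this]
  rfl

theorem ext_of_prefixes {w w' : Stream' A}
    (h : ∀ n, ∃ (x : List A) (y y' : Stream' A), n ≤ x.length ∧ w = x ++ₛ y ∧ w' = x ++ₛ y') :
    w = w' := by
  refine Stream'.ext fun n => ?_
  obtain ⟨x, y, y', hn, rfl, rfl⟩ := h (n + 1)
  rw [Stream'.get_append_left _ _ _ hn, Stream'.get_append_left _ _ _ hn]

theorem concat_append (n : ℕ) (f : Stream' (FreeSemigroup A)) : concat f =
    ((f.take n).map letters).flatten ++ₛ concat (f.drop n) := by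
  induction n generalizing f with
  | zero => rfl
  | succ n ihn =>
    rw [Wd.concat_cons, ihn f.tail, Stream'.take_succ, List.map_cons, List.flatten_cons,
      Stream'.append_append_stream]
    rfl

/-- The factors of an infinite word between consecutive positions of a sequence. -/
def blks (w : Stream' A) (m : ℕ → ℕ) : Stream' (FreeSemigroup A) :=
  fun i => blk w (m i) (m (i + 1))

theorem drop_eq_concat (w : Stream' A) {m : ℕ → ℕ} (hm : StrictMono m) :
    w.drop (m 0) = concat (blks w m) := by
  have key : ∀ n, (((blks w m).take n).map letters).flatten = seg w (m 0) (m n) := by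
    intro n
    induction n with
    | zero => simp [seg]
    | succ n ih =>
      rw [Stream'.take_succ', List.map_append, List.flatten_append, ih]
      have h1 : m n < m (n + 1) := hm (Nat.lt_succ_self n)
      change _ ++ [letters (blk w (m n) (m (n + 1)))].flatten = _
      rw [List.flatten_singleton, letters_blk w h1,
        seg_append w (hm.monotone (Nat.zero_le n)) h1.le]
  refine ext_of_prefixes fun n => ⟨seg w (m 0) (m n), w.drop (m n), concat ((blks w m).drop n), ?_,
    (seg_append_drop w (hm.monotone (Nat.zero_le n))).symm, ?_⟩
  · rw [length_seg]
    have h : ∀ n, m 0 + n ≤ m n := by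
      intro n
      induction n with
      | zero => exact le_rfl
      | succ n ih => have := hm (Nat.lt_add_one n); omega
    have := h n
    omega
  · rw [← key n]
    exact concat_append n _

end Word

/-! ### Common factorizations of infinite words of the same type -/

namespace Sat

open Word Wd

variable {A S T : Type*} [Semigroup S] [OmegaSemigroup S T]

/-- Ramsey's theorem for the values of the factors. The cuts are taken from a prescribed sequence
`m`, so that knowledge of the types of the factors along `m` remains available. -/
theorem exists_value [Finite S] (α : OmegaHom (FreeSemigroup A) (Stream' A) S T) (w : Stream' A)
    {m : ℕ → ℕ} (hm : StrictMono m) (h0 : 0 < m 0) : ∃ a b, a < b ∧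
      α.inf w = α.fin (blk w 0 (m a)) •
        (OmegaSemigroup.iprod (Stream'.const (α.fin (blk w (m a) (m b)))) : T) := by
  obtain ⟨k, e, hk, he⟩ := exists_strictMono_homogeneous fun i j => α.fin (blk w (m i) (m j))
  refine ⟨k 0, k 1, hk Nat.zero_lt_one, ?_⟩
  have h1 : w = blk w 0 (m (k 0)) •
      (OmegaSemigroup.iprod (blks w (m ∘ k)) : Stream' A) := by
    have h2 := seg_append_drop w (Nat.zero_le (m (k 0)))
    have h3 : 0 < m (k 0) := h0.trans_le (hm.monotone (Nat.zero_le _))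
    rw [← letters_blk w h3] at h2
    refine (Eq.symm h2).trans ?_
    exact congrArg (letters (blk w 0 (m (k 0))) ++ₛ ·) (drop_eq_concat w (hm.comp hk))
  conv_lhs => rw [h1, α.map_smul, α.map_iprod]
  congr 2
  refine funext fun i => ?_
  change α.fin (blk w (m (k i)) (m (k (i + 1)))) = α.fin (blk w (m (k 0)) (m (k 1)))
  rw [he _ _ (Nat.lt_succ_self i), he _ _ Nat.zero_lt_one]

/-- One move of an Ehrenfeucht–Fraïssé game on the suffixes: a cut in one word is answered in the
other, at the price of one rank. -/
theorem exists_cut {k i i' : ℕ} {w w' : Stream' A}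
    (h : tp (k + 1) (inf (w.drop i)) = tp (k + 1) (inf (w'.drop i'))) {j : ℕ} (hj : i ≤ j) :
    ∃ j', i' ≤ j' ∧ tp k (fin (seg w i j)) = tp k (fin (seg w' i' j')) ∧
      tp k (inf (w.drop j)) = tp k (inf (w'.drop j')) := by
  rw [← seg_append_drop w hj, ← app_inf] at h
  obtain ⟨x, y, he, h1, h2⟩ := tp_cut (by simp) h
  rcases y with y | y
  · simp at he
  · simp only [app_inf, inf.injEq] at he
    obtain ⟨hx, hy⟩ := eq_take_of_append he
    refine ⟨i' + x.length, Nat.le_add_right _ _, ?_, ?_⟩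
    · rw [h1, seg, Nat.add_sub_cancel_left, ← hx]
    · rw [h2, ← Stream'.drop_drop, ← hy]

/-- Two infinite words of the same type have factorizations of the same type. -/
theorem exists_factorizations [Finite A] {r : ℕ} (hr : 0 < r) {w w' : Stream' A}
    (h : tp (r + 5) (inf w) = tp (r + 5) (inf w')) :
    ∃ (m m' : ℕ → ℕ) (x y : List A), StrictMono m ∧ StrictMono m' ∧ 0 < m 0 ∧ 0 < m' 0 ∧
      (∀ i, tp r (fin (seg w 0 (m i))) = tp r (fin x)) ∧
      (∀ i j, i < j → tp r (fin (seg w (m i) (m j))) = tp r (fin y)) ∧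
      (∀ i, tp r (fin (seg w' 0 (m' i))) = tp r (fin x)) ∧
      (∀ i j, i < j → tp r (fin (seg w' (m' i) (m' j))) = tp r (fin y)) := by
  -- Both words are cut by Ramsey's theorem, with idempotent types `τ` and `τ'` that may differ. The
  -- first word uses rank `r + 1`, since its factors will be cut once more. Alternating moves at
  -- Ramsey cuts then relate `τ` to `τ'`.
  obtain ⟨p, γ, hp, hγ⟩ := exists_strictMono_homogeneous fun i j => tp (r + 1) (fin (seg w i j))
  obtain ⟨q, γ', hq, hγ'⟩ := exists_strictMono_homogeneous fun i j => tp r (fin (seg w' i j))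
  have hpn : ∀ n, n ≤ p n := fun n => hp.le_apply
  have hqn : ∀ n, n ≤ q n := fun n => hq.le_apply
  -- the moves
  obtain ⟨s₀, -, hX, h1⟩ := exists_cut (i := 0) (i' := 0) h.symm (Nat.zero_le (q 1))
  obtain ⟨s₁, hs₁, hH, h2⟩ := exists_cut h1.symm (j := p (s₀ + 2)) ((by omega : s₀ ≤ s₀ + 2).trans
    (hpn _))
  obtain ⟨s₂, hs₂, hZ, h3⟩ := exists_cut h2.symm (j := q (s₁ + 2)) ((by omega : s₁ ≤ s₁ + 2).trans
    (hqn _))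
  obtain ⟨s₃, hs₃, hT, h4⟩ := exists_cut h3.symm (j := p (s₂ + 2)) ((by omega : s₂ ≤ s₂ + 2).trans
    (hpn _))
  obtain ⟨s₄, hs₄, hR, -⟩ := exists_cut h4.symm (j := q (s₃ + 2)) ((by omega : s₃ ≤ s₃ + 2).trans
    (hqn _))
  -- the monoid of types
  let c : Con (FreeMonoid A) :=
    { r := fun u v => tp r (fin (FreeMonoid.toList u)) = tp r (fin (FreeMonoid.toList v))
      iseqv := ⟨fun _ => rfl, Eq.symm, Eq.trans⟩
      mul' := fun h h' => tp_append h h' }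
  let t : List A → c.Quotient := fun l => (FreeMonoid.ofList l : c.Quotient)
  have ht : ∀ u v, t u = t v ↔ tp r (fin u) = tp r (fin v) := fun u v => c.eq
  have htm : ∀ u v, t (u ++ v) = t u * t v := fun u v => rfl
  have hseg : ∀ (w : Stream' A) {i j l : ℕ}, i ≤ j → j ≤ l →
      t (seg w i l) = t (seg w i j) * t (seg w j l) := fun w i j l hij hjl => by
    rw [← htm, seg_append w hij hjl]
  set X := t (seg w' 0 (q 1)) with hXdef
  set H := t (seg w s₀ (p (s₀ + 2))) with hHdef
  set Z := t (seg w' s₁ (q (s₁ + 2))) with hZdef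
  set E := t (seg w s₂ (p (s₂ + 2))) with hEdef
  set R := t (seg w' s₃ (q (s₃ + 2))) with hRdef
  set τ := t (seg w (p 0) (p 1)) with hτdef
  set τ' := t (seg w' (q 0) (q 1)) with hτ'def
  have hτ : ∀ i j, i < j → t (seg w (p i) (p j)) = τ := fun i j hij =>
    (ht _ _).2 (tp_of_succ ((hγ i j hij).trans (hγ 0 1 Nat.zero_lt_one).symm))
  have hτ' : ∀ i j, i < j → t (seg w' (q i) (q j)) = τ' := fun i j hij =>
    (ht _ _).2 ((hγ' i j hij).trans (hγ' 0 1 Nat.zero_lt_one).symm)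
  have mono : ∀ {k : ℕ} {u v : List A}, r ≤ k → tp k (fin u) = tp k (fin v) → t u = t v :=
    fun hk hh => (ht _ _).2 (tp_mono hk hh)
  have hX' : t (seg w 0 s₀) = X := (mono (by omega) hX).symm
  have hH' : t (seg w' (q 1) s₁) = H := (mono (by omega) hH).symm
  have hZ' : t (seg w (p (s₀ + 2)) s₂) = Z := (mono (by omega) hZ).symm
  have hT' : t (seg w' (q (s₁ + 2)) s₃) = E := (mono (by omega) hT).symm
  have hττ : τ' * τ' = τ' := by
    have e := hseg w' (hq.monotone (by omega : 0 ≤ 1)) (hq.monotone (by omega : 1 ≤ 2))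
    rw [hτ' 0 2 (by omega), hτ' 1 2 (by omega)] at e
    exact e.symm
  have eHZ : H * Z = τ' := by
    have hl : s₁ ≤ q (s₁ + 2) := (by omega : s₁ ≤ s₁ + 2).trans (hqn _)
    rw [← hH', hZdef, ← hseg w' hs₁ hl]
    exact hτ' _ _ (by omega)
  have hlt : s₀ + 2 < s₂ + 2 := by
    have := hpn (s₀ + 2)
    omega
  have eZE : Z * E = τ := by
    rw [← hZ', hEdef, ← hseg w hs₂ ((by omega : s₂ ≤ s₂ + 2).trans (hpn _))]
    exact hτ _ _ hlt
  have eER : E * R = τ' := by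
    rw [← hT', hRdef, ← hseg w' hs₃ ((by omega : s₃ ≤ s₃ + 2).trans (hqn _))]
    refine hτ' _ _ ?_
    have := hqn (s₁ + 2)
    omega
  have eZτ : Z * τ' = Z := by
    have e : Z = t (seg w' s₁ (q (s₁ + 1))) * τ' := by
      rw [hZdef, hseg w' ((by omega : s₁ ≤ s₁ + 1).trans (hqn _))
        (hq.monotone (by omega : s₁ + 1 ≤ s₁ + 2)), hτ' _ _ (by omega)]
    rw [e, mul_assoc, hττ]
  have hττ2 : τ * τ = τ := by
    have e := hseg w (hp.monotone (by omega : 0 ≤ 1)) (hp.monotone (by omega : 1 ≤ 2))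
    rw [hτ 0 2 (by omega), hτ 1 2 (by omega)] at e
    exact e.symm
  have eEτ : E * τ = E := by
    have e : E = t (seg w s₂ (p (s₂ + 1))) * τ := by
      rw [hEdef, hseg w ((by omega : s₂ ≤ s₂ + 1).trans (hpn _))
        (hp.monotone (by omega : s₂ + 1 ≤ s₂ + 2)), hτ _ _ (by omega)]
    rw [e, mul_assoc, hττ2]
  -- With `Z E = τ` this makes `τ` and `τ'` conjugate. Each factor of type `τ` of the first word can
  -- be cut into parts of types `Z` and `E`, and regrouping between these new cuts gives factors of
  -- type `E Z = τ'`, as in the second word.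
  have eEZ : E * Z = τ' := by
    calc E * Z = E * Z * τ' := by rw [mul_assoc, eZτ]
      _ = E * (Z * E) * R := by rw [← eER]; simp only [mul_assoc]
      _ = τ' := by rw [eZE, eEτ, eER]
  -- the cuts of the first word
  have hcut : ∀ i, ∃ n, p (s₀ + 2 + i) ≤ n ∧ n < p (s₀ + 2 + (i + 1)) ∧
      t (seg w (p (s₀ + 2 + i)) n) = Z ∧ t (seg w n (p (s₀ + 2 + (i + 1)))) = E := by
    intro i
    have hl : s₂ < p (s₂ + 2) := (by omega : s₂ < s₂ + 2).trans_le (hpn _)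
    have h5 : tp (r + 1) (app (seg w (p (s₀ + 2)) s₂) (fin (seg w s₂ (p (s₂ + 2))))) =
        tp (r + 1) (fin (seg w (p (s₀ + 2 + i)) (p (s₀ + 2 + (i + 1))))) := by
      rw [app_fin, seg_append w hs₂ hl.le]
      exact (hγ _ _ hlt).trans (hγ _ _ (by omega)).symm
    have hne : seg w s₂ (p (s₂ + 2)) ≠ [] := by
      rw [← List.length_pos_iff, length_seg]
      omega
    obtain ⟨x, y, h6, h7, h8⟩ := tp_cut (by simpa using hne) h5
    rcases y with y | y
    swap
    · simp at h6
    simp only [app_fin, fin.injEq] at h6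
    have hle : p (s₀ + 2 + i) ≤ p (s₀ + 2 + (i + 1)) := hp.monotone (by omega)
    have hlen := congrArg List.length h6
    rw [length_seg, List.length_append] at hlen
    have hy : y ≠ [] := by
      rintro rfl
      obtain ⟨r', rfl⟩ := Nat.exists_eq_add_of_lt hr
      rw [Nat.zero_add] at h8
      have := eq_nil_of_tp h8
      simp only [fin.injEq] at this
      exact hne this
    have hy' := List.length_pos_iff.2 hy
    have h9 := seg_append w (i := p (s₀ + 2 + i)) (j := p (s₀ + 2 + i) + x.length)
      (l := p (s₀ + 2 + (i + 1))) (by omega) (by omega)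
    rw [h6] at h9
    obtain ⟨e1, e2⟩ := List.append_inj h9 (by rw [length_seg]; omega)
    refine ⟨p (s₀ + 2 + i) + x.length, by omega, by omega, ?_, ?_⟩
    · rw [e1, ← hZ', ht]
      exact h7.symm
    · rw [e2, hEdef, ht]
      exact h8.symm
  choose n hn1 hn2 hn3 hn4 using hcut
  have hnm : StrictMono n := strictMono_nat_of_lt_succ fun i => (hn2 i).trans_le (hn1 (i + 1))
  have hp0 : s₀ ≤ p (s₀ + 2) := (by omega : s₀ ≤ s₀ + 2).trans (hpn _)
  have block : ∀ (v : Stream' A) (m : ℕ → ℕ), StrictMono m →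
      (∀ i, t (seg v (m i) (m (i + 1))) = τ') → t (seg v 0 (m 0)) = X * τ' →
      (∀ i, t (seg v 0 (m i)) = X * τ') ∧ ∀ i j, i < j → t (seg v (m i) (m j)) = τ' := by
    intro v m hm h1 h2
    constructor
    · intro i
      induction i with
      | zero => exact h2
      | succ i ih =>
        rw [hseg v (Nat.zero_le (m i)) (hm.monotone (Nat.le_succ i)), ih, h1, mul_assoc, hττ]
    · intro i j hij
      induction j, hij using Nat.le_induction with
      | base => exact h1 i
      | succ j hj ih =>
        rw [hseg v (hm.monotone (by omega : i ≤ j)) (hm.monotone (Nat.le_succ j)), ih, h1, hττ]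
  -- The prefix before the first new cut has type `X H Z = X τ'`, which is the type of the prefix of
  -- the second word before `q 2`.
  obtain ⟨b1, b2⟩ := block w n hnm
    (fun i => by rw [hseg w (hn2 i).le (hn1 (i + 1)), hn4, hn3, eEZ])
    (by rw [hseg w (Nat.zero_le _) (hn1 0), Nat.add_zero, hseg w (Nat.zero_le s₀) hp0, hX']
        have e := hn3 0
        rw [Nat.add_zero] at e
        rw [e, mul_assoc]
        change X * (H * Z) = X * τ'
        rw [eHZ])
  obtain ⟨b3, b4⟩ := block w' (fun i => q (2 + i))
    (fun i j hij => hq (by omega)) (fun i => hτ' _ _ (by omega))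
    (by rw [Nat.add_zero, hseg w' (Nat.zero_le (q 1)) (hq.monotone (by omega : 1 ≤ 2)),
          hτ' 1 2 (by omega)])
  refine ⟨n, fun i => q (2 + i), seg w' 0 (q 1) ++ seg w' (q 0) (q 1), seg w' (q 0) (q 1),
    hnm, fun i j hij => hq (by omega), ?_, ?_, ?_, ?_, ?_, ?_⟩
  · have := hn1 0
    have := hpn (s₀ + 2 + 0)
    omega
  · have := hqn (2 + 0)
    change 0 < q (2 + 0)
    omega
  · exact fun i => (ht _ _).1 (b1 i)
  · exact fun i j hij => (ht _ _).1 (b2 i j hij)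
  · exact fun i => (ht _ _).1 (b3 i)
  · exact fun i j hij => (ht _ _).1 (b4 i j hij)

theorem close_of_tp [Finite A] [Finite S] (α : OmegaHom (FreeSemigroup A) (Stream' A) S T)
    {w w' : Stream' A} (h : tp (rank S + 5) (inf w) = tp (rank S + 5) (inf w')) :
    Close (img α.fin) (α.inf w) (α.inf w') := by
  obtain ⟨m, m', x, y, hm, hm', h0, h0', h1, h2, h3, h4⟩ :=
    exists_factorizations (by rw [rank]; omega) h
  obtain ⟨a, b, hab, e1⟩ := exists_value α w hm h0
  obtain ⟨a', b', hab', e2⟩ := exists_value α w' hm' h0'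
  have p1 : 0 < m a := h0.trans_le (hm.monotone (Nat.zero_le a))
  have p2 : 0 < m' a' := h0'.trans_le (hm'.monotone (Nat.zero_le a'))
  obtain ⟨X, hX, hX'⟩ := exists_isSat_of_tp α.fin (blk w 0 (m a))
  obtain ⟨E, hE, hE'⟩ := exists_isSat_of_tp α.fin (blk w (m a) (m b))
  refine ⟨X, E, hX, hE, _, hX' _ rfl, _, hX' _ ?_, _, hE' _ rfl, _, hE' _ ?_, e1, e2⟩
  · rw [letters_blk w p1, letters_blk w' p2, h1, h3]
  · rw [letters_blk w (hm hab), letters_blk w' (hm' hab'), h2 _ _ hab, h4 _ _ hab']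

theorem close_self [Finite S] (α : OmegaHom (FreeSemigroup A) (Stream' A) S T) (w : Stream' A) :
    Close (img α.fin) (α.inf w) (α.inf w) := by
  obtain ⟨a, b, -, e⟩ := exists_value α w (m := fun i => i + 1) (fun i j h => Nat.succ_lt_succ h)
    Nat.zero_lt_one
  obtain ⟨X, hX, hX'⟩ := exists_isSat_of_tp α.fin (blk w 0 (a + 1))
  obtain ⟨E, hE, hE'⟩ := exists_isSat_of_tp α.fin (blk w (a + 1) (b + 1))
  exact ⟨X, E, hX, hE, _, hX' _ rfl, _, hX' _ rfl, _, hE' _ rfl, _, hE' _ rfl, e, e⟩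

/-- The rank at which the values of infinite words are controlled by the saturation. -/
theorem close_of_tp_card [Finite A] [Finite S] (α : OmegaHom (FreeSemigroup A) (Stream' A) S T)
    {w w' : Stream' A} (h : tp (Nat.card A * 2 ^ (Nat.card S ^ 2) + 1) (inf w) =
      tp (Nat.card A * 2 ^ (Nat.card S ^ 2) + 1) (inf w')) :
    Close (img α.fin) (α.inf w) (α.inf w') := by
  -- The stated rank can be too small in two degenerate cases. With at most one letter, any two
  -- infinite words are equal; with at most one element in `S`, all infinite words have the same
  -- value.
  rcases le_or_gt (Nat.card A) 1 with hA | hA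
  · have := Finite.card_le_one_iff_subsingleton.1 hA
    rw [show w' = w from Stream'.ext fun n => Subsingleton.elim _ _]
    exact close_self α w
  rcases le_or_gt (Nat.card S) 1 with hS | hS
  · have := Finite.card_le_one_iff_subsingleton.1 hS
    have e : ∀ v : Stream' A, v = OmegaSemigroup.iprod (blks v id) := fun v =>
      drop_eq_concat v (m := id) strictMono_id
    have : α.inf w' = α.inf w := by
      rw [e w, e w', α.map_iprod, α.map_iprod]
      congr 1
      exact funext fun i => Subsingleton.elim _ _
    rw [this]
    exact close_self α w
  refine close_of_tp α (tp_mono ?_ h)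
  rw [rank]
  have h1 : Nat.card S + 1 ≤ Nat.card S ^ 2 := by nlinarith
  have h2 : 2 ^ (Nat.card S + 1) ≤ 2 ^ (Nat.card S ^ 2) := Nat.pow_le_pow_right (by omega) h1
  have h3 : 2 ^ 3 ≤ 2 ^ (Nat.card S ^ 2) := Nat.pow_le_pow_right (by omega) (by nlinarith)
  have h4 : 2 * 2 ^ (Nat.card S ^ 2) ≤ Nat.card A * 2 ^ (Nat.card S ^ 2) :=
    Nat.mul_le_mul_right _ hA
  rw [pow_succ] at h2
  omega

end Sat


/-! ## Sentences of rank `k` do not distinguish words of the same type -/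

namespace Word

open Wd

variable {A : Type*}

theorem inf_eq_app_cons_iff {w : Stream' A} {x : List A} {a : A} {y : Wd A} :
    inf w = app x (cons a y) ↔
      ∃ p, x = w.take p ∧ a = w.get p ∧ y = inf (w.drop (p + 1)) := by
  constructor
  · intro h
    obtain ⟨z, h', rfl⟩ := inf_eq_app_cons.1 h
    obtain ⟨h1, h2⟩ := eq_take_of_append h'
    refine ⟨x.length, h1, ?_, ?_⟩
    · have := Stream'.get_append_right 0 x (z.cons a)
      rw [← h'] at this
      exact this.symm
    · rw [← Stream'.drop_drop, ← h2]; rfl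
  · rintro ⟨p, rfl, rfl, rfl⟩
    rw [cons_inf, app_inf]
    congr 1
    conv_lhs => rw [← Stream'.append_take_drop p w]
    congr 1
    exact ((Stream'.eta (w.drop p)).symm.trans (by
      rw [Stream'.head_drop, Stream'.tail_drop']))

theorem exists_position {k : ℕ} {w w' : Stream' A} (h : tp (k + 1) (inf w) = tp (k + 1) (inf w'))
    (p : ℕ) : ∃ p', tp k (fin (w.take p)) = tp k (fin (w'.take p')) ∧ w.get p = w'.get p' ∧
      tp k (inf (w.drop (p + 1))) = tp k (inf (w'.drop (p' + 1))) := by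
  obtain ⟨x', y', hw, h1, h2⟩ := tp_sub h _ _ _ (inf_eq_app_cons_iff.2 ⟨p, rfl, rfl, rfl⟩)
  obtain ⟨p', rfl, h3, rfl⟩ := inf_eq_app_cons_iff.1 hw
  exact ⟨p', h1, h3, h2⟩

/-- An infinite word together with the positions of some variables. -/
def mark {n : ℕ} (w : Stream' A) (a : Fin n → ℕ) : Stream' (A × (Fin n → Bool)) :=
  fun p => (w.get p, fun i => decide (a i = p))

theorem mark_snoc {n : ℕ} (w : Stream' A) (a : Fin n → ℕ) (x : ℕ) :
    inf (mark w (Fin.snoc a x : Fin (n + 1) → ℕ)) =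
      app (((mark w a).take x).map fun c => (c.1, Fin.snoc c.2 false))
        (cons (((mark w a).get x).1, Fin.snoc ((mark w a).get x).2 true)
          (Wd.map (fun c => (c.1, Fin.snoc c.2 false)) (inf ((mark w a).drop (x + 1))))) := by
  have hs : ∀ p, (mark w (Fin.snoc a x : Fin (n + 1) → ℕ)).get p =
      ((mark w a |>.get p).1, Fin.snoc ((mark w a).get p).2 (decide (x = p))) := by
    intro p
    refine Prod.ext rfl (funext fun i => ?_)
    refine Fin.lastCases ?_ (fun i => ?_) i <;> simp [mark, Stream'.get]
  refine inf_eq_app_cons_iff.2 ⟨x, ?_, ?_, ?_⟩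
  · refine List.ext_getElem (by simp) fun p h1 h2 => ?_
    simp only [List.length_map, Stream'.length_take] at h1
    simp only [List.getElem_map, Stream'.take_get, hs]
    simp [show x ≠ p by omega]
  · rw [hs]; simp
  · refine congrArg inf (Stream'.ext fun p => ?_)
    simp only [Stream'.get_map, Stream'.get_drop, hs]
    simp [show x ≠ x + 1 + p by omega]

/-- Giving a value to a new variable splits the marked word at that position, and one rank allows
the split to be copied. -/
theorem mark_of_tp {n k : ℕ} {w w' : Stream' A} {a a' : Fin n → ℕ}
    (h : tp (k + 1) (inf (mark w a)) = tp (k + 1) (inf (mark w' a'))) (x : ℕ) :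
    ∃ x', tp k (inf (mark w (Fin.snoc a x : Fin (n + 1) → ℕ))) =
      tp k (inf (mark w' (Fin.snoc a' x' : Fin (n + 1) → ℕ))) := by
  obtain ⟨x', h1, h2, h3⟩ := exists_position h x
  refine ⟨x', ?_⟩
  rw [mark_snoc, mark_snoc, h2]
  exact tp_app (tp_map _ (u := fin _) (v := fin _) h1)
    (tp_app (u := [_]) (u' := [_]) rfl (tp_map _ h3))

theorem mark_eq_iff {n : ℕ} {w w' : Stream' A} {a a' : Fin n → ℕ}
    (h : tp 1 (inf (mark w a)) = tp 1 (inf (mark w' a'))) (i j : Fin n) :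
    (a i = a j ↔ a' i = a' j) ∧ w.get (a i) = w'.get (a' i) := by
  obtain ⟨p', -, h2, -⟩ := exists_position h (a i)
  have h3 := congrFun (congrArg Prod.snd h2) i
  have h4 := congrFun (congrArg Prod.snd h2) j
  have h5 := congrArg Prod.fst h2
  simp only [mark, Stream'.get, decide_eq_decide, true_iff] at h3 h4 h5
  subst h3
  exact ⟨by rw [eq_comm, h4, eq_comm], h5⟩

theorem mem_take_mark {n : ℕ} {w : Stream' A} {a : Fin n → ℕ} {p : ℕ} {i : Fin n} :
    (∃ c ∈ (mark w a).take p, c.2 i = true) ↔ a i < p := by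
  constructor
  · rintro ⟨c, hc, hi⟩
    obtain ⟨q, hq, rfl⟩ := List.getElem_of_mem hc
    rw [Stream'.length_take] at hq
    rw [Stream'.take_get] at hi
    have : a i = q := by simpa [mark, Stream'.get] using hi
    omega
  · intro h
    have h' : a i < ((mark w a).take p).length := by simpa using h
    refine ⟨_, List.getElem_mem h', ?_⟩
    rw [Stream'.take_get]
    simp [mark, Stream'.get]

/-- One rank finds the position of variable `j`, and a second one tells whether the mark of `i`
occurs in the prefix before it. -/
theorem mark_lt_iff {n : ℕ} {w w' : Stream' A} {a a' : Fin n → ℕ}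
    (h : tp 2 (inf (mark w a)) = tp 2 (inf (mark w' a'))) (i j : Fin n) :
    a i < a j ↔ a' i < a' j := by
  obtain ⟨p', h1, h2, -⟩ := exists_position h (a j)
  have h3 := congrFun (congrArg Prod.snd h2) j
  simp only [mark, Stream'.get, decide_eq_decide, true_iff] at h3
  subst h3
  rw [← mem_take_mark (w := w), ← mem_take_mark (w := w')]
  have key : ∀ {u v : List (A × (Fin n → Bool))}, tp 1 (fin u) = tp 1 (fin v) →
      ∀ c ∈ u, c ∈ v := by
    intro u v huv c hc
    obtain ⟨x, y, rfl⟩ := List.append_of_mem hc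
    obtain ⟨x', y', hv, -⟩ := tp_sub huv x c (fin y) rfl
    obtain ⟨z, rfl, -⟩ := fin_eq_app_cons.1 hv
    simp
  exact ⟨fun ⟨c, hc, hi⟩ => ⟨c, key h1 c hc, hi⟩, fun ⟨c, hc, hi⟩ => ⟨c, key h1.symm c hc, hi⟩⟩

end Word

namespace FOWord

open FirstOrder Word Wd

variable {A : Type*}

/-- The truth of a formula in an infinite word. -/
def Holds (w : Stream' A) {n : ℕ} (φ : (lang A).BoundedFormula Empty n) (a : Fin n → ℕ) : Prop :=
  letI := structureOf w
  φ.Realize default a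

theorem models_iff (w : Stream' A) (φ : (lang A).Sentence) :
    Models w φ ↔ Holds w φ default := by
  unfold Models Holds Language.Sentence.Realize Language.Formula.Realize
  convert Iff.rfl

section

variable (w : Stream' A) {n : ℕ} (φ ψ : (lang A).BoundedFormula Empty n) (a : Fin n → ℕ)

theorem holds_falsum : Holds w (.falsum : (lang A).BoundedFormula Empty n) a ↔ False := Iff.rfl

theorem holds_imp : Holds w (.imp φ ψ) a ↔ (Holds w φ a → Holds w ψ a) := Iff.rfl

theorem holds_all (φ : (lang A).BoundedFormula Empty (n + 1)) :
    Holds w (.all φ) a ↔ ∀ x, Holds w φ (Fin.snoc a x) := Iff.rfl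

end

theorem term_eq_var {n : ℕ} (t : (lang A).Term (Empty ⊕ Fin n)) : ∃ i, t = .var (.inr i) := by
  rcases t with (e | i) | f
  · exact e.elim
  · exact ⟨i, rfl⟩
  · exact nomatch f

/-- A back-and-forth argument on marked words; the two extra ranks are what atomic formulas need, by
`mark_lt_iff`. -/
theorem holds_iff_of_tp {n : ℕ} (φ : (lang A).BoundedFormula Empty n) {k : ℕ} (hk : qrank φ ≤ k)
    {w w' : Stream' A} {a a' : Fin n → ℕ}
    (h : tp (k + 2) (inf (mark w a)) = tp (k + 2) (inf (mark w' a'))) :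
    Holds w φ a ↔ Holds w' φ a' := by
  induction φ generalizing k with
  | falsum => exact Iff.rfl
  | equal s t =>
    obtain ⟨i, rfl⟩ := term_eq_var s
    obtain ⟨j, rfl⟩ := term_eq_var t
    exact (mark_eq_iff (tp_mono (by omega) h) i j).1
  | rel R ts =>
    obtain ⟨v, rfl⟩ : ∃ v : _ → Fin _, ts = fun i => .var (.inr (v i)) := by
      choose v hv using fun i => term_eq_var (ts i)
      exact ⟨v, funext hv⟩
    cases R with
    | letter c =>
      have := (mark_eq_iff (tp_mono (by omega) h) (v 0) (v 0)).2
      change w.get (a (v 0)) = c ↔ w'.get (a' (v 0)) = c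
      rw [this]
    | lt => exact mark_lt_iff (tp_mono (by omega) h) (v 0) (v 1)
  | imp φ ψ ihφ ihψ =>
    simp only [qrank, max_le_iff] at hk
    rw [holds_imp, holds_imp, ihφ hk.1 h, ihψ hk.2 h]
  | all φ ih =>
    obtain ⟨k, rfl⟩ : ∃ l, k = l + 1 := ⟨k - 1, by simp only [qrank] at hk; omega⟩
    simp only [qrank, Nat.add_le_add_iff_right] at hk
    rw [holds_all, holds_all]
    constructor
    · intro H x'
      obtain ⟨x, hx⟩ := mark_of_tp h.symm x'
      exact (ih hk hx.symm).1 (H x)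
    · intro H x
      obtain ⟨x', hx⟩ := mark_of_tp h x
      exact (ih hk hx).2 (H x')

theorem models_iff_of_tp (φ : (lang A).Sentence) {w w' : Stream' A}
    (h : tp (qrank φ + 2) (inf w) = tp (qrank φ + 2) (inf w')) : Models w φ ↔ Models w' φ := by
  rw [models_iff, models_iff]
  refine holds_iff_of_tp φ le_rfl ?_
  have e : ∀ w : Stream' A, inf (mark w (default : Fin 0 → ℕ)) =
      Wd.map (fun c => (c, (Fin.elim0 : Fin 0 → Bool))) (inf w) := fun w =>
    congrArg inf (Stream'.ext fun p => Prod.ext rfl (funext fun i => i.elim0))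
  rw [e, e]
  exact tp_map _ h

theorem not_separable_of_close {S T : Type*} [Semigroup S] [OmegaSemigroup S T] [Finite S]
    {α : OmegaHom (FreeSemigroup A) (Stream' A) S T} {F₀ F₁ : Set T}
    (h : Separable (α.inf ⁻¹' F₀) (α.inf ⁻¹' F₁)) {p q : T} (hp : p ∈ F₀) (hq : q ∈ F₁) :
    ¬ Sat.Close (Sat.img α.fin) p q := by
  intro hc
  obtain ⟨φ, h0, h1⟩ := h
  obtain ⟨w, w', rfl, rfl, ht⟩ := hc.exists_words (qrank φ + 2)
  have h2 : Models w φ := h0 hp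
  have h3 : w' ∈ α.inf ⁻¹' F₁ ∩ langOf φ := ⟨hq, (models_iff_of_tp φ ht).1 h2⟩
  rw [h1] at h3
  exact h3

end FOWord


/-! ## Formulas that define the types of ultimately periodic words -/

namespace Wd

open Word

variable {A B : Type*}

/-- The factorizations `x a y` of a list. -/
def splits : List A → List (List A × A × List A)
  | [] => []
  | a :: l => ([], a, l) :: (splits l).map fun s => (a :: s.1, s.2)

theorem mem_splits {l x y : List A} {a : A} : (x, a, y) ∈ splits l ↔ l = x ++ a :: y := by
  induction l generalizing x with
  | nil => simp [splits]
  | cons b l ih =>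
    cases x with
    | nil => simp [splits, eq_comm]
    | cons c x => simp [splits, ih, and_comm, eq_comm]

/-- The `t`-th power of a word. -/
def rep (t : ℕ) (v : List A) : List A := (List.replicate t v).flatten

theorem rep_add (s t : ℕ) (v : List A) : rep (s + t) v = rep s v ++ rep t v := by
  rw [rep, List.replicate_add, List.flatten_append]; rfl

theorem rep_nil (t : ℕ) : rep t ([] : List A) = [] := by simp [rep]

/-- The word `u v v v ⋯`, or `u` if `v` is empty. -/
def up (u : List A) : List A → Wd A
  | [] => fin u
  | b :: l => inf (u ++ₛ concat (Stream'.const ⟨b, l⟩))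

theorem app_up (x u v : List A) : app x (up u v) = up (x ++ u) v := by
  cases v <;> simp [up, Stream'.append_append_stream]

theorem up_rep (t : ℕ) (u v : List A) : up (u ++ rep t v) v = up u v := by
  cases v with
  | nil => simp [rep_nil]
  | cons b l =>
    induction t with
    | zero => simp [rep]
    | succ t ih =>
      rw [rep_add, ← List.append_assoc, ← app_up, ← ih, ← List.append_nil (u ++ rep t _), ← app_up,
        List.append_nil]
      congr 1
      simp only [up, Stream'.nil_append_stream]
      conv_rhs => rw [concat_cons]
      simp only [rep, List.replicate_one, List.flatten_singleton]
      rfl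

theorem up_of_rep {t : ℕ} {u v x y : List A} {a : A} (h : u ++ rep t v = x ++ a :: y) :
    up u v = app x (cons a (up y v)) := by
  rw [← up_rep t, h, cons, app_up, app_up]
  rfl

/-- A letter far out in the periodic part can be moved back into the last of the `t` copies of `v`.
At least `2 ^ k - 1` copies precede it in both places, which rank `k` cannot tell apart, and what
follows is the same infinite word. So finitely many splits represent all of them. -/
theorem exists_split_of_up {k t : ℕ} (ht : 2 ^ k ≤ t) {u v x : List A} {a : A} {y : Wd A}
    (h : up u v = app x (cons a y)) : ∃ x' y', (x', a, y') ∈ splits (u ++ rep t v) ∧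
      tp k (fin x) = tp k (fin x') ∧ tp k y = tp k (up y' v) := by
  cases v with
  | nil =>
    obtain ⟨z, rfl, rfl⟩ := fin_eq_app_cons.1 h
    exact ⟨x, z, by simp [mem_splits, rep_nil], rfl, rfl⟩
  | cons c l =>
    rw [← List.append_nil u, ← app_up, app_eq_app_cons] at h
    rcases h with ⟨z, rfl, rfl⟩ | ⟨z, rfl, h⟩
    · exact ⟨x, z ++ rep t (c :: l), by simp [mem_splits], rfl, by rw [app_up, up_rep]; simp⟩
    · rw [up, Stream'.nil_append_stream] at h
      obtain ⟨b, x', z', h1, rfl, rfl⟩ := concat_split h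
      have h1 : c :: l = x' ++ a :: z' := h1
      have e : ((Stream'.const (⟨c, l⟩ : FreeSemigroup A)).take b).map letters =
          List.replicate b (c :: l) := by
        refine List.ext_getElem (by simp) fun i _ _ => ?_
        simp [Stream'.take_get, letters]
      rw [e, Stream'.drop_const]
      obtain ⟨b', hb1, hb2⟩ : ∃ b' < t, b = b' ∨ 2 ^ k ≤ b + 1 ∧ 2 ^ k ≤ b' + 1 := by
        by_cases hb : b < t
        · exact ⟨b, hb, Or.inl rfl⟩
        · have : 0 < 2 ^ k := by positivity
          exact ⟨t - 1, by omega, Or.inr ⟨by omega, by omega⟩⟩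
      refine ⟨u ++ (rep b' (c :: l) ++ x'), z' ++ rep (t - b' - 1) (c :: l), ?_, ?_, ?_⟩
      · have : t = b' + (1 + (t - b' - 1)) := by omega
        rw [mem_splits]
        conv_lhs => rw [this]
        rw [rep_add, rep_add, show rep 1 (c :: l) = x' ++ a :: z' by simp [rep, h1]]
        simp
      · refine tp_append rfl (tp_append (tp_flatten (v := c :: l) ?_ ?_ ?_) rfl)
        · exact fun w hw => by rw [List.eq_of_mem_replicate hw]
        · exact fun w hw => by rw [List.eq_of_mem_replicate hw]
        · simpa using hb2
      · rw [up_rep]; rfl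

/-- The factor of an infinite word from a position to before another one or to infinity. -/
def ivl (w : Stream' A) (s : ℕ) : Option ℕ → Wd A
  | none => inf (w.drop s)
  | some e => fin (seg w s e)

theorem ivl_eq_app_cons {w : Stream' A} {s : ℕ} {r : Option ℕ} {x : List A} {a : A} {y : Wd A} :
    ivl w s r = app x (cons a y) ↔ ∃ z, s ≤ z ∧ (∀ e ∈ r, z < e) ∧ x = seg w s z ∧ a = w.get z ∧
      y = ivl w (z + 1) r := by
  cases r with
  | none =>
    rw [ivl, inf_eq_app_cons_iff]
    constructor
    · rintro ⟨p, rfl, rfl, rfl⟩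
      refine ⟨s + p, by omega, by simp, by simp [seg], by simp [Stream'.get_drop], ?_⟩
      rw [ivl, Stream'.drop_drop, Nat.add_assoc]
    · rintro ⟨z, hz, -, rfl, rfl, rfl⟩
      obtain ⟨p, rfl⟩ := Nat.exists_eq_add_of_le hz
      refine ⟨p, by simp [seg], by simp [Stream'.get_drop], ?_⟩
      rw [ivl, Stream'.drop_drop, Nat.add_assoc]
  | some e =>
    have hseg : ∀ z, s ≤ z → z < e → seg w s e = seg w s z ++ w.get z :: seg w (z + 1) e := by
      intro z h1 h2
      rw [← seg_append w h1 h2.le, ← seg_append w (Nat.le_succ z) h2]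
      simp [seg, Stream'.take_succ]
    rw [ivl, fin_eq_app_cons]
    constructor
    · rintro ⟨z, h, rfl⟩
      have hl := congrArg List.length h
      simp only [length_seg, List.length_append, List.length_cons] at hl
      have h' := hseg (s + x.length) (by omega) (by omega)
      rw [h] at h'
      obtain ⟨h1, h2⟩ := List.append_inj h' (by simp [length_seg])
      simp only [List.cons.injEq] at h2
      exact ⟨s + x.length, by omega, by simp; omega, h1, h2.1, by rw [ivl, h2.2]⟩
    · rintro ⟨z, h1, h2, rfl, rfl, rfl⟩
      exact ⟨_, hseg z h1 (h2 e rfl), rfl⟩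

end Wd

namespace FOWord

open FirstOrder Wd Word

variable {A : Type*}

/-- Negation. -/
def neg {n : ℕ} (φ : (lang A).BoundedFormula Empty n) : (lang A).BoundedFormula Empty n :=
  .imp φ .falsum

/-- The conjunction of a list of formulas. -/
def conj {n : ℕ} (l : List ((lang A).BoundedFormula Empty n)) : (lang A).BoundedFormula Empty n :=
  l.foldr (fun φ ψ => neg (.imp φ (neg ψ))) (neg .falsum)

/-- The disjunction of a list of formulas. -/
def disj {n : ℕ} (l : List ((lang A).BoundedFormula Empty n)) : (lang A).BoundedFormula Empty n :=
  l.foldr (fun φ ψ => .imp (neg φ) ψ) .falsum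

/-- The letter at the position of a variable. -/
def letterF {n : ℕ} (c : A) (i : Fin n) : (lang A).BoundedFormula Empty n :=
  .rel (.letter c) ![.var (.inr i)]

/-- The order of two variables. -/
def ltF {n : ℕ} (i j : Fin n) : (lang A).BoundedFormula Empty n :=
  .rel .lt ![.var (.inr i), .var (.inr j)]

/-- Quantify over the positions after `l` (if given) and before `r` (if given). -/
def allBetween {n : ℕ} (l r : Option (Fin n)) (φ : (lang A).BoundedFormula Empty (n + 1)) :
    (lang A).BoundedFormula Empty n :=
  .all (l.elim (r.elim φ fun j => .imp (ltF (Fin.last n) j.castSucc) φ) fun i =>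
    .imp (ltF i.castSucc (Fin.last n)) (r.elim φ fun j => .imp (ltF (Fin.last n) j.castSucc) φ))

section

variable {w : Stream' A} {n : ℕ} {a : Fin n → ℕ}

theorem holds_neg {φ : (lang A).BoundedFormula Empty n} : Holds w (neg φ) a ↔ ¬ Holds w φ a :=
  Iff.rfl

theorem holds_conj {l : List ((lang A).BoundedFormula Empty n)} :
    Holds w (conj l) a ↔ ∀ φ ∈ l, Holds w φ a := by
  induction l with
  | nil => simp [conj, holds_neg, holds_falsum]
  | cons φ l ih =>
    change Holds w (neg (.imp φ (neg (conj l)))) a ↔ _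
    rw [holds_neg, holds_imp, holds_neg, ih]
    simp

theorem holds_disj {l : List ((lang A).BoundedFormula Empty n)} :
    Holds w (disj l) a ↔ ∃ φ ∈ l, Holds w φ a := by
  induction l with
  | nil => simp [disj, holds_falsum]
  | cons φ l ih =>
    change Holds w (.imp (neg φ) (disj l)) a ↔ _
    rw [holds_imp, holds_neg, ih]
    simp only [List.mem_cons, exists_eq_or_imp]
    tauto

theorem holds_allBetween {l r : Option (Fin n)} {φ : (lang A).BoundedFormula Empty (n + 1)} :
    Holds w (allBetween l r φ) a ↔ ∀ z, l.elim 0 (fun i => a i + 1) ≤ z →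
      (∀ e ∈ r.map a, z < e) → Holds w φ (Fin.snoc a z) := by
  have hlt : ∀ (i j : Fin (n + 1)) (b : Fin (n + 1) → ℕ),
    Holds w (ltF i j : (lang A).BoundedFormula Empty (n + 1)) b ↔ b i < b j := fun _ _ _ => Iff.rfl
  rw [allBetween, holds_all]
  refine forall_congr' fun z => ?_
  cases l <;> cases r <;> simp [holds_imp, hlt]

theorem qrank_conj_le {k : ℕ} {l : List ((lang A).BoundedFormula Empty n)}
    (h : ∀ φ ∈ l, qrank φ ≤ k) : qrank (conj l) ≤ k := by
  induction l with
  | nil => exact Nat.zero_le _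
  | cons φ l ih =>
    simp only [List.forall_mem_cons] at h
    change max (max (qrank φ) (max (qrank (conj l)) 0)) 0 ≤ k
    have := ih h.2
    simp [h.1, this]

theorem qrank_disj_le {k : ℕ} {l : List ((lang A).BoundedFormula Empty n)}
    (h : ∀ φ ∈ l, qrank φ ≤ k) : qrank (disj l) ≤ k := by
  induction l with
  | nil => exact Nat.zero_le _
  | cons φ l ih =>
    simp only [List.forall_mem_cons] at h
    change max (max (qrank φ) 0) (qrank (disj l)) ≤ k
    have := ih h.2
    simp [h.1, this]

theorem qrank_allBetween {l r : Option (Fin n)} {φ : (lang A).BoundedFormula Empty (n + 1)} :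
    qrank (allBetween l r φ) = qrank φ + 1 := by
  cases l <;> cases r <;> simp [allBetween, qrank, ltF]

end

/-- A formula that expresses that the positions after `l` and before `r` form a word with the same
rank-`k` type as `u v v v ⋯` (or `u` if `v` is empty), provided that `2 ^ k ≤ t`. -/
def hint (t : ℕ) : (k : ℕ) → {n : ℕ} → (l r : Option (Fin n)) → (u v : List A) →
    (lang A).BoundedFormula Empty n
  | 0, _, _, _, _, _ => neg .falsum
  | k + 1, n, l, r, u, v =>
    let b := (splits (u ++ rep t v)).map fun s => neg (conj [letterF s.2.1 (Fin.last n),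
      hint t k (l.map Fin.castSucc) (some (Fin.last n)) s.1 [],
      hint t k (some (Fin.last n)) (r.map Fin.castSucc) s.2.2 v])
    conj ((b.map fun φ => neg (allBetween l r φ)) ++ [allBetween l r (neg (conj b))])

theorem qrank_hint_le (t k : ℕ) {n : ℕ} (l r : Option (Fin n)) (u v : List A) :
    qrank (hint t k l r u v) ≤ k := by
  induction k generalizing n l r u v with
  | zero => exact Nat.zero_le _
  | succ k ih =>
    have hneg : ∀ {n : ℕ} (φ : (lang A).BoundedFormula Empty n), qrank (neg φ) = qrank φ :=
      fun φ => by simp [neg, qrank]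
    rw [hint]
    have key : ∀ φ ∈ (splits (u ++ rep t v)).map fun s => neg (conj [letterF s.2.1 (Fin.last n),
      hint t k (l.map Fin.castSucc) (some (Fin.last n)) s.1 [],
      hint t k (some (Fin.last n)) (r.map Fin.castSucc) s.2.2 v]), qrank φ ≤ k := by
      simp only [List.mem_map]
      rintro _ ⟨s, -, rfl⟩
      rw [hneg]
      refine qrank_conj_le ?_
      simp only [List.mem_cons, List.not_mem_nil, or_false]
      rintro _ (rfl | rfl | rfl)
      · exact Nat.zero_le _
      · exact ih _ _ _ _
      · exact ih _ _ _ _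
    refine qrank_conj_le fun φ hφ => ?_
    rw [List.mem_append, List.mem_map, List.mem_singleton] at hφ
    rcases hφ with ⟨ψ, hψ, rfl⟩ | rfl
    · rw [hneg, qrank_allBetween]
      exact Nat.succ_le_succ (key ψ hψ)
    · rw [qrank_allBetween, hneg]
      exact Nat.succ_le_succ (qrank_conj_le key)

/-- The conjuncts of the first kind say that every split of `up u v` has a counterpart in the
interval, and the last conjunct says the converse; together they are the two halves of
`tp_succ_iff`. By `exists_split_of_up` the splits of `u ++ rep t v` suffice. -/
theorem holds_hint {t k : ℕ} (ht : 2 ^ k ≤ t) {n : ℕ} (l r : Option (Fin n)) (u v : List A)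
    (w : Stream' A) (a : Fin n → ℕ) : Holds w (hint t k l r u v) a ↔
      tp k (ivl w (l.elim 0 fun i => a i + 1) (r.map a)) = tp k (up u v) := by
  induction k generalizing n l r u v with
  | zero => exact iff_of_true id rfl
  | succ k ih =>
    have ht' : 2 ^ k ≤ t := (Nat.pow_le_pow_right (by norm_num) (Nat.le_succ k)).trans ht
    have key : ∀ (z : ℕ) (s : List A × A × List A),
        Holds w (conj [letterF s.2.1 (Fin.last n),
          hint t k (l.map Fin.castSucc) (some (Fin.last n)) s.1 [],
          hint t k (some (Fin.last n)) (r.map Fin.castSucc) s.2.2 v]) (Fin.snoc a z) ↔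
        w.get z = s.2.1 ∧ tp k (fin (seg w (l.elim 0 fun i => a i + 1) z)) = tp k (fin s.1) ∧
          tp k (ivl w (z + 1) (r.map a)) = tp k (up s.2.2 v) := by
      intro z s
      have hletter : Holds w (letterF s.2.1 (Fin.last n)) (Fin.snoc a z : Fin (n + 1) → ℕ) ↔
          w.get z = s.2.1 := by
        change w.get ((Fin.snoc a z : Fin (n + 1) → ℕ) (Fin.last n)) = s.2.1 ↔ _
        rw [Fin.snoc_last]
      have hl : ((l.map Fin.castSucc).elim 0 fun i => (Fin.snoc a z : Fin (n + 1) → ℕ) i + 1) =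
          l.elim 0 fun i => a i + 1 := by cases l <;> simp
      have hr : (r.map Fin.castSucc).map (Fin.snoc a z : Fin (n + 1) → ℕ) = r.map a := by
        cases r <;> simp
      rw [holds_conj]
      simp only [List.forall_mem_cons, List.not_mem_nil, false_imp_iff, implies_true, and_true,
        hletter, ih ht', hl, hr, Option.elim_some, Option.map_some, Fin.snoc_last]
      rfl
    rw [hint, holds_conj, tp_succ_iff, and_comm]
    simp only [List.forall_mem_append, List.forall_mem_singleton, List.forall_mem_map,
      holds_neg, holds_allBetween, holds_conj (l := List.map _ _), key]
    refine and_congr ?_ ?_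
    · constructor
      · intro h x b y hw
        obtain ⟨x', y', hs, h1, h2⟩ := exists_split_of_up ht' hw
        have := h _ hs
        push Not at this
        obtain ⟨z, hz1, hz2, hb, h3, h4⟩ := this
        exact ⟨_, _, ivl_eq_app_cons.2 ⟨z, hz1, hz2, rfl, hb.symm, rfl⟩, h1.trans h3.symm,
          h2.trans h4.symm⟩
      · rintro h ⟨x, b, y⟩ hs
        rw [mem_splits] at hs
        obtain ⟨x', y', hw, h1, h2⟩ := h _ _ _ (up_of_rep hs)
        obtain ⟨z, hz1, hz2, rfl, rfl, rfl⟩ := ivl_eq_app_cons.1 hw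
        exact fun H => H z hz1 hz2 ⟨rfl, h1.symm, h2.symm⟩
    · constructor
      · intro h x b y hw
        obtain ⟨z, hz1, hz2, rfl, rfl, rfl⟩ := ivl_eq_app_cons.1 hw
        have := h z hz1 hz2
        push Not at this
        obtain ⟨⟨x, b, y⟩, hs, rfl, h3, h4⟩ := this
        exact ⟨x, up y v, up_of_rep (mem_splits.1 hs), h3, h4⟩
      · intro h z hz1 hz2 H
        obtain ⟨x, y, hw, h1, h2⟩ := h _ _ _ (ivl_eq_app_cons.2 ⟨z, hz1, hz2, rfl, rfl, rfl⟩)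
        obtain ⟨x', y', hs, h3, h4⟩ := exists_split_of_up ht' hw
        exact H _ hs ⟨rfl, h1.trans h3, h2.trans h4⟩

end FOWord


/-! ## Short representatives and the separating sentence -/

/-- The number of rank-`k` types over an alphabet with `n` letters. -/
def tyCard (n : ℕ) : ℕ → ℕ
  | 0 => 1
  | k + 1 => 2 ^ (tyCard n k * (n * tyCard n k))

theorem Ty.card (A : Type*) [Finite A] (k : ℕ) : Nat.card (Ty A k) = tyCard (Nat.card A) k := by
  induction k with
  | zero => exact Nat.card_unique (α := PUnit)
  | succ k ih =>
    have : Nat.card (Set (Ty A k × A × Ty A k)) = 2 ^ Nat.card (Ty A k × A × Ty A k) := by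
      have := Fintype.ofFinite (Ty A k × A × Ty A k)
      simp [Nat.card_eq_fintype_card]
    rw [tyCard, ← ih, ← Nat.card_prod, ← Nat.card_prod, ← this]
    rfl

namespace Sat

open Word Wd OmegaSemigroup

variable {A S T : Type*} [Semigroup S] [OmegaSemigroup S T]

/-- Pumping: two prefixes of a long word agree in type and in value, and the part between them can
be removed. -/
theorem exists_short_word [Finite A] [Finite S] (φ : FreeSemigroup A →ₙ* S) (k : ℕ)
    (u : FreeSemigroup A) : ∃ u' : FreeSemigroup A,
      (letters u').length ≤ tyCard (Nat.card A) k * Nat.card S ∧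
      tp k (fin (letters u)) = tp k (fin (letters u')) ∧ φ u = φ u' := by
  induction hl : (letters u).length using Nat.strong_induction_on generalizing u with
  | _ l ih =>
  by_cases hB : l ≤ tyCard (Nat.card A) k * Nat.card S
  · exact ⟨u, by omega, rfl, rfl⟩
  have hval : ∀ a l, φ ⟨a, l⟩ = l.foldl (fun s b => s * img φ b) (img φ a) :=
    fun a l => (foldl_img φ ⟨a, l⟩).symm
  obtain ⟨a, v⟩ := u
  simp only [letters, List.length_cons] at hl ⊢
  let c : Fin (v.length + 1) → Ty A k × S := fun i => (tp k (fin (a :: v.take i)), φ ⟨a, v.take i⟩)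
  have hc : ¬ Function.Injective c := by
    intro hc
    have := Nat.card_le_card_of_injective c hc
    rw [Nat.card_prod, Ty.card, Nat.card_fin] at this
    omega
  obtain ⟨i, j, hij, h⟩ : ∃ i j, i < j ∧ c i = c j := by
    simp only [Function.Injective, not_forall] at hc
    obtain ⟨i, j, h, hne⟩ := hc
    rcases lt_or_gt_of_ne hne with h' | h'
    · exact ⟨i, j, h', h⟩
    · exact ⟨j, i, h', h.symm⟩
  simp only [c, Prod.mk.injEq] at h
  have hij' : (i : ℕ) < j := hij
  have hj := j.2
  obtain ⟨u', h1, h2, h3⟩ := ih (letters ⟨a, v.take i ++ v.drop j⟩).length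
    (by simp [letters]; omega) ⟨a, v.take i ++ v.drop j⟩ rfl
  refine ⟨u', h1, ?_, ?_⟩
  · refine Eq.trans ?_ h2
    have := tp_append (u := a :: v.take j) (v := v.drop j) h.1.symm rfl
    simpa [letters] using this
  · refine Eq.trans ?_ h3
    have h4 := h.2
    rw [hval, hval] at h4
    rw [hval, hval, List.foldl_append, h4, ← List.foldl_append, List.take_append_drop]

theorem exists_lasso [Finite A] [Finite S] (α : OmegaHom (FreeSemigroup A) (Stream' A) S T) (k : ℕ)
    (w : Stream' A) : ∃ u v : FreeSemigroup A,
      (letters u).length ≤ tyCard (Nat.card A) k * Nat.card S ∧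
      (letters v).length ≤ tyCard (Nat.card A) k * Nat.card S ∧
      tp k (inf w) = tp k (up (letters u) (letters v)) ∧
      α.inf w = α.fin u • (iprod (Stream'.const (α.fin v)) : T) := by
  -- Ramsey's theorem is applied to the types here and to the values through `exists_value`. The
  -- shift by one keeps the prefix before the first cut nonempty.
  obtain ⟨m, γ, hm, hγ⟩ :=
    exists_strictMono_homogeneous fun i j => tp k (fin (seg w (i + 1) (j + 1)))
  have hm' : StrictMono fun i => m i + 1 := fun i j h => Nat.succ_lt_succ (hm h)
  obtain ⟨a, b, hab, hw⟩ := exists_value α w hm' (Nat.succ_pos _)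
  obtain ⟨u, hu, hu1, hu2⟩ := exists_short_word α.fin k (blk w 0 (m a + 1))
  obtain ⟨v, hv, hv1, hv2⟩ := exists_short_word α.fin k (blk w (m a + 1) (m b + 1))
  refine ⟨u, v, hu, hv, ?_, by rw [hw, hu2, hv2]⟩
  have hs : StrictMono fun i => m (a + i) + 1 := fun i j h => hm' (Nat.add_lt_add_left h a)
  have e : w = letters (blk w 0 (m a + 1)) ++ₛ
      concat (blks w fun i => m (a + i) + 1) := by
    have := seg_append_drop w (Nat.zero_le (m a + 1))
    rw [← letters_blk w (Nat.succ_pos _)] at this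
    refine this.symm.trans ?_
    exact congrArg (letters (blk w 0 (m a + 1)) ++ₛ ·) (drop_eq_concat w hs)
  rw [congrArg inf e, ← app_inf]
  refine (tp_app hu1 (v' := inf (concat (Stream'.const v))) (tp_iconcat fun i => ?_)).trans rfl
  change tp k (fin (letters (blk w (m (a + i) + 1) (m (a + (i + 1)) + 1)))) = tp k (fin (letters v))
  rw [← hv1, letters_blk _ (hs (Nat.lt_succ_self i)), letters_blk _ (hm' hab), hγ _ _ hab,
    hγ _ _ (by omega)]

/-- The words of length at most `b` over a list of letters. -/
def wordsUpTo {A : Type*} (L : List A) : ℕ → List (List A)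
  | 0 => [[]]
  | b + 1 => [] :: (wordsUpTo L b).flatMap fun w => L.map (· :: w)

theorem mem_wordsUpTo {L : List A} {b : ℕ} {w : List A} (hb : w.length ≤ b) (h : ∀ a ∈ w, a ∈ L) :
    w ∈ wordsUpTo L b := by
  induction b generalizing w with
  | zero => simp_all [wordsUpTo]
  | succ b ih =>
    rcases w with _ | ⟨a, w⟩
    · simp [wordsUpTo]
    · simp only [List.forall_mem_cons, List.length_cons, Nat.add_le_add_iff_right] at h hb
      simp only [wordsUpTo, List.mem_cons, reduceCtorEq, List.mem_flatMap, List.mem_map, false_or]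
      exact ⟨w, ih hb h.2, a, h.1, rfl⟩

end Sat

namespace FOWord

open FirstOrder Word Wd Sat OmegaSemigroup

variable {A S T : Type*} [Semigroup S] [OmegaSemigroup S T]

/-- The disjunction of the formulas for the types of the words `u v v v ⋯` that pass a test. -/
def lassoDisj (t k : ℕ) (W : List (List A)) (test : List A → List A → Bool) :
    (lang A).Sentence :=
  disj (W.flatMap fun u => W.flatMap fun v => if test u v then [hint t k none none u v] else [])

theorem qrank_lassoDisj_le (t k : ℕ) (W : List (List A)) (test : List A → List A → Bool) :
    qrank (lassoDisj t k W test) ≤ k := by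
  refine qrank_disj_le fun φ hφ => ?_
  simp only [List.mem_flatMap] at hφ
  obtain ⟨u, -, v, -, hφ⟩ := hφ
  split_ifs at hφ
  · rw [List.mem_singleton.1 hφ]
    exact qrank_hint_le _ _ _ _ _ _
  · simp at hφ

theorem models_lassoDisj {t k : ℕ} (ht : 2 ^ k ≤ t) {W : List (List A)}
    {test : List A → List A → Bool} {w : Stream' A} : Models w (lassoDisj t k W test) ↔
      ∃ u ∈ W, ∃ v ∈ W, test u v = true ∧ tp k (inf w) = tp k (up u v) := by
  rw [models_iff, lassoDisj, holds_disj]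
  simp only [List.mem_flatMap]
  constructor
  · rintro ⟨φ, ⟨u, hu, v, hv, hφ⟩, h⟩
    split_ifs at hφ with htest
    · rw [List.mem_singleton.1 hφ, holds_hint ht] at h
      exact ⟨u, hu, v, hv, htest, h⟩
    · simp at hφ
  · rintro ⟨u, hu, v, hv, htest, h⟩
    exact ⟨_, ⟨u, hu, v, hv, by rw [if_pos htest]; exact List.mem_singleton_self _⟩,
      (holds_hint ht none none u v w default).2 h⟩

/-- By `exists_lasso` every type met by the first language is the type of a short `u v v v ⋯` with
value in `F₀`, so the sentence defines the union of these types. A word of the second language in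
one of them would have a value close to an element of `F₀`, by `close_of_tp_card`. -/
theorem separates_lassoDisj [Finite A] [Finite S]
    (α : OmegaHom (FreeSemigroup A) (Stream' A) S T) {F₀ F₁ : Set T}
    (h : ∀ p ∈ F₀, ∀ q ∈ F₁, ¬ Close (img α.fin) p q) {t k : ℕ}
    (hk : k = Nat.card A * 2 ^ (Nat.card S ^ 2) + 1) (ht : 2 ^ k ≤ t) {L : List A}
    (hL : ∀ a, a ∈ L) {test : List A → List A → Bool}
    (htest : ∀ u v, test u v = true ↔ ∃ u' v' : FreeSemigroup A, letters u' = u ∧ letters v' = v ∧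
      α.fin u' • (iprod (Stream'.const (α.fin v')) : T) ∈ F₀) :
    Separates (langOf (lassoDisj t k (wordsUpTo L (tyCard (Nat.card A) k * Nat.card S)) test))
      (α.inf ⁻¹' F₀) (α.inf ⁻¹' F₁) := by
  constructor
  · intro w hw
    obtain ⟨u, v, hu, hv, h1, h2⟩ := exists_lasso α k w
    refine (models_lassoDisj ht).2 ⟨_, mem_wordsUpTo hu fun a _ => hL a, _,
      mem_wordsUpTo hv fun a _ => hL a, (htest _ _).2 ⟨u, v, rfl, rfl, ?_⟩, h1⟩
    rw [← h2]
    exact hw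
  · refine Set.eq_empty_iff_forall_notMem.2 fun w hw => ?_
    obtain ⟨u, -, v, -, h1, h2⟩ := (models_lassoDisj ht).1 hw.2
    obtain ⟨u, v, rfl, rfl, h3⟩ := (htest _ _).1 h1
    have e : α.inf (letters u ++ₛ concat (Stream'.const v)) =
        α.fin u • (iprod (Stream'.const (α.fin v)) : T) := by
      have := α.map_smul u (iprod (Stream'.const v))
      rw [α.map_iprod] at this
      exact this
    refine h _ h3 _ hw.1 ?_
    rw [← e]
    refine close_of_tp_card α ?_
    rw [← hk, h2]
    rfl

theorem separable_iff [Finite A] [Finite S] (α : OmegaHom (FreeSemigroup A) (Stream' A) S T)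
    (F₀ F₁ : Set T) : Separable (α.inf ⁻¹' F₀) (α.inf ⁻¹' F₁) ↔
      ∀ p ∈ F₀, ∀ q ∈ F₁, ¬ Close (img α.fin) p q := by
  classical
  constructor
  · exact fun h p hp q hq => not_separable_of_close h hp hq
  · intro h
    have := Fintype.ofFinite A
    exact ⟨_, separates_lassoDisj α h rfl le_rfl (L := Finset.univ.toList)
      (test := fun u v => decide (∃ u' v' : FreeSemigroup A, letters u' = u ∧ letters v' = v ∧
      α.fin u' • (iprod (Stream'.const (α.fin v')) : T) ∈ F₀)) (by simp) (by simp)⟩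

end FOWord


/-! ## Reading an input -/

theorem List.getD_flatMap_finRange {β : Type*} {m k : ℕ} (f : Fin m → Fin k → β) (d : β) (i : Fin m)
    (j : Fin k) : ((List.finRange m).flatMap fun i => (List.finRange k).map (f i)).getD
      (i * k + j) d = f i j := by
  induction m with
  | zero => exact i.elim0
  | succ m ih =>
    rw [List.finRange_succ, List.flatMap_cons]
    refine Fin.cases ?_ (fun i => ?_) i
    · rw [List.getD_append _ _ _ _ (by simp)]
      simp
    · have : (i.succ : ℕ) * k + j = k + (i * k + j) := by rw [Fin.val_succ]; ring
      rw [this, List.getD_append_right _ _ _ _ (by simp)]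
      simpa [List.flatMap_map] using ih (fun i => f i.succ) i

open OmegaSemigroup in
/-- The tables of an input stand in a memory. -/
structure IsPresented {A S T : Type*} [Semigroup S] [OmegaSemigroup S T] {n m k : ℕ}
    (eA : A ≃ Fin n) (eS : S ≃ Fin m) (eT : T ≃ Fin k)
    (α : OmegaHom (FreeSemigroup A) (Stream' A) S T) (F₀ F₁ : Set T) (mem : ℕ → ℕ) : Prop where
  size_fin : mem 0 = m
  size_inf : mem 1 = k
  size_letters : mem 2 = n
  mul (s t : S) : mem (3 + (eS s * m + eS t)) = eS (s * t)
  smul (s : S) (t : T) : mem (3 + m * m + (eS s * k + eT t)) = eT (s • t)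
  power (s : S) : mem (3 + m * m + m * k + eS s) = eT (iprod (Stream'.const s))
  letter (a : A) : mem (3 + m * m + m * k + m + eA a) = eS (Sat.img α.fin a)
  left (t : T) : mem (3 + m * m + m * k + m + n + eT t) = 1 ↔ t ∈ F₀
  right (t : T) : mem (3 + m * m + m * k + m + n + k + eT t) = 1 ↔ t ∈ F₁

theorem presentation_isPresented {A S T : Type*} [Semigroup S] [OmegaSemigroup S T] {n m k : ℕ}
    (eA : A ≃ Fin n) (eS : S ≃ Fin m) (eT : T ≃ Fin k)
    (α : OmegaHom (FreeSemigroup A) (Stream' A) S T) (F₀ F₁ : Set T) :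
    IsPresented eA eS eT α F₀ F₁ fun i => (presentation eA eS eT α F₀ F₁).getD i 0 := by
  have hlen : ∀ {m k : ℕ} (f : Fin m → Fin k → ℕ),
      ((List.finRange m).flatMap fun i => (List.finRange k).map (f i)).length = m * k := by
    intro m k f
    simp [List.length_flatMap]
  have hfin : ∀ {m : ℕ} (f : Fin m → ℕ) (i : Fin m), ((List.finRange m).map f).getD i 0 = f i := by
    intro m f i
    simp
  have key : ∀ (l₁ l₂ : List ℕ) (p i : ℕ), l₁.length = p → (l₁ ++ l₂).getD (p + i) 0 = l₂.getD i 0 := by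
    rintro l₁ l₂ _ i rfl
    rw [List.getD_append_right _ _ _ _ (by omega), Nat.add_sub_cancel_left]
  have hlt : ∀ {m k : ℕ} (i : Fin m) (j : Fin k), (i : ℕ) * k + j < m * k := fun i j => by
    calc (i : ℕ) * _ + j < i * _ + _ := Nat.add_lt_add_left j.2 _
      _ = (i + 1) * _ := by ring
      _ ≤ _ := Nat.mul_le_mul_right _ i.2
  constructor
  · rfl
  · rfl
  · rfl
  all_goals simp only [presentation, List.append_assoc, Nat.add_assoc]
  · intro s t
    rw [key [m, k, n] _ 3 _ rfl, List.getD_append _ _ _ _ (by rw [hlen]; exact hlt _ _),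
      List.getD_flatMap_finRange]
    simp
  · intro s t
    rw [key [m, k, n] _ 3 _ rfl, key _ _ _ _ (hlen _),
      List.getD_append _ _ _ _ (by rw [hlen]; exact hlt _ _), List.getD_flatMap_finRange]
    simp
  · intro s
    rw [key [m, k, n] _ 3 _ rfl, key _ _ _ _ (hlen _), key _ _ _ _ (hlen _),
      List.getD_append _ _ _ _ (by simp), hfin]
    simp
  · intro a
    rw [key [m, k, n] _ 3 _ rfl, key _ _ _ _ (hlen _), key _ _ _ _ (hlen _),
      key _ _ m _ (by simp), List.getD_append _ _ _ _ (by simp), hfin]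
    simp [Sat.img]
  · intro t
    rw [key [m, k, n] _ 3 _ rfl, key _ _ _ _ (hlen _), key _ _ _ _ (hlen _),
      key _ _ m _ (by simp), key _ _ n _ (by simp), List.getD_append _ _ _ _ (by simp), hfin]
    simp
  · intro t
    rw [key [m, k, n] _ 3 _ rfl, key _ _ _ _ (hlen _), key _ _ _ _ (hlen _),
      key _ _ m _ (by simp), key _ _ n _ (by simp), key _ _ k _ (by simp), hfin]
    simp


-- Closure properties of primitive recursive functions, for `fun_prop`

attribute [fun_prop] Primrec

namespace Primrec

variable {α β γ σ : Type*} [Primcodable α] [Primcodable β] [Primcodable γ] [Primcodable σ]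

@[fun_prop] theorem fun_id : Primrec fun a : α => a := Primrec.id
@[fun_prop] theorem fun_const (c : β) : Primrec fun _ : α => c := Primrec.const c
@[fun_prop] theorem fun_comp {f : β → σ} {g : α → β} (hf : Primrec f) (hg : Primrec g) :
    Primrec fun a => f (g a) := hf.comp hg
@[fun_prop] theorem fun_pair {f : α → β} {g : α → σ} (hf : Primrec f) (hg : Primrec g) :
    Primrec fun a => (f a, g a) := hf.pair hg
@[fun_prop] theorem fun_fst {f : α → β × σ} (hf : Primrec f) : Primrec fun a => (f a).1 :=
  Primrec.fst.comp hf
@[fun_prop] theorem fun_snd {f : α → β × σ} (hf : Primrec f) : Primrec fun a => (f a).2 :=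
  Primrec.snd.comp hf
@[fun_prop] theorem fun_add {f g : α → ℕ} (hf : Primrec f) (hg : Primrec g) :
    Primrec fun a => f a + g a := Primrec.nat_add.comp hf hg
@[fun_prop] theorem fun_sub {f g : α → ℕ} (hf : Primrec f) (hg : Primrec g) :
    Primrec fun a => f a - g a := Primrec.nat_sub.comp hf hg
@[fun_prop] theorem fun_mul {f g : α → ℕ} (hf : Primrec f) (hg : Primrec g) :
    Primrec fun a => f a * g a := Primrec.nat_mul.comp hf hg
@[fun_prop] theorem fun_pow {f g : α → ℕ} (hf : Primrec f) (hg : Primrec g) :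
    Primrec fun a => f a ^ g a := (Primrec₂.unpaired'.1 Nat.Primrec.pow).comp hf hg
@[fun_prop] theorem fun_cons {f : α → β} {g : α → List β} (hf : Primrec f) (hg : Primrec g) :
    Primrec fun a => f a :: g a := Primrec.list_cons.comp hf hg
@[fun_prop] theorem fun_append {f g : α → List β} (hf : Primrec f) (hg : Primrec g) :
    Primrec fun a => f a ++ g a := Primrec.list_append.comp hf hg
@[fun_prop] theorem fun_length {f : α → List β} (hf : Primrec f) :
    Primrec fun a => (f a).length := Primrec.list_length.comp hf
@[fun_prop] theorem fun_range {f : α → ℕ} (hf : Primrec f) :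
    Primrec fun a => List.range (f a) := Primrec.list_range.comp hf
@[fun_prop] theorem fun_some {f : α → β} (hf : Primrec f) :
    Primrec fun a => some (f a) := Primrec.option_some.comp hf
@[fun_prop] theorem fun_map {f : α → List β} {g : α → β → σ} (hf : Primrec f)
    (hg : Primrec fun p : α × β => g p.1 p.2) : Primrec fun a => (f a).map (g a) :=
  Primrec.list_map hf hg
@[fun_prop] theorem fun_flatMap {f : α → List β} {g : α → β → List σ} (hf : Primrec f)
    (hg : Primrec fun p : α × β => g p.1 p.2) : Primrec fun a => (f a).flatMap (g a) :=
  Primrec.list_flatMap hf hg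
@[fun_prop] theorem fun_foldr {f : α → List β} {g : α → σ} {h : α → β → σ → σ} (hf : Primrec f)
    (hg : Primrec g) (hh : Primrec fun p : α × β × σ => h p.1 p.2.1 p.2.2) :
    Primrec fun a => (f a).foldr (h a) (g a) :=
  Primrec.list_foldr hf hg (h := fun a p => h a p.1 p.2) hh
@[fun_prop] theorem fun_foldl {f : α → List β} {g : α → σ} {h : α → σ → β → σ} (hf : Primrec f)
    (hg : Primrec g) (hh : Primrec fun p : α × σ × β => h p.1 p.2.1 p.2.2) :
    Primrec fun a => (f a).foldl (h a) (g a) :=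
  Primrec.list_foldl hf hg (h := fun a p => h a p.1 p.2) hh
@[fun_prop] theorem fun_getD {f : α → List β} {g : α → ℕ} {d : β} (hf : Primrec f)
    (hg : Primrec g) : Primrec fun a => (f a).getD (g a) d := (Primrec.list_getD d).comp hf hg
@[fun_prop] theorem fun_take {f : α → List β} {g : α → ℕ} (hf : Primrec f)
    (hg : Primrec g) : Primrec fun a => (f a).take (g a) := Primrec.list_take.comp hg hf
@[fun_prop] theorem fun_drop {f : α → List β} {g : α → ℕ} (hf : Primrec f)
    (hg : Primrec g) : Primrec fun a => (f a).drop (g a) := Primrec.list_drop.comp hg hf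
@[fun_prop] theorem fun_elim {o : α → Option β} {f : α → σ} {g : α → β → σ} (ho : Primrec o)
    (hf : Primrec f) (hg : Primrec fun p : α × β => g p.1 p.2) :
    Primrec fun a => (o a).elim (f a) (g a) :=
  (Primrec.option_casesOn ho hf (g := g) hg).of_eq fun a => by cases o a <;> rfl
@[fun_prop] theorem fun_ite_eq {f g : α → ℕ} {x y : α → σ} (hf : Primrec f) (hg : Primrec g)
    (hx : Primrec x) (hy : Primrec y) : Primrec fun a => if f a = g a then x a else y a :=
  Primrec.ite (Primrec.eq.comp hf hg) hx hy

end Primrec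

/-! ## Codes of the separating sentences -/

namespace FOWord

open FirstOrder Word Wd Sat OmegaSemigroup

/-- The code of a negation. -/
def negC (φ : List ℕ) : List ℕ := 4 :: (φ ++ [0])

/-- The code of a conjunction. -/
def conjC (l : List (List ℕ)) : List ℕ := l.foldr (fun φ ψ => negC (4 :: (φ ++ negC ψ))) (negC [0])

/-- The code of a disjunction. -/
def disjC (l : List (List ℕ)) : List ℕ := l.foldr (fun φ ψ => 4 :: (negC φ ++ ψ)) [0]

/-- The code of a relativized quantification. -/
def allBetweenC (n : ℕ) (l r : Option ℕ) (φ : List ℕ) : List ℕ :=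
  5 :: l.elim (r.elim φ fun j => 4 :: 3 :: n :: j :: φ)
    fun i => 4 :: 3 :: i :: n :: r.elim φ fun j => 4 :: 3 :: n :: j :: φ

/-- The nodes below a node in the recursion for the codes of the formulas `hint`. -/
def hintChildren (t : ℕ) (b : ℕ × ℕ × Option ℕ × Option ℕ × List ℕ × List ℕ) :
    List (ℕ × ℕ × Option ℕ × Option ℕ × List ℕ × List ℕ) :=
  if b.1 = 0 then [] else
    ((List.range (b.2.2.2.2.1 ++ rep t b.2.2.2.2.2).length).map fun i =>
      (b.1 - 1, b.2.1 + 1, b.2.2.1, some b.2.1, (b.2.2.2.2.1 ++ rep t b.2.2.2.2.2).take i, [])) ++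
    (List.range (b.2.2.2.2.1 ++ rep t b.2.2.2.2.2).length).map fun i =>
      (b.1 - 1, b.2.1 + 1, some b.2.1, b.2.2.2.1,
        (b.2.2.2.2.1 ++ rep t b.2.2.2.2.2).drop (i + 1), b.2.2.2.2.2)

/-- The code at a node from the codes at the nodes below. -/
def hintCombine (t : ℕ) (b : ℕ × ℕ × Option ℕ × Option ℕ × List ℕ × List ℕ)
    (c : List (List ℕ)) : List ℕ :=
  if b.1 = 0 then negC [0] else
    (fun d : List (List ℕ) => conjC ((d.map fun φ => negC (allBetweenC b.2.1 b.2.2.1 b.2.2.2.1 φ)) ++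
      [allBetweenC b.2.1 b.2.2.1 b.2.2.2.1 (negC (conjC d))]))
    ((List.range (b.2.2.2.2.1 ++ rep t b.2.2.2.2.2).length).map fun i => negC (conjC
      [ [2, (b.2.2.2.2.1 ++ rep t b.2.2.2.2.2).getD i 0, b.2.1], c.getD i [],
        c.getD ((b.2.2.2.2.1 ++ rep t b.2.2.2.2.2).length + i) [] ]))

/-- The code of the formula `hint`. -/
def hintC (t : ℕ) : ℕ → ℕ → Option ℕ → Option ℕ → List ℕ → List ℕ → List ℕ
  | 0, _, _, _, _, _ => negC [0]
  | k + 1, n, l, r, u, v =>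
    let d := (List.range (u ++ rep t v).length).map fun i => negC (conjC
      [ [2, (u ++ rep t v).getD i 0, n], hintC t k (n + 1) l (some n) ((u ++ rep t v).take i) [],
        hintC t k (n + 1) (some n) r ((u ++ rep t v).drop (i + 1)) v])
    conjC ((d.map fun φ => negC (allBetweenC n l r φ)) ++ [allBetweenC n l r (negC (conjC d))])

section

variable {α : Type*} [Primcodable α]

@[fun_prop] theorem primrec_rep {f : α → ℕ} {g : α → List ℕ} (hf : Primrec f) (hg : Primrec g) :
    Primrec fun a => rep (f a) (g a) := by
  have : Primrec fun a => (List.range (f a)).flatMap fun _ => g a := by fun_prop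
  refine this.of_eq fun a => ?_
  rw [rep, List.flatMap_def, List.map_const', List.length_range]

@[fun_prop] theorem primrec_negC {f : α → List ℕ} (hf : Primrec f) :
    Primrec fun a => negC (f a) := by
  unfold negC; fun_prop

@[fun_prop] theorem primrec_conjC {f : α → List (List ℕ)} (hf : Primrec f) :
    Primrec fun a => conjC (f a) := by
  unfold conjC; fun_prop

@[fun_prop] theorem primrec_disjC {f : α → List (List ℕ)} (hf : Primrec f) :
    Primrec fun a => disjC (f a) := by
  unfold disjC; fun_prop

@[fun_prop] theorem primrec_allBetweenC {n : α → ℕ} {l r : α → Option ℕ} {f : α → List ℕ}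
    (hn : Primrec n) (hl : Primrec l) (hr : Primrec r) (hf : Primrec f) :
    Primrec fun a => allBetweenC (n a) (l a) (r a) (f a) := by
  unfold allBetweenC; fun_prop

theorem primrec_hintChildren : Primrec₂ hintChildren := by
  refine Primrec₂.mk ?_
  unfold hintChildren; fun_prop

theorem primrec_hintCombine : Primrec fun p : ℕ × (ℕ × ℕ × Option ℕ × Option ℕ × List ℕ × List ℕ) ×
    List (List ℕ) => hintCombine p.1 p.2.1 p.2.2 := by
  unfold hintCombine; fun_prop

/-- The recursion branches over all splits and changes its parameters, so it is treated as a
recursion over a tree of nodes, with the rank as the decreasing measure that `Primrec.nat_omega_rec`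
asks for. -/
theorem primrec_hintC : Primrec fun p : ℕ × ℕ × ℕ × Option ℕ × Option ℕ × List ℕ × List ℕ =>
    hintC p.1 p.2.1 p.2.2.1 p.2.2.2.1 p.2.2.2.2.1 p.2.2.2.2.2.1 p.2.2.2.2.2.2 := by
  refine (Primrec.nat_omega_rec (m := fun _ b => b.1)
    (fun t (b : ℕ × ℕ × Option ℕ × Option ℕ × List ℕ × List ℕ) =>
      hintC t b.1 b.2.1 b.2.2.1 b.2.2.2.1 b.2.2.2.2.1 b.2.2.2.2.2)
    (l := hintChildren) (g := fun t p => some (hintCombine t p.1 p.2)) ?_ primrec_hintChildren ?_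
    ?_ ?_)
  · exact Primrec₂.mk (by fun_prop)
  · exact Primrec.option_some.comp primrec_hintCombine
  · intro t b b' hb'
    unfold hintChildren at hb'
    split_ifs at hb' with h
    · simp at hb'
    · simp only [List.mem_append, List.mem_map] at hb'
      rcases hb' with ⟨i, -, rfl⟩ | ⟨i, -, rfl⟩ <;> exact Nat.sub_lt (Nat.pos_of_ne_zero h) one_pos
  · rintro t ⟨k, n, l, r, u, v⟩
    congr 1
    cases k with
    | zero => simp [hintCombine, hintC]
    | succ k =>
      simp only [hintCombine, hintC, Nat.succ_ne_zero, if_false]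
      -- The children list all prefixes and then all suffixes, so the two children of split `i`
      -- stand at the places `i` and `x + i`.
      have e : ∀ (x : ℕ) (g h : ℕ → List ℕ), ∀ i < x,
          ((List.range x).map g ++ (List.range x).map h).getD i [] = g i ∧
          ((List.range x).map g ++ (List.range x).map h).getD (x + i) [] = h i := by
        intro x g h i hi
        rw [List.getD_append _ _ _ _ (by simpa using hi),
          List.getD_append_right _ _ _ _ (by simp)]
        simp [hi]
      refine congrArg (fun d : List (List ℕ) => conjC ((d.map fun φ => negC (allBetweenC n l r φ)) ++
        [allBetweenC n l r (negC (conjC d))])) (List.map_congr_left fun i hi => ?_)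
      have hi := List.mem_range.1 hi
      simp only [hintChildren, Nat.succ_ne_zero, if_false, List.map_append, List.map_map,
        Nat.add_sub_cancel]
      rw [(e _ _ _ i hi).1, (e _ _ _ i hi).2]
      rfl

end

section

variable {A : Type*} (c : A → ℕ)

theorem code_neg {n : ℕ} (φ : (lang A).BoundedFormula Empty n) :
    code c (neg φ) = negC (code c φ) := rfl

theorem code_conj {n : ℕ} (l : List ((lang A).BoundedFormula Empty n)) :
    code c (conj l) = conjC (l.map (code c)) := by
  induction l with
  | nil => rfl
  | cons φ l ih =>
    change negC (4 :: (code c φ ++ negC (code c (conj l)))) = _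
    rw [ih]; rfl

theorem code_disj {n : ℕ} (l : List ((lang A).BoundedFormula Empty n)) :
    code c (disj l) = disjC (l.map (code c)) := by
  induction l with
  | nil => rfl
  | cons φ l ih =>
    change 4 :: (negC (code c φ) ++ code c (disj l)) = _
    rw [ih]; rfl

theorem code_allBetween {n : ℕ} (l r : Option (Fin n)) (φ : (lang A).BoundedFormula Empty (n + 1)) :
    code c (allBetween l r φ) =
      allBetweenC n (l.map Fin.val) (r.map Fin.val) (code c φ) := by
  cases l <;> cases r <;> rfl

/-- Connects the recursive list `splits` with the enumeration by positions that the primitive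
recursive code uses. -/
theorem map_splits {β : Type*} (l : List A) (G : List ℕ → ℕ → List ℕ → β) :
    (splits l).map (fun s => G (s.1.map c) (c s.2.1) (s.2.2.map c)) =
      (List.range l.length).map fun i =>
        G ((l.map c).take i) ((l.map c).getD i 0) ((l.map c).drop (i + 1)) := by
  induction l generalizing G with
  | nil => rfl
  | cons a l ih =>
    rw [splits, List.map_cons, List.map_map, List.length_cons, List.range_succ_eq_map, List.map_cons,
      List.map_map]
    exact congrArg₂ _ rfl (ih fun x b y => G (c a :: x) b y)

theorem map_rep (t : ℕ) (v : List A) : (rep t v).map c = rep t (v.map c) := by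
  simp [rep, List.map_flatten]

theorem code_hint (t k : ℕ) {n : ℕ} (l r : Option (Fin n)) (u v : List A) :
    code c (hint t k l r u v) = hintC t k n (l.map Fin.val) (r.map Fin.val)
      (u.map c) (v.map c) := by
  induction k generalizing n l r u v with
  | zero => rfl
  | succ k ih =>
    have e : ∀ l : Option (Fin n), (l.map Fin.castSucc).map (Fin.val) =
      l.map Fin.val := fun l => by cases l <;> rfl
    have hd := map_splits c (u ++ rep t v) fun x b y => negC (conjC [ [2, b, n],
      hintC t k (n + 1) (l.map Fin.val) (some n) x [],
      hintC t k (n + 1) (some n) (r.map Fin.val) y (v.map c)])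
    refine (code_conj c _).trans ?_
    have hd' : ((splits (u ++ rep t v)).map fun s => neg (conj [letterF s.2.1 (Fin.last n),
      hint t k (l.map Fin.castSucc) (some (Fin.last n)) s.1 [],
      hint t k (some (Fin.last n)) (r.map Fin.castSucc) s.2.2 v])).map (code c) = _ :=
      Eq.trans (by
        rw [List.map_map]
        refine List.map_congr_left fun s _ => ?_
        simp only [Function.comp, code_neg, code_conj, List.map_cons, ih, e]
        rfl) hd
    rw [List.map_append, map_rep] at hd'
    rw [← List.length_map (f := c), List.map_append, map_rep] at hd'
    refine Eq.trans ?_ (congrArg (fun d : List (List ℕ) => conjC ((d.map fun φ => negC (allBetweenC n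
      (l.map Fin.val) (r.map Fin.val) φ)) ++ [allBetweenC n (l.map Fin.val) (r.map Fin.val)
        (negC (conjC d))])) hd')
    simp only [List.map_append, List.map_map, List.map_cons, List.map_nil, code_allBetween, code_neg,
      code_conj, Function.comp_def]

end

end FOWord


/-! ## Computing the code of a separating sentence -/

namespace FOWord

open FirstOrder Word Wd Sat OmegaSemigroup

section

variable {α β : Type*} [Primcodable α] [Primcodable β]

@[fun_prop] theorem primrec_tyCard {n k : α → ℕ} (hn : Primrec n) (hk : Primrec k) :
    Primrec fun a => tyCard (n a) (k a) := by
  have h : Primrec₂ fun (a : α) (p : ℕ × ℕ) => 2 ^ (p.2 * (n a * p.2)) :=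
    Primrec₂.mk (by fun_prop)
  refine (Primrec.nat_rec' hk (Primrec.const 1) h).of_eq fun a => ?_
  generalize k a = k
  induction k with
  | zero => rfl
  | succ k ih => exact congrArg (fun x => 2 ^ (x * (n a * x))) ih

@[fun_prop] theorem primrec_wordsUpTo {L : α → List ℕ} {b : α → ℕ} (hL : Primrec L)
    (hb : Primrec b) : Primrec fun a => wordsUpTo (L a) (b a) := by
  have h : Primrec₂ fun (a : α) (p : ℕ × List (List ℕ)) =>
      [] :: p.2.flatMap fun w => (L a).map fun x => x :: w := Primrec₂.mk (by fun_prop)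
  refine (Primrec.nat_rec' hb (Primrec.const [ [] ]) h).of_eq fun a => ?_
  generalize b a = b
  induction b with
  | zero => rfl
  | succ b ih => exact congrArg (fun x => [] :: x.flatMap fun w => (L a).map (· :: w)) ih

end

/-- The number of the value of a nonempty word, computed from an input. -/
def wordValue (l u : List ℕ) : ℕ :=
  (u.drop 1).foldl (fun s b => l.getD (3 + (s * l.getD 0 0 + l.getD (3 + l.getD 0 0 * l.getD 0 0 +
    l.getD 0 0 * l.getD 1 0 + l.getD 0 0 + b) 0)) 0)
    (l.getD (3 + l.getD 0 0 * l.getD 0 0 + l.getD 0 0 * l.getD 1 0 + l.getD 0 0 + u.getD 0 0) 0)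

/-- The number `1` if the value of `u v v v ⋯` is in the first set of an input. -/
def lassoTest (l u v : List ℕ) : ℕ :=
  if u.length = 0 then 0 else if v.length = 0 then 0 else
    l.getD (3 + l.getD 0 0 * l.getD 0 0 + l.getD 0 0 * l.getD 1 0 + l.getD 0 0 + l.getD 2 0 +
      l.getD (3 + l.getD 0 0 * l.getD 0 0 + (wordValue l u * l.getD 1 0 +
        l.getD (3 + l.getD 0 0 * l.getD 0 0 + l.getD 0 0 * l.getD 1 0 + wordValue l v) 0)) 0) 0

/-- The rank of the separating sentence for an input. -/
def sepRank (l : List ℕ) : ℕ := l.getD 2 0 * 2 ^ (l.getD 0 0 ^ 2) + 1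

/-- The bound on the words in the separating sentence for an input. -/
def sepBound (l : List ℕ) : ℕ := tyCard (l.getD 2 0) (sepRank l) * l.getD 0 0

/-- The code of the separating sentence for an input. -/
def sepCode (l : List ℕ) : List ℕ :=
  disjC ((wordsUpTo (List.range (l.getD 2 0)) (sepBound l)).flatMap fun u =>
    (wordsUpTo (List.range (l.getD 2 0)) (sepBound l)).flatMap fun v =>
      if lassoTest l u v = 1 then [hintC (2 ^ sepRank l) (sepRank l) 0 none none u v] else [])

section

variable {α : Type*} [Primcodable α]

@[fun_prop] theorem primrec_wordValue {l u : α → List ℕ} (hl : Primrec l) (hu : Primrec u) :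
    Primrec fun a => wordValue (l a) (u a) := by
  unfold wordValue; fun_prop

@[fun_prop] theorem primrec_lassoTest {l u v : α → List ℕ} (hl : Primrec l) (hu : Primrec u)
    (hv : Primrec v) : Primrec fun a => lassoTest (l a) (u a) (v a) := by
  unfold lassoTest; fun_prop

@[fun_prop] theorem primrec_sepRank {l : α → List ℕ} (hl : Primrec l) :
    Primrec fun a => sepRank (l a) := by
  unfold sepRank; fun_prop

@[fun_prop] theorem primrec_sepBound {l : α → List ℕ} (hl : Primrec l) :
    Primrec fun a => sepBound (l a) := by
  unfold sepBound; fun_prop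

@[fun_prop] theorem primrec_hintC_comp {t k n : α → ℕ} {l r : α → Option ℕ} {u v : α → List ℕ}
    (ht : Primrec t) (hk : Primrec k) (hn : Primrec n) (hl : Primrec l) (hr : Primrec r)
    (hu : Primrec u) (hv : Primrec v) :
    Primrec fun a => hintC (t a) (k a) (n a) (l a) (r a) (u a) (v a) :=
  primrec_hintC.comp (g := fun a => (t a, k a, n a, l a, r a, u a, v a)) (by fun_prop)

theorem primrec_sepCode : Primrec sepCode := by
  unfold sepCode; fun_prop

end

variable {A S T : Type*} [Semigroup S] [OmegaSemigroup S T] {n m k : ℕ}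
  {eA : A ≃ Fin n} {eS : S ≃ Fin m} {eT : T ≃ Fin k}
  {α : OmegaHom (FreeSemigroup A) (Stream' A) S T} {F₀ F₁ : Set T} {l : List ℕ}

theorem wordValue_eq (h : IsPresented eA eS eT α F₀ F₁ fun i => l.getD i 0) (u : FreeSemigroup A) :
    wordValue l ((letters u).map fun a => (eA a : ℕ)) = eS (α.fin u) := by
  obtain ⟨a, u⟩ := u
  rw [← foldl_img]
  have h0 := h.size_fin
  have h1 := h.size_inf
  simp only [wordValue, h0, h1, letters, List.map_cons, List.drop_succ_cons, List.drop_zero,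
    List.getD_cons_zero, h.letter]
  generalize img α.fin a = s
  induction u generalizing s with
  | nil => rfl
  | cons b u ih =>
    simp only [List.map_cons, List.foldl_cons, h.letter, h.mul]
    exact ih _

theorem lassoTest_eq_one_iff (h : IsPresented eA eS eT α F₀ F₁ fun i => l.getD i 0) (u v : List A) :
    lassoTest l (u.map fun a => (eA a : ℕ)) (v.map fun a => (eA a : ℕ)) = 1 ↔
      ∃ u' v' : FreeSemigroup A, letters u' = u ∧ letters v' = v ∧
        α.fin u' • (iprod (Stream'.const (α.fin v')) : T) ∈ F₀ := by
  constructor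
  · intro H
    rcases u with _ | ⟨a, u⟩
    · simp [lassoTest] at H
    rcases v with _ | ⟨b, v⟩
    · simp [lassoTest] at H
    refine ⟨⟨a, u⟩, ⟨b, v⟩, rfl, rfl, ?_⟩
    rw [← h.left]
    have e1 := wordValue_eq h ⟨a, u⟩
    have e2 := wordValue_eq h ⟨b, v⟩
    simp only [letters] at e1 e2
    have h0 := h.size_fin
    have h1 := h.size_inf
    have h2 := h.size_letters
    simp only [lassoTest, e1, e2, h0, h1, h2, h.power, h.smul] at H
    simpa using H
  · rintro ⟨u, v, rfl, rfl, H⟩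
    rw [← h.left] at H
    have h0 := h.size_fin
    have h1 := h.size_inf
    have h2 := h.size_letters
    simp only [lassoTest, wordValue_eq h, h0, h1, h2, h.power, h.smul]
    simpa [letters] using H

theorem map_wordsUpTo (c : A → ℕ) (L : List A) (b : ℕ) :
    (wordsUpTo L b).map (List.map c) = wordsUpTo (L.map c) b := by
  induction b with
  | zero => rfl
  | succ b ih =>
    simp [wordsUpTo, ← ih, List.map_flatMap, List.flatMap_map, Function.comp_def]

theorem code_lassoDisj (c : A → ℕ) (t k : ℕ) (W : List (List A)) (test : List A → List A → Bool)
    (testC : List ℕ → List ℕ → ℕ) (h : ∀ u v, test u v = decide (testC (u.map c) (v.map c) = 1)) :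
    code c (lassoDisj t k W test) = disjC ((W.map (List.map c)).flatMap fun u =>
      (W.map (List.map c)).flatMap fun v =>
        if testC u v = 1 then [hintC t k 0 none none u v] else []) := by
  rw [lassoDisj, code_disj]
  simp only [List.map_flatMap, List.flatMap_map]
  congr 1
  refine List.flatMap_congr fun u _ => List.flatMap_congr fun v _ => ?_
  rw [h]
  by_cases hc : testC (u.map c) (v.map c) = 1
  · simp [hc, code_hint]
  · simp [hc]

theorem exists_separator [Finite S] (h : IsPresented eA eS eT α F₀ F₁ fun i => l.getD i 0)
    (hs : Separable (α.inf ⁻¹' F₀) (α.inf ⁻¹' F₁)) : ∃ φ : (lang A).Sentence,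
      sepCode l = code (fun a => (eA a : ℕ)) φ ∧ qrank φ ≤ n * 2 ^ (m ^ 2) + 1 ∧
      Separates (langOf φ) (α.inf ⁻¹' F₀) (α.inf ⁻¹' F₁) := by
  have := Finite.of_equiv _ eA.symm
  have hn : Nat.card A = n := by rw [Nat.card_congr eA, Nat.card_fin]
  have hm : Nat.card S = m := by rw [Nat.card_congr eS, Nat.card_fin]
  have h0 := h.size_fin
  have h2 := h.size_letters
  have hrank : sepRank l = n * 2 ^ (m ^ 2) + 1 := by rw [sepRank, h0, h2]
  -- The letters are listed in the order of their numbers, so that this list becomes `List.range n`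
  -- in the code.
  refine ⟨lassoDisj (2 ^ sepRank l) (sepRank l)
    (wordsUpTo ((List.finRange n).map eA.symm) (sepBound l)) fun u v =>
      decide (lassoTest l (u.map fun a => (eA a : ℕ)) (v.map fun a => (eA a : ℕ)) = 1), ?_, ?_, ?_⟩
  · rw [code_lassoDisj _ _ _ _ _ (lassoTest l) fun _ _ => rfl, map_wordsUpTo, sepCode, h2]
    have : ((List.finRange n).map eA.symm).map (fun a => (eA a : ℕ)) = List.range n := by
      rw [List.map_map]
      simp [Function.comp_def]
    rw [this]
  · rw [← hrank]
    exact qrank_lassoDisj_le _ _ _ _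
  · have := separates_lassoDisj (t := 2 ^ sepRank l) α ((separable_iff α F₀ F₁).1 hs)
      (by rw [hn, hm]; exact hrank) le_rfl (L := (List.finRange n).map eA.symm)
      (fun a => List.mem_map.2 ⟨eA a, by simp, by simp⟩) (test := fun u v =>
      decide (lassoTest l (u.map fun a => (eA a : ℕ)) (v.map fun a => (eA a : ℕ)) = 1))
      (fun u v => by rw [decide_eq_true_iff]; exact lassoTest_eq_one_iff h u v)
    rw [sepBound, h0, h2]
    rwa [hn, hm] at this

end FOWord


/-! ## Building random access machines -/

namespace RAM

/-- A memory, and a number that stands in register `0` and bounds the number of turns of loops. -/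
structure Base where
  /-- the memory -/
  mem : ℕ → ℕ
  /-- the bound -/
  bound : ℕ

/-- The program `P` puts `v` into register `e` within `T` steps; it changes neither the memory nor
the registers below `e`. -/
def Outputs (P : Prog) (e : ℕ) (s : State) (T v : ℕ) : Prop :=
  ∃ t s', Runs P s t s' ∧ t ≤ T ∧ s'.mem = s.mem ∧ (∀ i < e, s'.reg i = s.reg i) ∧ s'.reg e = v

/-- The types of environments for programs: a memory with some further numbers in registers. -/
class Layout (α : Type) where
  /-- the possible assignments of registers -/
  Lay : Type
  /-- the memory and the bound -/
  base : α → Base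
  /-- the state represents the environment in registers below a given one -/
  Rep : Lay → ℕ → α → State → Prop
  rep_mono {L : Lay} {e e' : ℕ} {x : α} {s s' : State} (he : e ≤ e') (hm : s'.mem = s.mem)
    (hr : ∀ i < e, s'.reg i = s.reg i) (h : Rep L e x s) : Rep L e' x s'
  rep_base {L : Lay} {e : ℕ} {x : α} {s : State} (h : Rep L e x s) :
    0 < e ∧ s.mem = (base x).mem ∧ s.reg 0 = (base x).bound

open Layout

instance : Layout Base where
  Lay := Unit
  base := id
  Rep _ e x s := 0 < e ∧ s.mem = x.mem ∧ s.reg 0 = x.bound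
  rep_mono he hm hr h := ⟨h.1.trans_le he, hm.trans h.2.1, (hr 0 h.1).trans h.2.2⟩
  rep_base h := h

instance {α : Type} [Layout α] : Layout (α × ℕ) where
  Lay := Lay α × ℕ
  base x := base x.1
  Rep L e x s := Rep L.1 e x.1 s ∧ L.2 < e ∧ s.reg L.2 = x.2
  rep_mono he hm hr h := ⟨rep_mono he hm hr h.1, h.2.1.trans_le he, (hr _ h.2.1).trans h.2.2⟩
  rep_base h := rep_base h.1

/-- The function `f` can be evaluated in a number of steps that is polynomial in the bound. -/
def Feasible {α : Type} [Layout α] (f : α → ℕ) : Prop :=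
  ∃ T : Polynomial ℕ, ∀ (L : Lay α) (e : ℕ), ∃ P : Prog, ∀ (x : α) (s : State), Rep L e x s →
    Outputs P e s (T.eval (base x).bound) (f x)

/-- Iteration. -/
def loop (n a : ℕ) (f : ℕ → ℕ → ℕ) : ℕ := Nat.rec a f n

theorem loop_zero (a : ℕ) (f : ℕ → ℕ → ℕ) : loop 0 a f = a := rfl

theorem loop_succ (n a : ℕ) (f : ℕ → ℕ → ℕ) : loop (n + 1) a f = f n (loop n a f) := rfl

namespace Feasible

variable {α : Type} [Layout α] {f g h : α → ℕ}

theorem snd : Feasible fun p : α × ℕ => p.2 := by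
  -- A register is copied by adding it to a cleared one.
  refine ⟨2, fun L e => ⟨.seq (.const e 0) (.add e e L.2), fun x s hs => ?_⟩⟩
  refine ⟨2, _, .seq (.const _ _ _) (.add _ _ _ _), by simp, rfl, ?_, ?_⟩
  · intro i hi
    simp [State.setReg, hi.ne]
  · have := hs.2.1.ne
    simp [State.setReg, this, hs.2.2]

theorem bound : Feasible fun x : α => (base x).bound := by
  refine ⟨2, fun L e => ⟨.seq (.const e 0) (.add e e 0), fun x s hs => ?_⟩⟩
  refine ⟨2, _, .seq (.const _ _ _) (.add _ _ _ _), by simp, rfl, ?_, ?_⟩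
  · intro i hi
    simp [State.setReg, hi.ne]
  · have h := rep_base hs
    simp [State.setReg, h.1.ne, h.2.2]

theorem const (c : ℕ) : Feasible fun _ : α => c := by
  refine ⟨1, fun L e => ⟨.const e c, fun x s hs => ?_⟩⟩
  refine ⟨1, _, .const _ _ _, by simp, rfl, ?_, ?_⟩
  · intro i hi
    simp [State.setReg, hi.ne]
  · simp [State.setReg]

theorem fst (hf : Feasible f) : Feasible fun p : α × ℕ => f p.1 := by
  obtain ⟨T, hT⟩ := hf
  refine ⟨T, fun L e => ?_⟩
  obtain ⟨P, hP⟩ := hT L.1 e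
  exact ⟨P, fun x s hs => hP x.1 s hs.1⟩

theorem mem (hf : Feasible f) : Feasible fun x => (base x).mem (f x) := by
  obtain ⟨T, hT⟩ := hf
  refine ⟨T + 1, fun L e => ?_⟩
  obtain ⟨P, hP⟩ := hT L e
  refine ⟨.seq P (.load e e), fun x s hs => ?_⟩
  obtain ⟨t, s', h1, h2, h3, h4, h5⟩ := hP x s hs
  refine ⟨_, _, .seq h1 (.load _ _ _), by simpa using h2, h3, ?_, ?_⟩
  · intro i hi
    simp [State.setReg, hi.ne, h4 i hi]
  · simp [State.setReg, h5, h3, (rep_base hs).2.1]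

/-- The second argument is evaluated one register higher, which protects the value of the first. -/
theorem add (hf : Feasible f) (hg : Feasible g) : Feasible fun x => f x + g x := by
  obtain ⟨T, hT⟩ := hf
  obtain ⟨U, hU⟩ := hg
  refine ⟨T + U + 1, fun L e => ?_⟩
  obtain ⟨P, hP⟩ := hT L e
  obtain ⟨Q, hQ⟩ := hU L (e + 1)
  refine ⟨.seq (.seq P Q) (.add e e (e + 1)), fun x s hs => ?_⟩
  obtain ⟨t, s', h1, h2, h3, h4, h5⟩ := hP x s hs
  obtain ⟨t', s'', k1, k2, k3, k4, k5⟩ := hQ x s' (rep_mono (Nat.le_succ e) h3 h4 hs)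
  refine ⟨_, _, .seq (.seq h1 k1) (.add _ _ _ _), ?_, k3.trans h3, ?_, ?_⟩
  · simpa using Nat.add_le_add h2 k2
  · intro i hi
    simp [State.setReg, hi.ne, h4 i hi, k4 i (hi.trans (Nat.lt_succ_self e))]
  · simp [State.setReg, h5, k5, k4 e (Nat.lt_succ_self e)]

theorem sub (hf : Feasible f) (hg : Feasible g) : Feasible fun x => f x - g x := by
  obtain ⟨T, hT⟩ := hf
  obtain ⟨U, hU⟩ := hg
  refine ⟨T + U + 1, fun L e => ?_⟩
  obtain ⟨P, hP⟩ := hT L e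
  obtain ⟨Q, hQ⟩ := hU L (e + 1)
  refine ⟨.seq (.seq P Q) (.sub e e (e + 1)), fun x s hs => ?_⟩
  obtain ⟨t, s', h1, h2, h3, h4, h5⟩ := hP x s hs
  obtain ⟨t', s'', k1, k2, k3, k4, k5⟩ := hQ x s' (rep_mono (Nat.le_succ e) h3 h4 hs)
  refine ⟨_, _, .seq (.seq h1 k1) (.sub _ _ _ _), ?_, k3.trans h3, ?_, ?_⟩
  · simpa using Nat.add_le_add h2 k2
  · intro i hi
    simp [State.setReg, hi.ne, h4 i hi, k4 i (hi.trans (Nat.lt_succ_self e))]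
  · simp [State.setReg, h5, k5, k4 e (Nat.lt_succ_self e)]

theorem ite (hf : Feasible f) (hg : Feasible g) (hh : Feasible h) :
    Feasible fun x => if f x = 0 then g x else h x := by
  obtain ⟨T, hT⟩ := hf
  obtain ⟨U, hU⟩ := hg
  obtain ⟨V, hV⟩ := hh
  refine ⟨T + U + V + 1, fun L e => ?_⟩
  obtain ⟨P, hP⟩ := hT L e
  obtain ⟨Q, hQ⟩ := hU L e
  obtain ⟨R, hR⟩ := hV L e
  refine ⟨.seq P (.cond e R Q), fun x s hs => ?_⟩
  obtain ⟨t, s', h1, h2, h3, h4, h5⟩ := hP x s hs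
  have hs' := rep_mono le_rfl h3 h4 hs
  by_cases h0 : f x = 0
  · obtain ⟨t', s'', k1, k2, k3, k4, k5⟩ := hQ x s' hs'
    refine ⟨_, _, .seq h1 (.cond_false (h5.trans h0) k1), ?_, k3.trans h3,
      fun i hi => (k4 i hi).trans (h4 i hi), k5.trans (if_pos h0).symm⟩
    simp only [Polynomial.eval_add, Polynomial.eval_one]
    omega
  · obtain ⟨t', s'', k1, k2, k3, k4, k5⟩ := hR x s' hs'
    refine ⟨_, _, .seq h1 (.cond_true (by rwa [h5]) k1), ?_, k3.trans h3,
      fun i hi => (k4 i hi).trans (h4 i hi), k5.trans (if_neg h0).symm⟩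
    simp only [Polynomial.eval_add, Polynomial.eval_one]
    omega

/-- Register `e` counts the remaining turns, `e + 1` holds the accumulator, `e + 2` the index and `e
+ 3` the constant `1`; the body delivers its result in `e + 4`, and `e + 5` is a zero for copying.
Since the number of turns is capped by the bound, the time is polynomial whatever the value of `f`
is. -/
theorem loop {h : α → ℕ → ℕ → ℕ} (hf : Feasible f) (hg : Feasible g)
    (hh : Feasible fun p : (α × ℕ) × ℕ => h p.1.1 p.1.2 p.2) :
    Feasible fun x => loop (min (f x) (base x).bound) (g x) (h x) := by
  obtain ⟨T, hT⟩ := hf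
  obtain ⟨U, hU⟩ := hg
  obtain ⟨V, hV⟩ := hh
  refine ⟨T + U + 7 + Polynomial.X * (V + 5), fun L e => ?_⟩
  obtain ⟨P, hP⟩ := hT L e
  obtain ⟨Q, hQ⟩ := hU L (e + 1)
  obtain ⟨R, hR⟩ := hV ((L, e + 2), e + 1) (e + 4)
  let B : Prog := .seq R (.seq (.const (e + 5) 0) (.seq (.add (e + 1) (e + 4) (e + 5))
    (.seq (.add (e + 2) (e + 2) (e + 3)) (.sub e e (e + 3)))))
  have key : ∀ (x : α) (r i : ℕ) (s : State), Rep L e x s → s.reg e = r →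
      s.reg (e + 1) = RAM.loop i (g x) (h x) → s.reg (e + 2) = i → s.reg (e + 3) = 1 →
      ∃ t s', Runs (.loop e B) s t s' ∧ t ≤ r * (V.eval (base x).bound + 5) + 1 ∧ s'.mem = s.mem ∧
        (∀ j < e, s'.reg j = s.reg j) ∧ s'.reg (e + 1) = RAM.loop (r + i) (g x) (h x) := by
    intro x r
    induction r with
    | zero =>
      intro i s hs h0 h1 h2 h3
      exact ⟨1, s, .loop_false h0, by omega, rfl, fun _ _ => rfl, by rw [h1, Nat.zero_add]⟩
    | succ r ih =>
      intro i s hs h0 h1 h2 h3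
      obtain ⟨t, s₁, k1, k2, k3, k4, k5⟩ := hR ((x, i), RAM.loop i (g x) (h x)) s
        ⟨⟨rep_mono (by omega) rfl (fun _ _ => rfl) hs, Nat.add_lt_add_left (by norm_num) e, h2⟩,
          Nat.add_lt_add_left (by norm_num) e, h1⟩
      obtain ⟨σ, hB, m1, g1, c0, c1, c2, c3⟩ : ∃ σ, Runs B s (t + (1 + (1 + (1 + 1)))) σ ∧
          σ.mem = s.mem ∧ (∀ j < e, σ.reg j = s.reg j) ∧ σ.reg e = r ∧
          σ.reg (e + 1) = RAM.loop (i + 1) (g x) (h x) ∧ σ.reg (e + 2) = i + 1 ∧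
          σ.reg (e + 3) = 1 := by
        refine ⟨_, .seq k1 (.seq (.const _ _ _) (.seq (.add _ _ _ _)
          (.seq (.add _ _ _ _) (.sub _ _ _ _)))), k3, ?_, ?_, ?_, ?_, ?_⟩
        · intro j hj
          have := k4 j (by omega)
          simp [State.setReg, this, show j ≠ e by omega,
            show j ≠ e + 1 by omega, show j ≠ e + 2 by omega, show j ≠ e + 5 by omega]
        · have h4 := k4 e (by omega)
          have h5 := k4 (e + 3) (by omega)
          simp [State.setReg, h4, h5, h0, h3]
        · simp [State.setReg, k5, loop_succ]
        · have h4 := k4 (e + 2) (by omega)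
          have h5 := k4 (e + 3) (by omega)
          simp [State.setReg, h4, h5, h2, h3]
        · have h5 := k4 (e + 3) (by omega)
          simp [State.setReg, h5, h3]
      obtain ⟨t', s₂, l1, l2, l3, l4, l5⟩ := ih (i + 1) σ (rep_mono le_rfl m1 g1 hs) c0 c1 c2 c3
      refine ⟨_, s₂, .loop_true (by omega) hB l1, ?_, l3.trans m1,
        fun j hj => (l4 j hj).trans (g1 j hj), ?_⟩
      · have e1 : (base ((x, i), RAM.loop i (g x) (h x))).bound = (base x).bound := rfl
        rw [e1] at k2
        rw [Nat.succ_mul]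
        omega
      · rw [l5]
        congr 1
        omega
  -- Two truncated subtractions compute `f - (f - bound)`, which is the minimum of `f` and the
  -- bound.
  refine ⟨.seq (.seq (.seq P (.seq (.sub (e + 1) e 0) (.sub e e (e + 1))))
    (.seq Q (.seq (.const (e + 2) 0) (.const (e + 3) 1))))
    (.seq (.loop e B) (.seq (.const (e + 2) 0) (.add e (e + 1) (e + 2)))), fun x s hs => ?_⟩
  obtain ⟨t, s₁, h1, h2, h3, h4, h5⟩ := hP x s hs
  have hb := rep_base hs
  have h0 := (h4 0 hb.1).trans hb.2.2
  have r1 : Runs (.seq P (.seq (.sub (e + 1) e 0) (.sub e e (e + 1)))) s (t + (1 + 1)) _ :=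
    .seq h1 (.seq (.sub _ _ _ _) (.sub _ _ _ _))
  set s₂ := ((s₁.setReg (e + 1) (s₁.reg e - s₁.reg 0)).setReg e _) with hs₂
  have m2 : s₂.mem = s.mem := h3
  have g2 : ∀ i < e, s₂.reg i = s.reg i := by
    intro i hi
    simp [hs₂, State.setReg, h4 i hi, hi.ne, show i ≠ e + 1 by omega]
  have c2 : s₂.reg e = min (f x) (base x).bound := by
    simp [hs₂, State.setReg, h5, h0]
    omega
  obtain ⟨t', s₃, k1, k2, k3, k4, k5⟩ := hQ x s₂ (rep_mono (Nat.le_succ e) m2 g2 hs)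
  have r2 : Runs (.seq Q (.seq (.const (e + 2) 0) (.const (e + 3) 1))) s₂ (t' + (1 + 1)) _ :=
    .seq k1 (.seq (.const _ _ _) (.const _ _ _))
  set s₄ := ((s₃.setReg (e + 2) 0).setReg (e + 3) 1) with hs₄
  have g4 : ∀ i < e + 1, s₄.reg i = s₂.reg i := by
    intro i hi
    simp [hs₄, State.setReg, k4 i hi, show i ≠ e + 2 by omega,
      show i ≠ e + 3 by omega]
  obtain ⟨t'', s₅, l1, l2, l3, l4, l5⟩ := key x (min (f x) (base x).bound) 0 s₄
    (rep_mono le_rfl (k3.trans m2) (fun i hi => (g4 i (by omega)).trans (g2 i hi)) hs)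
    ((g4 e (by omega)).trans c2) (by simp [hs₄, State.setReg, k5, loop_zero])
    (by simp [hs₄, State.setReg])
    (by simp [hs₄, State.setReg])
  refine ⟨_, _, .seq (.seq r1 r2) (.seq l1 (.seq (.const _ _ _) (.add _ _ _ _))), ?_,
    l3.trans (k3.trans m2), ?_, ?_⟩
  · simp only [Polynomial.eval_add, Polynomial.eval_mul, Polynomial.eval_X, Polynomial.eval_ofNat]
    have : min (f x) (base x).bound * (V.eval (base x).bound + 5) ≤
        (base x).bound * (V.eval (base x).bound + 5) := Nat.mul_le_mul_right _ (min_le_right _ _)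
    omega
  · intro i hi
    have := (l4 i hi).trans ((g4 i (by omega)).trans (g2 i hi))
    simp [State.setReg, this, hi.ne, show i ≠ e + 2 by omega]
  · simp [State.setReg, l5]

end Feasible

end RAM


/-! ## The saturation algorithm -/

namespace RAM

/-- Iteration with a bounded number of turns. -/
def Base.iter (b : Base) (n a : ℕ) (f : ℕ → ℕ → ℕ) : ℕ := loop (min n b.bound) a f

namespace Base

/-- The number `2 ^ j`. -/
def pow2 (b : Base) (j : ℕ) : ℕ := b.iter j 1 fun _ a => a + a

/-- Not `0` if some `i < n` satisfies a condition. -/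
def any (b : Base) (n : ℕ) (c : ℕ → ℕ) : ℕ := b.iter n 0 fun i a => if c i = 0 then a else 1

/-- The number whose binary digits tell which `i < n` satisfy a condition. -/
def mask (b : Base) (n : ℕ) (c : ℕ → ℕ) : ℕ :=
  b.iter n 0 fun i a => if c i = 0 then a else a + b.pow2 i

/-- Not `0` if `x = y`. -/
def eqNat (x y : ℕ) : ℕ := 1 - ((x - y) + (y - x))

/-- A remainder modulo `2 ^ (i + 1)`. -/
def low (b : Base) (Z i : ℕ) : ℕ := b.iter (b.bound - (i + 1)) Z fun t r =>
  if b.pow2 (b.bound - (t + 1)) - r = 0 then r - b.pow2 (b.bound - (t + 1)) else r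

/-- A binary digit. -/
def bit (b : Base) (Z i : ℕ) : ℕ := 1 - (b.pow2 i - b.low Z i)

/-- A product. -/
def times (b : Base) (s k : ℕ) : ℕ := b.iter s 0 fun _ a => a + k

/-- The number of subsets of the semigroup. -/
def sets (b : Base) : ℕ := b.pow2 (b.mem 0)

/-- The product of the semigroup. -/
def mulAt (b : Base) (s t : ℕ) : ℕ := b.mem (3 + (b.times s (b.mem 0) + t))

/-- The mixed product. -/
def smulAt (b : Base) (s t : ℕ) : ℕ :=
  b.mem (3 + b.times (b.mem 0) (b.mem 0) + (b.times s (b.mem 1) + t))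

/-- The infinite power. -/
def powerAt (b : Base) (s : ℕ) : ℕ :=
  b.mem (3 + b.times (b.mem 0) (b.mem 0) + b.times (b.mem 0) (b.mem 1) + s)

/-- The image of a letter. -/
def letterAt (b : Base) (a : ℕ) : ℕ :=
  b.mem (3 + b.times (b.mem 0) (b.mem 0) + b.times (b.mem 0) (b.mem 1) + b.mem 0 + a)

/-- The characteristic sequence of the first set. -/
def leftAt (b : Base) (t : ℕ) : ℕ :=
  b.mem (3 + b.times (b.mem 0) (b.mem 0) + b.times (b.mem 0) (b.mem 1) + b.mem 0 + b.mem 2 + t)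

/-- The characteristic sequence of the second set. -/
def rightAt (b : Base) (t : ℕ) : ℕ :=
  b.mem (3 + b.times (b.mem 0) (b.mem 0) + b.times (b.mem 0) (b.mem 1) + b.mem 0 + b.mem 2 +
    b.mem 1 + t)

/-- The product of two sets. -/
def mulMask (b : Base) (X Y : ℕ) : ℕ := b.mask (b.mem 0) fun u => b.any (b.mem 0) fun s =>
  if b.bit X s = 0 then 0 else b.any (b.mem 0) fun t =>
    if b.bit Y t = 0 then 0 else eqNat (b.mulAt s t) u

/-- The power `X ^ (n + 1)` of a set. -/
def powMask (b : Base) (X n : ℕ) : ℕ := b.iter n X fun _ Z => b.mulMask Z X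

/-- The union of the powers of a set with large exponents. -/
def upowMask (b : Base) (X : ℕ) : ℕ := b.mask (b.mem 0) fun u => b.any b.sets fun i =>
  b.bit (b.powMask X (b.sets + i)) u

/-- The singletons of the images of the letters. -/
def satInit (b : Base) : ℕ := b.mask b.sets fun X => b.any (b.mem 2) fun a =>
  eqNat X (b.pow2 (b.letterAt a))

/-- One round of saturation. -/
def satStep (b : Base) (Z : ℕ) : ℕ := b.mask b.sets fun V => b.bit Z V + b.any b.sets fun X =>
  if b.bit Z X = 0 then 0 else eqNat V (b.upowMask X) + b.any b.sets fun Y =>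
    if b.bit Z Y = 0 then 0 else eqNat V (b.mulMask X Y)

/-- The saturation. -/
def sat (b : Base) : ℕ := b.iter b.sets b.satInit fun _ Z => b.satStep Z

/-- Not `0` if some product `x e e e ⋯` with `x ∈ X` and `e ∈ E` is in the first set. -/
def hitsLeft (b : Base) (X E : ℕ) : ℕ := b.any (b.mem 0) fun x =>
  if b.bit X x = 0 then 0 else b.any (b.mem 0) fun e =>
    if b.bit E e = 0 then 0 else eqNat (b.leftAt (b.smulAt x (b.powerAt e))) 1

/-- Not `0` if some product `x e e e ⋯` with `x ∈ X` and `e ∈ E` is in the second set. -/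
def hitsRight (b : Base) (X E : ℕ) : ℕ := b.any (b.mem 0) fun x =>
  if b.bit X x = 0 then 0 else b.any (b.mem 0) fun e =>
    if b.bit E e = 0 then 0 else eqNat (b.rightAt (b.smulAt x (b.powerAt e))) 1

/-- Not `0` if the languages are not separable. -/
def witness (b : Base) : ℕ := b.any b.sets fun X =>
  if b.bit b.sat X = 0 then 0 else b.any b.sets fun E =>
    if b.bit b.sat E = 0 then 0 else if b.hitsLeft X E = 0 then 0 else b.hitsRight X E

end Base

namespace Feasible

open Layout

variable {α : Type} [Layout α] {f g : α → ℕ}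

/-- From here on feasibility follows the definitions term by term; `snd`, `snd.fst`, `snd.fst.fst`,
… act as de Bruijn indices of the bound variables. -/
theorem iter {h : α → ℕ → ℕ → ℕ} (hf : Feasible f) (hg : Feasible g)
    (hh : Feasible fun p : (α × ℕ) × ℕ => h p.1.1 p.1.2 p.2) :
    Feasible fun x => (base x).iter (f x) (g x) (h x) :=
  loop hf hg hh

theorem pow2 (hf : Feasible f) : Feasible fun x => (base x).pow2 (f x) :=
  iter hf (const 1) (add snd snd)

theorem any {c : α → ℕ → ℕ} (hf : Feasible f) (hc : Feasible fun p : α × ℕ => c p.1 p.2) :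
    Feasible fun x => (base x).any (f x) (c x) :=
  iter hf (const 0) (ite hc.fst snd (const 1))

theorem mask {c : α → ℕ → ℕ} (hf : Feasible f) (hc : Feasible fun p : α × ℕ => c p.1 p.2) :
    Feasible fun x => (base x).mask (f x) (c x) :=
  iter hf (const 0) (ite hc.fst snd (add snd (pow2 snd.fst)))

theorem eqNat (hf : Feasible f) (hg : Feasible g) : Feasible fun x => Base.eqNat (f x) (g x) :=
  sub (const 1) (add (sub hf hg) (sub hg hf))

theorem low (hf : Feasible f) (hg : Feasible g) : Feasible fun x => (base x).low (f x) (g x) :=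
  iter (sub bound (add hg (const 1))) hf
    (ite (sub (pow2 (sub bound (add snd.fst (const 1)))) snd)
      (sub snd (pow2 (sub bound (add snd.fst (const 1))))) snd)

theorem bit (hf : Feasible f) (hg : Feasible g) : Feasible fun x => (base x).bit (f x) (g x) :=
  sub (const 1) (sub (pow2 hg) (low hf hg))

theorem times (hf : Feasible f) (hg : Feasible g) : Feasible fun x => (base x).times (f x) (g x) :=
  iter hf (const 0) (add snd hg.fst.fst)

theorem sets : Feasible fun x : α => (base x).sets := pow2 (mem (const 0))

theorem mulAt (hf : Feasible f) (hg : Feasible g) : Feasible fun x => (base x).mulAt (f x) (g x) :=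
  mem (add (const 3) (add (times hf (mem (const 0))) hg))

theorem smulAt (hf : Feasible f) (hg : Feasible g) :
    Feasible fun x => (base x).smulAt (f x) (g x) :=
  mem (add (add (const 3) (times (mem (const 0)) (mem (const 0))))
    (add (times hf (mem (const 1))) hg))

theorem powerAt (hf : Feasible f) : Feasible fun x => (base x).powerAt (f x) :=
  mem (add (add (add (const 3) (times (mem (const 0)) (mem (const 0))))
    (times (mem (const 0)) (mem (const 1)))) hf)

theorem letterAt (hf : Feasible f) : Feasible fun x => (base x).letterAt (f x) :=
  mem (add (add (add (add (const 3) (times (mem (const 0)) (mem (const 0))))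
    (times (mem (const 0)) (mem (const 1)))) (mem (const 0))) hf)

theorem leftAt (hf : Feasible f) : Feasible fun x => (base x).leftAt (f x) :=
  mem (add (add (add (add (add (const 3) (times (mem (const 0)) (mem (const 0))))
    (times (mem (const 0)) (mem (const 1)))) (mem (const 0))) (mem (const 2))) hf)

theorem rightAt (hf : Feasible f) : Feasible fun x => (base x).rightAt (f x) :=
  mem (add (add (add (add (add (add (const 3) (times (mem (const 0)) (mem (const 0))))
    (times (mem (const 0)) (mem (const 1)))) (mem (const 0))) (mem (const 2))) (mem (const 1))) hf)

theorem mulMask (hf : Feasible f) (hg : Feasible g) :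
    Feasible fun x => (base x).mulMask (f x) (g x) :=
  mask (mem (const 0)) (any (mem (const 0)) (ite (bit hf.fst.fst snd) (const 0)
    (any (mem (const 0)) (ite (bit hg.fst.fst.fst snd) (const 0)
      (eqNat (mulAt snd.fst snd) snd.fst.fst)))))

theorem powMask (hf : Feasible f) (hg : Feasible g) :
    Feasible fun x => (base x).powMask (f x) (g x) :=
  iter hg hf (mulMask snd hf.fst.fst)

theorem upowMask (hf : Feasible f) : Feasible fun x => (base x).upowMask (f x) :=
  mask (mem (const 0)) (any sets (bit (powMask hf.fst.fst (add sets snd)) snd.fst))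

theorem satInit : Feasible fun x : α => (base x).satInit :=
  mask sets (any (mem (const 2)) (eqNat snd.fst (pow2 (letterAt snd))))

theorem satStep (hf : Feasible f) : Feasible fun x => (base x).satStep (f x) :=
  mask sets (add (bit hf.fst snd) (any sets (ite (bit hf.fst.fst snd) (const 0)
    (add (eqNat snd.fst (upowMask snd)) (any sets (ite (bit hf.fst.fst.fst snd) (const 0)
      (eqNat snd.fst.fst (mulMask snd.fst snd))))))))

theorem sat : Feasible fun x : α => (base x).sat := iter sets satInit (satStep snd)

theorem hitsLeft (hf : Feasible f) (hg : Feasible g) :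
    Feasible fun x => (base x).hitsLeft (f x) (g x) :=
  any (mem (const 0)) (ite (bit hf.fst snd) (const 0) (any (mem (const 0))
    (ite (bit hg.fst.fst snd) (const 0) (eqNat (leftAt (smulAt snd.fst (powerAt snd))) (const 1)))))

theorem hitsRight (hf : Feasible f) (hg : Feasible g) :
    Feasible fun x => (base x).hitsRight (f x) (g x) :=
  any (mem (const 0)) (ite (bit hf.fst snd) (const 0) (any (mem (const 0))
    (ite (bit hg.fst.fst snd) (const 0) (eqNat (rightAt (smulAt snd.fst (powerAt snd))) (const 1)))))

theorem witness : Feasible fun x : α => (base x).witness :=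
  any sets (ite (bit sat snd) (const 0) (any sets (ite (bit sat snd) (const 0)
    (ite (hitsLeft snd.fst snd) (const 0) (hitsRight snd.fst snd)))))

end Feasible

end RAM


/-! ## Correctness of the saturation algorithm -/

namespace RAM

namespace Base

variable {b : Base} {n : ℕ}

theorem iter_eq (h : n ≤ b.bound) (a : ℕ) (f : ℕ → ℕ → ℕ) : b.iter n a f = loop n a f := by
  rw [iter, min_eq_left h]

theorem pow2_eq (h : n ≤ b.bound) : b.pow2 n = 2 ^ n := by
  rw [pow2, iter_eq h]
  clear h
  induction n with
  | zero => rfl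
  | succ n ih => rw [loop_succ, ih, pow_succ, mul_two]

theorem any_ne_zero (h : n ≤ b.bound) (c : ℕ → ℕ) : b.any n c ≠ 0 ↔ ∃ i < n, c i ≠ 0 := by
  rw [any, iter_eq h]
  clear h
  induction n with
  | zero => simp [loop_zero]
  | succ n ih =>
    rw [loop_succ]
    by_cases hn : c n = 0
    · rw [if_pos hn, ih]
      constructor
      · rintro ⟨i, hi, hc⟩
        exact ⟨i, by omega, hc⟩
      · rintro ⟨i, hi, hc⟩
        refine ⟨i, ?_, hc⟩
        have : i ≠ n := fun e => hc (e ▸ hn)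
        omega
    · rw [if_neg hn]
      exact iff_of_true one_ne_zero ⟨n, Nat.lt_succ_self n, hn⟩

theorem mask_spec (h : n ≤ b.bound) (c : ℕ → ℕ) :
    b.mask n c < 2 ^ n ∧ ∀ i, (b.mask n c).testBit i = true ↔ i < n ∧ c i ≠ 0 := by
  have key : ∀ m ≤ n, loop m 0 (fun i a => if c i = 0 then a else a + b.pow2 i) < 2 ^ m ∧
      ∀ i, (loop m 0 fun i a => if c i = 0 then a else a + b.pow2 i).testBit i = true ↔
        i < m ∧ c i ≠ 0 := by
    intro m hm
    induction m with
    | zero => simp [loop_zero]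
    | succ m ih =>
      obtain ⟨h1, h2⟩ := ih (by omega)
      rw [loop_succ, pow2_eq (by omega)]
      by_cases hc : c m = 0
      · rw [if_pos hc]
        refine ⟨h1.trans (Nat.pow_lt_pow_right one_lt_two (Nat.lt_succ_self m)), fun i => ?_⟩
        rw [h2]
        constructor
        · rintro ⟨hi, hci⟩
          exact ⟨by omega, hci⟩
        · rintro ⟨hi, hci⟩
          have : i ≠ m := fun e => hci (e ▸ hc)
          exact ⟨by omega, hci⟩
      · rw [if_neg hc]
        refine ⟨by rw [pow_succ]; omega, fun i => ?_⟩
        rw [Nat.add_comm]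
        rcases lt_trichotomy i m with hi | rfl | hi
        · rw [Nat.testBit_two_pow_add_gt hi, h2]
          simp [hi, hi.trans (Nat.lt_succ_self m)]
        · rw [Nat.testBit_two_pow_add_eq]
          have : (loop i 0 fun i a => if c i = 0 then a else a + b.pow2 i).testBit i = false :=
            Nat.testBit_lt_two_pow h1
          simp [this, hc]
        · rw [Nat.testBit_lt_two_pow (lt_of_lt_of_le (by rw [pow_succ]; omega)
            (Nat.pow_le_pow_right two_pos hi))]
          simp
          omega
  rw [mask, iter_eq h]
  exact key n le_rfl

theorem eqNat_ne_zero {x y : ℕ} : eqNat x y ≠ 0 ↔ x = y := by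
  unfold eqNat; omega

/-- Before turn `k` the value is `Z` modulo `2 ^ (bound - k)`; the turn subtracts the highest
remaining power of two if it occurs. -/
theorem low_eq {Z i : ℕ} (hZ : Z < 2 ^ b.bound) : b.low Z i = Z % 2 ^ (b.bound - (b.bound - (i + 1))) := by
  rw [low, iter_eq (Nat.sub_le _ _)]
  have hk : b.bound - (i + 1) ≤ b.bound := Nat.sub_le _ _
  generalize b.bound - (i + 1) = k at hk ⊢
  induction k with
  | zero => rw [loop_zero, Nat.sub_zero, Nat.mod_eq_of_lt hZ]
  | succ k ih =>
    rw [loop_succ, ih (by omega), pow2_eq (Nat.sub_le _ _)]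
    have e : b.bound - k = b.bound - (k + 1) + 1 := by omega
    rw [e, pow_succ, Nat.mod_mul]
    have h1 : Z % 2 ^ (b.bound - (k + 1)) < 2 ^ (b.bound - (k + 1)) :=
      Nat.mod_lt _ (by positivity)
    rcases Nat.mod_two_eq_zero_or_one (Z / 2 ^ (b.bound - (k + 1))) with h | h <;> rw [h]
    · rw [mul_zero, add_zero, if_neg (by omega)]
    · rw [mul_one, if_pos (by omega), Nat.add_sub_cancel]

theorem bit_ne_zero {Z i : ℕ} (hZ : Z < 2 ^ b.bound) (hi : i < b.bound) :
    b.bit Z i ≠ 0 ↔ Z.testBit i = true := by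
  rw [bit, low_eq hZ, pow2_eq hi.le, show b.bound - (b.bound - (i + 1)) = i + 1 by omega, pow_succ,
    Nat.mod_mul, Nat.testBit_eq_decide_div_mod_eq, decide_eq_true_iff]
  have h1 : Z % 2 ^ i < 2 ^ i := Nat.mod_lt _ (by positivity)
  rcases Nat.mod_two_eq_zero_or_one (Z / 2 ^ i) with h | h <;> rw [h]
  · simp; omega
  · simp

/-- Only the first factor has to be below the bound. The second one may be the size of `T`, which
the bound does not control; no loop runs over `T`. -/
theorem times_eq {s : ℕ} (hs : s ≤ b.bound) (k : ℕ) : b.times s k = s * k := by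
  rw [times, iter_eq hs]
  clear hs
  induction s with
  | zero => simp [loop_zero]
  | succ s ih => rw [loop_succ, ih, Nat.succ_mul]

end Base

/-- The set of elements whose numbers are the positions of the digits `1`. -/
def toSet {S : Type*} {m : ℕ} (eS : S ≃ Fin m) (X : ℕ) : Set S := {s | X.testBit (eS s) = true}

section

variable {S : Type*} {m : ℕ} (eS : S ≃ Fin m)

theorem toSet_injOn {X Y : ℕ} (hX : X < 2 ^ m) (hY : Y < 2 ^ m) (h : toSet eS X = toSet eS Y) :
    X = Y := by
  refine Nat.eq_of_testBit_eq fun i => ?_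
  by_cases hi : i < m
  · have := Set.ext_iff.1 h (eS.symm ⟨i, hi⟩)
    exact Bool.eq_iff_iff.2 (by simpa [toSet] using this)
  · have hm : 2 ^ m ≤ 2 ^ i := Nat.pow_le_pow_right two_pos (by omega)
    rw [Nat.testBit_lt_two_pow (hX.trans_le hm), Nat.testBit_lt_two_pow (hY.trans_le hm)]

theorem exists_toSet (T : Set S) : ∃ X < 2 ^ m, toSet eS X = T := by
  classical
  let b : Base := ⟨fun _ => 0, m⟩
  obtain ⟨h1, h2⟩ := b.mask_spec (n := m) le_rfl fun i =>
    if ∃ s ∈ T, (eS s : ℕ) = i then 1 else 0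
  refine ⟨_, h1, Set.ext fun s => ?_⟩
  simp only [toSet, Set.mem_ofPred_eq, h2]
  simp [Fin.val_inj]

end

/-- An increasing sequence of subsets of a finite set becomes stationary. -/
theorem exists_stationary {N : ℕ} {A : ℕ → Finset ℕ} (hA : ∀ i, A i ⊆ Finset.range N)
    (hmono : ∀ i, A i ⊆ A (i + 1)) : ∃ i ≤ N, A i = A (i + 1) := by
  by_contra! h
  have key : ∀ i ≤ N + 1, i ≤ (A i).card := by
    intro i hi
    induction i with
    | zero => exact Nat.zero_le _
    | succ i ih =>
      have := Finset.card_lt_card ((hmono i).ssubset_of_ne (h i (by omega)))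
      have := ih (by omega)
      omega
  have h1 := key (N + 1) le_rfl
  have h2 := Finset.card_le_card (hA (N + 1))
  rw [Finset.card_range] at h2
  omega

theorem ite_ne_zero {c d : ℕ} : (if c = 0 then 0 else d) ≠ 0 ↔ c ≠ 0 ∧ d ≠ 0 := by
  split_ifs with h <;> simp [h]

theorem exists_lt_iff {S : Type*} {m : ℕ} (e : S ≃ Fin m) {p : ℕ → Prop} :
    (∃ i < m, p i) ↔ ∃ s, p (e s) :=
  ⟨fun ⟨i, hi, h⟩ => ⟨e.symm ⟨i, hi⟩, by simpa using h⟩, fun ⟨s, h⟩ => ⟨e s, (e s).2, h⟩⟩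

open Sat OmegaSemigroup
open scoped Pointwise

/-- An input stands in the memory, and the bound is large enough for the algorithm. -/
structure Adequate {A S T : Type*} [Semigroup S] [OmegaSemigroup S T] {n m k : ℕ}
    (eA : A ≃ Fin n) (eS : S ≃ Fin m) (eT : T ≃ Fin k)
    (α : OmegaHom (FreeSemigroup A) (Stream' A) S T) (F₀ F₁ : Set T) (b : Base) : Prop
    extends IsPresented eA eS eT α F₀ F₁ b.mem where
  two_mul_le : 2 * 2 ^ m ≤ b.bound
  letters_le : n ≤ b.bound

namespace Adequate

variable {A S T : Type*} [Semigroup S] [OmegaSemigroup S T] {n m k : ℕ}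
  {eA : A ≃ Fin n} {eS : S ≃ Fin m} {eT : T ≃ Fin k}
  {α : OmegaHom (FreeSemigroup A) (Stream' A) S T} {F₀ F₁ : Set T} {b : Base}

theorem two_pow_le (h : Adequate eA eS eT α F₀ F₁ b) : 2 ^ m ≤ b.bound :=
  (Nat.le_mul_of_pos_left _ two_pos).trans h.two_mul_le

theorem size_le (h : Adequate eA eS eT α F₀ F₁ b) : m ≤ b.bound :=
  Nat.lt_two_pow_self.le.trans h.two_pow_le

theorem sets_eq (h : Adequate eA eS eT α F₀ F₁ b) : b.sets = 2 ^ m := by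
  rw [Base.sets, h.size_fin, Base.pow2_eq h.size_le]

theorem bit_mask (h : Adequate eA eS eT α F₀ F₁ b) {X : ℕ} (hX : X < 2 ^ m) (s : S) :
    b.bit X (eS s) ≠ 0 ↔ s ∈ toSet eS X :=
  Base.bit_ne_zero (hX.trans_le (Nat.pow_le_pow_right two_pos h.size_le)) ((eS s).2.trans_le h.size_le)

theorem bit_family (h : Adequate eA eS eT α F₀ F₁ b) {Z X : ℕ} (hZ : Z < 2 ^ 2 ^ m)
    (hX : X < 2 ^ m) : b.bit Z X ≠ 0 ↔ Z.testBit X = true :=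
  Base.bit_ne_zero (hZ.trans_le (Nat.pow_le_pow_right two_pos h.two_pow_le)) (hX.trans_le h.two_pow_le)

theorem mulAt_eq (h : Adequate eA eS eT α F₀ F₁ b) (s t : S) :
    b.mulAt (eS s) (eS t) = eS (s * t) := by
  rw [Base.mulAt, Base.times_eq ((eS s).2.le.trans h.size_le), h.size_fin, h.mul]

theorem smulAt_eq (h : Adequate eA eS eT α F₀ F₁ b) (s : S) (t : T) :
    b.smulAt (eS s) (eT t) = eT (s • t) := by
  rw [Base.smulAt, Base.times_eq ((eS s).2.le.trans h.size_le), h.size_fin, h.size_inf,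
    Base.times_eq h.size_le, h.smul]

theorem powerAt_eq (h : Adequate eA eS eT α F₀ F₁ b) (s : S) :
    b.powerAt (eS s) = eT (iprod (Stream'.const s)) := by
  rw [Base.powerAt, h.size_fin, h.size_inf, Base.times_eq h.size_le, Base.times_eq h.size_le,
    h.power]

theorem letterAt_eq (h : Adequate eA eS eT α F₀ F₁ b) (a : A) :
    b.letterAt (eA a) = eS (img α.fin a) := by
  rw [Base.letterAt, h.size_fin, h.size_inf, Base.times_eq h.size_le, Base.times_eq h.size_le,
    h.letter]

theorem leftAt_eq (h : Adequate eA eS eT α F₀ F₁ b) (t : T) : b.leftAt (eT t) = 1 ↔ t ∈ F₀ := by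
  rw [Base.leftAt, h.size_fin, h.size_inf, h.size_letters, Base.times_eq h.size_le,
    Base.times_eq h.size_le, h.left]

theorem rightAt_eq (h : Adequate eA eS eT α F₀ F₁ b) (t : T) : b.rightAt (eT t) = 1 ↔ t ∈ F₁ := by
  rw [Base.rightAt, h.size_fin, h.size_inf, h.size_letters, Base.times_eq h.size_le,
    Base.times_eq h.size_le, h.right]

theorem any_size (h : Adequate eA eS eT α F₀ F₁ b) (c : ℕ → ℕ) :
    b.any m c ≠ 0 ↔ ∃ s : S, c (eS s) ≠ 0 := by
  rw [Base.any_ne_zero h.size_le]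
  exact exists_lt_iff eS (p := fun i => c i ≠ 0)

theorem mulMask_spec (h : Adequate eA eS eT α F₀ F₁ b) {X Y : ℕ} (hX : X < 2 ^ m)
    (hY : Y < 2 ^ m) :
    b.mulMask X Y < 2 ^ m ∧ toSet eS (b.mulMask X Y) = toSet eS X * toSet eS Y := by
  obtain ⟨h1, h2⟩ := b.mask_spec (n := m) h.size_le fun u => b.any (b.mem 0) fun s =>
    if b.bit X s = 0 then 0 else b.any (b.mem 0) fun t =>
      if b.bit Y t = 0 then 0 else Base.eqNat (b.mulAt s t) u
  rw [Base.mulMask, h.size_fin] at *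
  refine ⟨h1, Set.ext fun u => ?_⟩
  rw [toSet, Set.mem_ofPred_eq, h2, Set.mem_mul]
  simp only [h.any_size, ite_ne_zero, h.bit_mask hX, h.bit_mask hY, h.mulAt_eq,
    Base.eqNat_ne_zero, Fin.val_inj, eS.injective.eq_iff]
  simp

theorem powMask_spec (h : Adequate eA eS eT α F₀ F₁ b) {X : ℕ} (hX : X < 2 ^ m) {i : ℕ}
    (hi : i ≤ b.bound) :
    b.powMask X i < 2 ^ m ∧ toSet eS (b.powMask X i) = ppow (toSet eS X) i := by
  rw [Base.powMask, Base.iter_eq hi]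
  clear hi
  induction i with
  | zero => exact ⟨hX, rfl⟩
  | succ i ih =>
    rw [loop_succ]
    obtain ⟨h1, h2⟩ := h.mulMask_spec ih.1 hX
    exact ⟨h1, by rw [h2, ih.2, ppow]⟩

theorem upowMask_spec (h : Adequate eA eS eT α F₀ F₁ b) {X : ℕ} (hX : X < 2 ^ m) :
    b.upowMask X < 2 ^ m ∧ toSet eS (b.upowMask X) = upow (2 ^ m) (toSet eS X) := by
  rw [Base.upowMask, h.sets_eq, h.size_fin]
  obtain ⟨h1, h2⟩ := b.mask_spec (n := m) h.size_le fun u =>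
    b.any (2 ^ m) fun i => b.bit (b.powMask X (2 ^ m + i)) u
  refine ⟨h1, Set.ext fun u => ?_⟩
  rw [toSet, Set.mem_ofPred_eq, h2, Base.any_ne_zero h.two_pow_le, upow, Set.mem_ofPred_eq]
  have := h.two_mul_le
  constructor
  · rintro ⟨-, i, hi, hu⟩
    obtain ⟨h3, h4⟩ := h.powMask_spec hX (i := 2 ^ m + i) (by omega)
    rw [h.bit_mask h3, h4] at hu
    exact ⟨i, hi, hu⟩
  · rintro ⟨i, hi, hu⟩
    obtain ⟨h3, h4⟩ := h.powMask_spec hX (i := 2 ^ m + i) (by omega)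
    exact ⟨(eS u).2, i, hi, by rwa [h.bit_mask h3, h4]⟩

theorem satInit_spec (h : Adequate eA eS eT α F₀ F₁ b) : b.satInit < 2 ^ 2 ^ m ∧
    ∀ X, b.satInit.testBit X = true ↔ X < 2 ^ m ∧ ∃ a, toSet eS X = {img α.fin a} := by
  rw [Base.satInit, h.sets_eq, h.size_letters]
  obtain ⟨h1, h2⟩ := b.mask_spec (n := 2 ^ m) h.two_pow_le fun X =>
    b.any n fun a => Base.eqNat X (b.pow2 (b.letterAt a))
  refine ⟨h1, fun X => ?_⟩
  rw [h2, Base.any_ne_zero h.letters_le]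
  simp only [Base.eqNat_ne_zero]
  rw [exists_lt_iff eA (p := fun a => X = b.pow2 (b.letterAt a))]
  refine and_congr_right fun hX => exists_congr fun a => ?_
  rw [h.letterAt_eq, Base.pow2_eq ((eS _).2.le.trans h.size_le)]
  have e : toSet eS (2 ^ (eS (img α.fin a) : ℕ)) = {img α.fin a} := by
    ext s
    simp [toSet, Nat.testBit_two_pow, Fin.val_inj, eq_comm]
  constructor
  · rintro rfl
    exact e
  · intro hs
    exact toSet_injOn eS hX (Nat.pow_lt_pow_right one_lt_two (eS _).2) (hs.trans e.symm)

theorem satStep_spec (h : Adequate eA eS eT α F₀ F₁ b) {Z : ℕ} (hZ : Z < 2 ^ 2 ^ m) :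
    b.satStep Z < 2 ^ 2 ^ m ∧ ∀ V, (b.satStep Z).testBit V = true ↔ V < 2 ^ m ∧
      (Z.testBit V = true ∨ ∃ X < 2 ^ m, Z.testBit X = true ∧ (V = b.upowMask X ∨
        ∃ Y < 2 ^ m, Z.testBit Y = true ∧ V = b.mulMask X Y)) := by
  rw [Base.satStep, h.sets_eq]
  obtain ⟨h1, h2⟩ := b.mask_spec (n := 2 ^ m) h.two_pow_le fun V => b.bit Z V + b.any (2 ^ m) fun X =>
    if b.bit Z X = 0 then 0 else Base.eqNat V (b.upowMask X) + b.any (2 ^ m) fun Y =>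
      if b.bit Z Y = 0 then 0 else Base.eqNat V (b.mulMask X Y)
  refine ⟨h1, fun V => ?_⟩
  have hadd : ∀ x y : ℕ, x + y ≠ 0 ↔ x ≠ 0 ∨ y ≠ 0 := by omega
  rw [h2]
  refine and_congr_right fun hV => ?_
  simp only [hadd, h.bit_family hZ hV, Base.any_ne_zero h.two_pow_le, ite_ne_zero,
    Base.eqNat_ne_zero]
  refine or_congr_right (exists_congr fun X => and_congr_right fun hX => ?_)
  rw [h.bit_family hZ hX]
  refine and_congr_right fun _ => or_congr_right (exists_congr fun Y => and_congr_right fun hY => ?_)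
  rw [h.bit_family hZ hY]

/-- A family of subsets of `S` is coded by a number below `2 ^ 2 ^ m`. The rounds produce an
increasing sequence of families of at most `2 ^ m` sets, so it is stationary after `2 ^ m` rounds,
and a stationary family is closed under both operations. -/
theorem sat_spec (h : Adequate eA eS eT α F₀ F₁ b) : b.sat < 2 ^ 2 ^ m ∧
    ∀ X < 2 ^ m, b.sat.testBit X = true ↔ IsSat (img α.fin) (toSet eS X) := by
  have hm : Nat.card S = m := by rw [Nat.card_congr eS, Nat.card_fin]
  rw [Base.sat, h.sets_eq, Base.iter_eq h.two_pow_le]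
  set z : ℕ → ℕ := fun i => loop i b.satInit fun _ Z => b.satStep Z with hz
  have hlt : ∀ i, z i < 2 ^ 2 ^ m := by
    intro i
    induction i with
    | zero => exact h.satInit_spec.1
    | succ i ih => exact (h.satStep_spec ih).1
  have hmono : ∀ i V, (z i).testBit V = true → (z (i + 1)).testBit V = true := by
    intro i V hV
    have : V < 2 ^ m := by
      by_contra hV'
      rw [Nat.testBit_lt_two_pow ((hlt i).trans_le (Nat.pow_le_pow_right two_pos (by omega)))] at hV
      simp at hV
    exact ((h.satStep_spec (hlt i)).2 V).2 ⟨this, Or.inl hV⟩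
  have hsound : ∀ i V, (z i).testBit V = true → IsSat (img α.fin) (toSet eS V) := by
    intro i
    induction i with
    | zero =>
      intro V hV
      obtain ⟨-, a, ha⟩ := (h.satInit_spec.2 V).1 hV
      rw [ha]
      exact .letter a
    | succ i ih =>
      intro V hV
      obtain ⟨-, hV | ⟨X, hX, hX', rfl | ⟨Y, hY, hY', rfl⟩⟩⟩ := ((h.satStep_spec (hlt i)).2 V).1 hV
      · exact ih V hV
      · rw [(h.upowMask_spec hX).2]
        have := (ih X hX').pow
        rwa [hm] at this
      · rw [(h.mulMask_spec hX hY).2]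
        exact (ih X hX').mul (ih Y hY')
  obtain ⟨i, hi, hstat⟩ : ∃ i ≤ 2 ^ m, z i = z (i + 1) := by
    obtain ⟨i, hi, hA⟩ := exists_stationary (N := 2 ^ m)
      (A := fun i => (Finset.range (2 ^ m)).filter fun V => (z i).testBit V = true)
      (fun i => Finset.filter_subset _ _)
      (fun i => Finset.monotone_filter_right _ fun V _ hV => hmono i V hV)
    refine ⟨i, hi, Nat.eq_of_testBit_eq fun V => ?_⟩
    by_cases hV : V < 2 ^ m
    · have := Finset.ext_iff.1 hA V
      exact Bool.eq_iff_iff.2 (by simpa [hV] using this)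
    · have e : 2 ^ 2 ^ m ≤ 2 ^ V := Nat.pow_le_pow_right two_pos (by omega)
      rw [Nat.testBit_lt_two_pow ((hlt i).trans_le e),
        Nat.testBit_lt_two_pow ((hlt (i + 1)).trans_le e)]
  have hconst : ∀ j, z (i + j) = z i := by
    intro j
    induction j with
    | zero => rfl
    | succ j ih =>
      change b.satStep (z (i + j)) = _
      rw [ih]
      exact hstat.symm
  have hclosed : b.satStep (z (2 ^ m)) = z (2 ^ m) := by
    have := hconst (2 ^ m - i)
    rw [Nat.add_sub_cancel' hi] at this
    rw [this]
    exact hstat.symm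
  have hinit : ∀ i V, (z 0).testBit V = true → (z i).testBit V = true := by
    intro i V hV
    induction i with
    | zero => exact hV
    | succ i ih => exact hmono i V ih
  refine ⟨hlt _, fun X hX => ⟨hsound _ X, fun hs => ?_⟩⟩
  change (z (2 ^ m)).testBit X = true
  generalize hTX : toSet eS X = T at hs
  induction hs generalizing X with
  | letter a => exact hinit _ _ ((h.satInit_spec.2 X).2 ⟨hX, a, hTX⟩)
  | @mul U V _ _ ihU ihV =>
    obtain ⟨Y, hY, rfl⟩ := exists_toSet eS U
    obtain ⟨Y', hY', rfl⟩ := exists_toSet eS V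
    rw [← hclosed]
    have e := h.mulMask_spec hY hY'
    exact ((h.satStep_spec (hlt _)).2 X).2 ⟨hX, Or.inr ⟨Y, hY, ihU Y hY rfl, Or.inr
      ⟨Y', hY', ihV Y' hY' rfl, toSet_injOn eS hX e.1 (hTX.trans e.2.symm)⟩⟩⟩
  | @pow U _ ihU =>
    obtain ⟨Y, hY, rfl⟩ := exists_toSet eS U
    rw [← hclosed]
    have e := h.upowMask_spec hY
    rw [hm] at hTX
    exact ((h.satStep_spec (hlt _)).2 X).2 ⟨hX, Or.inr ⟨Y, hY, ihU Y hY rfl, Or.inl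
      (toSet_injOn eS hX e.1 (hTX.trans e.2.symm))⟩⟩

theorem hitsLeft_ne_zero (h : Adequate eA eS eT α F₀ F₁ b) {X E : ℕ} (hX : X < 2 ^ m)
    (hE : E < 2 ^ m) : b.hitsLeft X E ≠ 0 ↔ ∃ x ∈ toSet eS X, ∃ e ∈ toSet eS E,
      x • (iprod (Stream'.const e) : T) ∈ F₀ := by
  rw [Base.hitsLeft, h.size_fin]
  simp only [h.any_size, ite_ne_zero, h.bit_mask hX, h.bit_mask hE, h.powerAt_eq, h.smulAt_eq,
    Base.eqNat_ne_zero, h.leftAt_eq]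

theorem hitsRight_ne_zero (h : Adequate eA eS eT α F₀ F₁ b) {X E : ℕ} (hX : X < 2 ^ m)
    (hE : E < 2 ^ m) : b.hitsRight X E ≠ 0 ↔ ∃ x ∈ toSet eS X, ∃ e ∈ toSet eS E,
      x • (iprod (Stream'.const e) : T) ∈ F₁ := by
  rw [Base.hitsRight, h.size_fin]
  simp only [h.any_size, ite_ne_zero, h.bit_mask hX, h.bit_mask hE, h.powerAt_eq, h.smulAt_eq,
    Base.eqNat_ne_zero, h.rightAt_eq]

theorem witness_eq_zero (h : Adequate eA eS eT α F₀ F₁ b) :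
    b.witness = 0 ↔ ∀ p ∈ F₀, ∀ q ∈ F₁, ¬ Close (img α.fin) p q := by
  rw [← not_iff_not, ← ne_eq, Base.witness, h.sets_eq, Base.any_ne_zero h.two_pow_le]
  push Not
  simp only [ite_ne_zero]
  constructor
  · rintro ⟨X, hX, hXs, hE⟩
    rw [Base.any_ne_zero h.two_pow_le] at hE
    obtain ⟨E, hE, hE'⟩ := hE
    simp only [ite_ne_zero] at hE'
    obtain ⟨hEs, hl, hr⟩ := hE'
    rw [h.bit_family h.sat_spec.1 hX, h.sat_spec.2 X hX] at hXs
    rw [h.bit_family h.sat_spec.1 hE, h.sat_spec.2 E hE] at hEs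
    obtain ⟨x, hx, e, he, hp⟩ := (h.hitsLeft_ne_zero hX hE).1 hl
    obtain ⟨y, hy, f, hf, hq⟩ := (h.hitsRight_ne_zero hX hE).1 hr
    exact ⟨_, hp, _, hq, _, _, hXs, hEs, x, hx, y, hy, e, he, f, hf, rfl, rfl⟩
  · rintro ⟨p, hp, q, hq, U, V, hU, hV, x, hx, y, hy, e, he, f, hf, rfl, rfl⟩
    obtain ⟨X, hX, rfl⟩ := exists_toSet eS U
    obtain ⟨E, hE, rfl⟩ := exists_toSet eS V
    refine ⟨X, hX, ?_, ?_⟩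
    · rwa [h.bit_family h.sat_spec.1 hX, h.sat_spec.2 X hX]
    · rw [Base.any_ne_zero h.two_pow_le]
      refine ⟨E, hE, ?_⟩
      simp only [ite_ne_zero]
      rw [h.bit_family h.sat_spec.1 hE, h.sat_spec.2 E hE]
      exact ⟨hV, (h.hitsLeft_ne_zero hX hE).2 ⟨x, hx, e, he, hp⟩,
        (h.hitsRight_ne_zero hX hE).2 ⟨y, hy, f, hf, hq⟩⟩

end Adequate

end RAM


/-! ## The random access machine -/

namespace RAM

theorem exists_eval_le (T : Polynomial ℕ) : ∃ a d, ∀ c, T.eval c ≤ a * (c + 1) ^ d := by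
  induction T using Polynomial.induction_on' with
  | add p q hp hq =>
    obtain ⟨a, d, h⟩ := hp
    obtain ⟨a', d', h'⟩ := hq
    refine ⟨a + a', d + d', fun c => ?_⟩
    rw [Polynomial.eval_add, add_mul]
    have e : ∀ {i j : ℕ}, i ≤ j → (c + 1) ^ i ≤ (c + 1) ^ j := fun hij =>
      Nat.pow_le_pow_right (Nat.succ_pos c) hij
    exact Nat.add_le_add ((h c).trans (Nat.mul_le_mul_left _ (e (by omega))))
      ((h' c).trans (Nat.mul_le_mul_left _ (e (by omega))))
  | monomial n a =>
    refine ⟨a, n, fun c => ?_⟩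
    rw [Polynomial.eval_monomial]
    exact Nat.mul_le_mul_left _ (Nat.pow_le_pow_left (Nat.le_succ c) n)

/-- Since `T.eval c ≤ a * (c + 1) ^ d` and `2 * 2 ^ m + n + 1 ≤ 2 ^ m * (n + 3)`, the dependence on
`m` and the dependence on `n` separate into two factors. -/
theorem exists_exp_bound (T : Polynomial ℕ) : ∃ p q : Polynomial ℕ,
    ∀ m n, T.eval (2 * 2 ^ m + n) ≤ 2 ^ p.eval m * q.eval n := by
  obtain ⟨a, d, h⟩ := exists_eval_le T
  refine ⟨.X * .C d, .C a * (.X + .C 3) ^ d, fun m n => (h _).trans ?_⟩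
  simp only [Polynomial.eval_mul, Polynomial.eval_C, Polynomial.eval_X, Polynomial.eval_pow,
    Polynomial.eval_add]
  have h1 : 2 * 2 ^ m + n + 1 ≤ 2 ^ m * (n + 3) := by
    have : 1 ≤ 2 ^ m := Nat.one_le_two_pow
    nlinarith
  calc a * (2 * 2 ^ m + n + 1) ^ d ≤ a * (2 ^ m * (n + 3)) ^ d :=
        Nat.mul_le_mul_left _ (Nat.pow_le_pow_left h1 d)
    _ = 2 ^ (m * d) * (a * (n + 3) ^ d) := by rw [mul_pow, ← pow_mul]; ring

/-- A program that puts the bound for the loops into register `0`. -/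
def prelude : Prog :=
  .seq (.seq (.seq (.const 1 0) (.load 2 1)) (.seq (.const 3 2) (.load 4 3)))
    (.seq (.seq (.const 5 1) (.const 6 2))
      (.seq (.loop 2 (.seq (.add 6 6 6) (.sub 2 2 5))) (.add 0 6 4)))

theorem doubling_runs (r : ℕ) (s : State) (h2 : s.reg 2 = r) (h5 : s.reg 5 = 1) :
    ∃ s', Runs (.loop 2 (.seq (.add 6 6 6) (.sub 2 2 5))) s (3 * r + 1) s' ∧ s'.mem = s.mem ∧
      s'.reg 4 = s.reg 4 ∧ s'.reg 6 = 2 ^ r * s.reg 6 := by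
  induction r generalizing s with
  | zero => exact ⟨s, .loop_false h2, rfl, rfl, by simp⟩
  | succ r ih =>
    obtain ⟨σ, hσ, hm, h4', h6', h2', h5'⟩ : ∃ σ, Runs (.seq (.add 6 6 6) (.sub 2 2 5)) s 2 σ ∧
        σ.mem = s.mem ∧ σ.reg 4 = s.reg 4 ∧ σ.reg 6 = 2 * s.reg 6 ∧ σ.reg 2 = r ∧ σ.reg 5 = 1 :=
      ⟨_, .seq (.add _ _ _ _) (.sub _ _ _ _), rfl, by simp [State.setReg],
        by simp [State.setReg, two_mul], by simp [State.setReg, h2, h5],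
        by simp [State.setReg, h5]⟩
    obtain ⟨s', h, k1, k2, k3⟩ := ih σ h2' h5'
    refine ⟨s', ?_, k1.trans hm, k2.trans h4', by rw [k3, h6', pow_succ, mul_assoc]⟩
    have := Runs.loop_true (by omega) hσ h
    rwa [show 2 + (3 * r + 1) + 1 = 3 * (r + 1) + 1 by omega] at this

/-- The value left in register `0` caps all loops: `upowMask` takes powers with exponents up to `2 *
2 ^ m`, and `satInit` runs over the `n` letters. -/
theorem prelude_runs (s : State) : ∃ s', Runs prelude s (3 * s.mem 0 + 8) s' ∧ s'.mem = s.mem ∧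
    s'.reg 0 = 2 * 2 ^ s.mem 0 + s.mem 2 := by
  obtain ⟨σ, hσ, hm, h2, h4⟩ : ∃ σ, Runs (.seq (.seq (.const 1 0) (.load 2 1))
      (.seq (.const 3 2) (.load 4 3))) s 4 σ ∧ σ.mem = s.mem ∧ σ.reg 2 = s.mem 0 ∧
      σ.reg 4 = s.mem 2 :=
    ⟨_, .seq (.seq (.const _ _ _) (.load _ _ _)) (.seq (.const _ _ _) (.load _ _ _)), rfl,
      by simp [State.setReg], by simp [State.setReg]⟩
  obtain ⟨τ, hτ, km, k2, k4, k5, k6⟩ : ∃ τ, Runs (.seq (.const 5 1) (.const 6 2)) σ 2 τ ∧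
      τ.mem = s.mem ∧ τ.reg 2 = s.mem 0 ∧ τ.reg 4 = s.mem 2 ∧ τ.reg 5 = 1 ∧ τ.reg 6 = 2 :=
    ⟨_, .seq (.const _ _ _) (.const _ _ _), hm, by simp [State.setReg, h2],
      by simp [State.setReg, h4], by simp [State.setReg], by simp [State.setReg]⟩
  obtain ⟨υ, hυ, lm, l4, l6⟩ := doubling_runs (s.mem 0) τ k2 k5
  refine ⟨υ.setReg 0 (υ.reg 6 + υ.reg 4), ?_, lm.trans km, ?_⟩
  · have := Runs.seq hσ (.seq hτ (.seq hυ (.add 0 6 4 υ)))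
    rw [show 4 + (2 + (3 * s.mem 0 + 1 + 1)) = 3 * s.mem 0 + 8 by omega] at this
    exact this
  · simp [State.setReg, l4, l6, k4, k6, mul_comm]

theorem exists_prog_decides : ∃ (P : Prog) (p q : Polynomial ℕ),
    ∀ {A S T : Type*} [Semigroup S] [OmegaSemigroup S T] {n m k : ℕ}
      (eA : A ≃ Fin n) (eS : S ≃ Fin m) (eT : T ≃ Fin k)
      (α : OmegaHom (FreeSemigroup A) (Stream' A) S T) (F₀ F₁ : Set T),
      DecidesWithin P (presentation eA eS eT α F₀ F₁) (2 ^ p.eval m * q.eval n)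
        (∀ p ∈ F₀, ∀ q ∈ F₁, ¬ Sat.Close (Sat.img α.fin) p q) := by
  obtain ⟨T, hT⟩ := Feasible.witness (α := Base)
  obtain ⟨W, hW⟩ := hT () 1
  -- The added polynomial pays for the `3 * m + 8` steps of the prelude and the two final
  -- instructions, which negate the result by computing `1 - witness`.
  obtain ⟨p, q, hpq⟩ := exists_exp_bound (T + (3 * .X + 10))
  refine ⟨.seq prelude (.seq W (.seq (.const 0 1) (.sub 0 0 1))), p, q, ?_⟩
  intro A S T' _ _ n m k eA eS eT α F₀ F₁
  have hp := presentation_isPresented eA eS eT α F₀ F₁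
  obtain ⟨s, h1, h2, h3⟩ := prelude_runs (init (presentation eA eS eT α F₀ F₁))
  have e0 : (init (presentation eA eS eT α F₀ F₁)).mem 0 = m := hp.size_fin
  have e2 : (init (presentation eA eS eT α F₀ F₁)).mem 2 = n := hp.size_letters
  rw [e0] at h1
  rw [e0, e2] at h3
  let b : Base := ⟨(init (presentation eA eS eT α F₀ F₁)).mem, 2 * 2 ^ m + n⟩
  have hb : Adequate eA eS eT α F₀ F₁ b :=
    { hp with
      two_mul_le := Nat.le_add_right _ _
      letters_le := Nat.le_add_left _ _ }
  obtain ⟨t, s', k1, k2, -, -, k5⟩ := hW b s ⟨Nat.one_pos, h2, h3⟩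
  have k2 : t ≤ T.eval (2 * 2 ^ m + n) := k2
  have k5 : s'.reg 1 = b.witness := k5
  refine ⟨_, _, .seq h1 (.seq k1 (.seq (.const _ _ _) (.sub _ _ _ _))), ?_, ?_⟩
  · refine le_trans ?_ (hpq m n)
    simp only [Polynomial.eval_add, Polynomial.eval_mul, Polynomial.eval_X, Polynomial.eval_ofNat]
    have : m < 2 ^ m := Nat.lt_two_pow_self
    omega
  · rw [← hb.witness_eq_zero]
    simp [State.setReg, k5]
    omega

end RAM

/-! ### The decision procedure and the separator combined -/

theorem mainTheorem5 :
    (∃ (P : RAM.Prog) (p q : Polynomial ℕ),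
      ∀ (A S T : Type*) [Fintype A] [Fintype S] [Fintype T] [Semigroup S] [OmegaSemigroup S T]
        (eA : A ≃ Fin (Fintype.card A)) (eS : S ≃ Fin (Fintype.card S))
        (eT : T ≃ Fin (Fintype.card T))
        (α : OmegaHom (FreeSemigroup A) (Stream' A) S T) (F₀ F₁ : Set T),
        RAM.DecidesWithin P (presentation eA eS eT α F₀ F₁)
          (2 ^ p.eval (Fintype.card S) * q.eval (Fintype.card A))
          (FOWord.Separable (α.inf ⁻¹' F₀) (α.inf ⁻¹' F₁))) ∧
    (∃ f : List ℕ → List ℕ, Computable f ∧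
      ∀ (A S T : Type*) [Fintype A] [Fintype S] [Fintype T] [Semigroup S] [OmegaSemigroup S T]
        (eA : A ≃ Fin (Fintype.card A)) (eS : S ≃ Fin (Fintype.card S))
        (eT : T ≃ Fin (Fintype.card T))
        (α : OmegaHom (FreeSemigroup A) (Stream' A) S T) (F₀ F₁ : Set T),
        FOWord.Separable (α.inf ⁻¹' F₀) (α.inf ⁻¹' F₁) →
          ∃ φ : (FOWord.lang A).Sentence,
            f (presentation eA eS eT α F₀ F₁) = FOWord.code (fun a => (eA a : ℕ)) φ ∧
            FOWord.qrank φ ≤ Fintype.card A * 2 ^ (Fintype.card S ^ 2) + 1 ∧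
            FOWord.Separates (FOWord.langOf φ) (α.inf ⁻¹' F₀) (α.inf ⁻¹' F₁)) := by
  obtain ⟨P, p, q, h⟩ := RAM.exists_prog_decides
  refine ⟨⟨P, p, q, ?_⟩, FOWord.sepCode, FOWord.primrec_sepCode.to_comp, ?_⟩
  · intro A S T _ _ _ _ _ eA eS eT α F₀ F₁
    rw [FOWord.separable_iff]
    exact h eA eS eT α F₀ F₁
  · intro A S T _ _ _ _ _ eA eS eT α F₀ F₁ hs
    exact FOWord.exists_separator (presentation_isPresented eA eS eT α F₀ F₁) hs
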